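/- Let $N\ge 4$ and write $\mathbb R^N=\mathbb R^2\times\mathbb R^{N-2}\ni x=(z,y)$, $2^*=\frac{2N}{N-2}$. Let $\mathcal D^{1,2}(\mathbb R^N)$ be the closure of the real-valued smooth functions with compact support with respect to the Dirichlet norm $\big(\int_{\mathbb R^N}|\nabla u|^2\,dx\big)^{1/2}$ (realized, via Sobolev's inequality, as a space of functions in $L^{2^*}(\mathbb R^N)$ with gradient in $L^2$), and let $\mathcal D^{1,2}_{\rm circ}(\mathbb R^N)$ be the set of those $u\in\mathcal D^{1,2}(\mathbb R^N)$ that depend only on $(|z|,|y|)$, i.e. $u(z,y)=u(|z|,|y|)$ almost everywhere. For every real $\lambda_0<\frac{(N-2)^2}{4}$ the infimum $$ S_{\rm circ}(\lambda_0)=\inf_{\substack{u\in\mathcal D^{1,2}_{\rm circ}(\mathbb R^N)\\ u\not\equiv 0}} \frac{\displaystyle\int_{\mathbb R^N}|\nabla u|^2\,dx-\lambda_0\int_{\mathbb R^N}\frac{u^2(x)}{|x|^2}\,dx}{\displaystyle\Big(\int_{\mathbb R^N}|u|^{2^*}\,dx\Big)^{2/2^*}} $$ is finite and attained: there is $u\in\mathcal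 D^{1,2}_{\rm circ}(\mathbb R^N)$, $u\not\equiv0$, at which the quotient equals $S_{\rm circ}(\lambda_0)$. -/

import Mathlib

open MeasureTheory Filter Topology
open scoped ENNReal ContDiff Gradient

noncomputable section

namespace HardySobolev

/-- The critical Sobolev exponent `2* = 2N / (N - 2)`. -/
def critExp (N : ℕ) : ℝ := 2 * N / (N - 2)

/-- `𝒟(ℝᴺ)`: smooth functions with compact support. -/
def IsTest {N : ℕ} (φ : EuclideanSpace ℝ (Fin N) → ℝ) : Prop :=
  ContDiff ℝ ∞ φ ∧ HasCompactSupport φ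

/-- `u` belongs to `𝒟^{1,2}(ℝᴺ)`, the closure of `𝒟(ℝᴺ)` for the Dirichlet norm `(∫ |∇φ|²)^{1/2}`,
and `g` is its gradient. For `N ≥ 3` a sequence of test functions that is Cauchy in the Dirichlet
norm converges in `L^{2*}` by Sobolev's inequality; `u` is its limit, as a function, and `g` is the
`L²`-limit of the gradients. -/
structure HasDirichletGrad {N : ℕ} (u : EuclideanSpace ℝ (Fin N) → ℝ)
    (g : EuclideanSpace ℝ (Fin N) → EuclideanSpace ℝ (Fin N)) : Prop where
  memLp_fun : MemLp u (ENNReal.ofReal (critExp N)) volume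
  memLp_grad : MemLp g 2 volume
  approx : ∃ φ : ℕ → EuclideanSpace ℝ (Fin N) → ℝ, (∀ n, IsTest (φ n)) ∧
    Tendsto (fun n => eLpNorm (fun x => φ n x - u x) (ENNReal.ofReal (critExp N)) volume)
      atTop (𝓝 0) ∧
    Tendsto (fun n => eLpNorm (fun x => ∇ (φ n) x - g x) 2 volume) atTop (𝓝 0)

/-- Membership in `𝒟^{1,2}(ℝᴺ)`. -/
def MemD12 {N : ℕ} (u : EuclideanSpace ℝ (Fin N) → ℝ) : Prop :=
  ∃ g, HasDirichletGrad u g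

open Classical in
/-- The (weak) gradient of `u ∈ 𝒟^{1,2}(ℝᴺ)`, determined almost everywhere
(see `HasDirichletGrad.grad_ae_eq`). -/
def grad {N : ℕ} (u : EuclideanSpace ℝ (Fin N) → ℝ) :
    EuclideanSpace ℝ (Fin N) → EuclideanSpace ℝ (Fin N) :=
  if h : MemD12 u then h.choose else 0

/-- `|z|` for `x = (z, y) ∈ ℝ² × ℝ^{N-2}`. -/
def normZ {N : ℕ} (x : EuclideanSpace ℝ (Fin N)) : ℝ :=
  √(∑ i : Fin N with i.val < 2, x i ^ 2)

/-- `|y|` for `x = (z, y) ∈ ℝ² × ℝ^{N-2}`. -/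
def normY {N : ℕ} (x : EuclideanSpace ℝ (Fin N)) : ℝ :=
  √(∑ i : Fin N with 2 ≤ i.val, x i ^ 2)

/-- `𝒟^{1,2}_circ(ℝᴺ)`: the functions of `𝒟^{1,2}(ℝᴺ)` with `u(z,y) = u(|z|,|y|)`
(almost everywhere, elements of `𝒟^{1,2}` being classes of functions). -/
def MemD12Circ {N : ℕ} (u : EuclideanSpace ℝ (Fin N) → ℝ) : Prop :=
  MemD12 u ∧ ∃ f : ℝ → ℝ → ℝ, ∀ᵐ x, u x = f (normZ x) (normY x)

/-- The Hardy–Sobolev quotient. -/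
def quotient {N : ℕ} (lam : ℝ) (u : EuclideanSpace ℝ (Fin N) → ℝ) : ℝ :=
  ((∫ x, ‖grad u x‖ ^ 2) - lam * ∫ x, u x ^ 2 / ‖x‖ ^ 2) /
    (∫ x, |u x| ^ critExp N) ^ (2 / critExp N)

/-- The values of the quotient on the nonzero elements of `𝒟^{1,2}_circ(ℝᴺ)`. -/
def quotientValues (N : ℕ) (lam : ℝ) : Set ℝ :=
  {q | ∃ u : EuclideanSpace ℝ (Fin N) → ℝ, MemD12Circ u ∧ ¬ u =ᵐ[volume] 0 ∧ quotient lam u = q}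

/-- `S_circ(λ)`. -/
def Scirc (N : ℕ) (lam : ℝ) : ℝ := sInf (quotientValues N lam)

/-! ### The gradient is well defined -/

lemma one_le_critExp {N : ℕ} (hN : 3 ≤ N) : 1 ≤ critExp N := by
  have h : (3 : ℝ) ≤ N := by exact_mod_cast hN
  unfold critExp
  rw [le_div_iff₀ (by linarith)]
  linarith

/-- Strong convergence in `L^p` implies convergence of the integrals against a continuous function
with compact support. -/
lemma tendsto_integral_smul {N : ℕ} {F : Type*} [NormedAddCommGroup F] [NormedSpace ℝ F]
    {p : ℝ≥0∞} (hp : 1 ≤ p) {f : ℕ → EuclideanSpace ℝ (Fin N) → F}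
    {f₀ : EuclideanSpace ℝ (Fin N) → F} (hf : ∀ n, MemLp (f n) p volume)
    (hf₀ : MemLp f₀ p volume)
    (h : Tendsto (fun n => eLpNorm (fun x => f n x - f₀ x) p volume) atTop (𝓝 0))
    {ψ : EuclideanSpace ℝ (Fin N) → ℝ} (hc : Continuous ψ) (hs : HasCompactSupport ψ) :
    Tendsto (fun n => ∫ x, ψ x • f n x) atTop (𝓝 (∫ x, ψ x • f₀ x)) := by
  obtain ⟨q, hq⟩ : ∃ q : ℝ≥0∞, ENNReal.HolderConjugate q p :=
    ⟨ENNReal.conjExponent p, (ENNReal.HolderConjugate.conjExponent hp).symm⟩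
  have hψ : MemLp ψ q volume := hc.memLp_of_hasCompactSupport hs
  have hψ' := hψ.2
  refine tendsto_integral_of_L1' _ ?_ (Eventually.of_forall fun n => ?_) ?_
  · exact (memLp_one_iff_integrable.1 (hf₀.smul hψ)).1
  · exact memLp_one_iff_integrable.1 ((hf n).smul hψ)
  · have h0 : Tendsto (fun n => eLpNorm ψ q volume *
        eLpNorm (fun x => f n x - f₀ x) p volume) atTop (𝓝 0) := by
      simpa using ENNReal.Tendsto.const_mul h (Or.inr hψ'.ne)
    refine tendsto_of_tendsto_of_tendsto_of_le_of_le tendsto_const_nhds h0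
      (fun _ => bot_le) fun n => ?_
    have := eLpNorm_smul_le_mul_eLpNorm (p := q) (q := p) (r := 1) (μ := volume) ((hf n).sub hf₀).1 hψ.1
    refine le_trans (le_of_eq ?_) this
    congr 1
    ext x
    simp [smul_sub]

/-- `g` is the weak gradient of `u`. -/
lemma HasDirichletGrad.integral_smul_grad {N : ℕ} (hN : 3 ≤ N)
    {u : EuclideanSpace ℝ (Fin N) → ℝ}
    {g : EuclideanSpace ℝ (Fin N) → EuclideanSpace ℝ (Fin N)} (h : HasDirichletGrad u g)
    {ψ : EuclideanSpace ℝ (Fin N) → ℝ} (hψ : IsTest ψ) (v : EuclideanSpace ℝ (Fin N)) :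
    ∫ x, ψ x * inner ℝ v (g x) = - ∫ x, fderiv ℝ ψ x v * u x := by
  obtain ⟨hu, hg, φ, hφ, h1, h2⟩ := h
  have hp : 1 ≤ ENNReal.ofReal (critExp N) := by
    simpa using ENNReal.ofReal_le_ofReal (one_le_critExp hN)
  have cψ' : Continuous fun x => fderiv ℝ ψ x v :=
    (hψ.1.continuous_fderiv (by simp)).clm_apply continuous_const
  have sψ' : HasCompactSupport fun x => fderiv ℝ ψ x v := hψ.2.fderiv_apply ℝ v
  have cgrad : ∀ n, Continuous (∇ (φ n)) := fun n =>
    (InnerProductSpace.toDual ℝ _).symm.continuous.comp ((hφ n).1.continuous_fderiv (by simp))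
  have sgrad : ∀ n, HasCompactSupport (∇ (φ n)) := fun n =>
    ((hφ n).2.fderiv ℝ).comp_left (g := (InnerProductSpace.toDual ℝ _).symm) (by simp)
  have A := tendsto_integral_smul hp
    (fun n => (hφ n).1.continuous.memLp_of_hasCompactSupport (hφ n).2) hu h1 cψ' sψ'
  have mg : ∀ n, MemLp (∇ (φ n)) 2 volume := fun n =>
    (cgrad n).memLp_of_hasCompactSupport (sgrad n)
  have B := tendsto_integral_smul (by norm_num) mg hg h2 hψ.1.continuous hψ.2
  have intg : ∀ {f : EuclideanSpace ℝ (Fin N) → EuclideanSpace ℝ (Fin N)}, MemLp f 2 volume →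
      Integrable (fun x => ψ x • f x) := fun hf =>
    memLp_one_iff_integrable.1 (hf.smul (p := 2) (q := 2)
      (hψ.1.continuous.memLp_of_hasCompactSupport hψ.2))
  have B' := (continuous_const.inner continuous_id :
    Continuous fun w : EuclideanSpace ℝ (Fin N) => inner ℝ v w).tendsto _ |>.comp B
  have key : ∀ n, inner ℝ v (∫ x, ψ x • ∇ (φ n) x) = - ∫ x, fderiv ℝ ψ x v * φ n x := by
    intro n
    rw [← integral_inner (intg (mg n))]
    have e : ∀ x, inner ℝ v (ψ x • ∇ (φ n) x) = ψ x * fderiv ℝ (φ n) x v := by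
      intro x
      rw [inner_smul_right, real_inner_comm, gradient, InnerProductSpace.toDual_symm_apply]
    simp_rw [e]
    have cφ' : Continuous fun x => fderiv ℝ (φ n) x v :=
      ((hφ n).1.continuous_fderiv (by simp)).clm_apply continuous_const
    refine integral_mul_fderiv_eq_neg_fderiv_mul_of_integrable ?_ ?_ ?_
      (fun x _ => hψ.1.differentiable (by simp) x)
      (fun x _ => (hφ n).1.differentiable (by simp) x)
    · exact (cψ'.mul (hφ n).1.continuous).integrable_of_hasCompactSupport sψ'.mul_right
    · exact (hψ.1.continuous.mul cφ').integrable_of_hasCompactSupport hψ.2.mul_right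
    · exact (hψ.1.continuous.mul (hφ n).1.continuous).integrable_of_hasCompactSupport
        hψ.2.mul_right
  have C := tendsto_nhds_unique B' (A.neg.congr fun n => by
    simp only [Function.comp, key n, smul_eq_mul])
  simp only [smul_eq_mul] at C
  rw [← C, ← integral_inner (intg hg)]
  simp [inner_smul_right]

lemma HasDirichletGrad.ae_unique {N : ℕ} (hN : 3 ≤ N) {u : EuclideanSpace ℝ (Fin N) → ℝ}
    {g g' : EuclideanSpace ℝ (Fin N) → EuclideanSpace ℝ (Fin N)}
    (h : HasDirichletGrad u g) (h' : HasDirichletGrad u g') : g =ᵐ[volume] g' := by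
  have hl : LocallyIntegrable (fun x => g x - g' x) volume :=
    (h.memLp_grad.sub h'.memLp_grad).locallyIntegrable (by norm_num)
  have : ∀ᵐ x, g x - g' x = 0 := by
    refine ae_eq_zero_of_integral_contDiff_smul_eq_zero hl fun ψ h1 h2 => ?_
    have hψ : IsTest ψ := ⟨h1, h2⟩
    have intg : ∀ {f : EuclideanSpace ℝ (Fin N) → EuclideanSpace ℝ (Fin N)}, MemLp f 2 volume →
        Integrable (fun x => ψ x • f x) := fun hf =>
      memLp_one_iff_integrable.1 (hf.smul (p := 2) (q := 2)
        (h1.continuous.memLp_of_hasCompactSupport h2))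
    refine ext_inner_left ℝ fun v => ?_
    have a := h.integral_smul_grad hN hψ v
    have b := h'.integral_smul_grad hN hψ v
    simp only [smul_sub]
    rw [integral_sub (intg h.memLp_grad) (intg h'.memLp_grad), inner_sub_right,
      ← integral_inner (intg h.memLp_grad), ← integral_inner (intg h'.memLp_grad)]
    simp only [inner_smul_right, inner_zero_right]
    rw [a, b, sub_self]
  filter_upwards [this] with x hx using sub_eq_zero.1 hx

/-- The gradient chosen in `grad` is the only one, up to a null set. -/
lemma HasDirichletGrad.grad_ae_eq {N : ℕ} (hN : 3 ≤ N) {u : EuclideanSpace ℝ (Fin N) → ℝ}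
    {g : EuclideanSpace ℝ (Fin N) → EuclideanSpace ℝ (Fin N)} (h : HasDirichletGrad u g) :
    grad u =ᵐ[volume] g := by
  have hm : MemD12 u := ⟨g, h⟩
  have hc : HasDirichletGrad u (grad u) := by
    rw [grad, dif_pos hm]
    exact hm.choose_spec
  exact hc.ae_unique hN h

end HardySobolev

end

noncomputable section

namespace HardySobolev

/-! ### The critical exponent -/

/-! Since `lam` lies below the Hardy constant, Hardy's inequality makes the numerator control the
Dirichlet norm (`HasDirichletGrad.hardy`, `exists_coercive`). Hence the quotient is nonnegative, and
a minimizing sequence normalized by `∫ |u|^{2*} = 1` is bounded in the Dirichlet norm. What has to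
be excluded is that its weak limit is zero.

Dilations leave the quotient invariant and are used to normalize the sequence. Averaging a localized
Sobolev inequality over all dilates of one annular cutoff (`exists_annuli_const`) shows that a
bounded function of mass one carries a fixed amount of mass in some dilated annulus; rescaling moves
it to `1/2 ≤ |x| ≤ 4` (`exists_dilate_annulus`).

Symmetry then prevents concentration in that annulus. As `N ≥ 4`, both factors `ℝ²` and `ℝ^{N-2}`
have room for rotations, so a small ball away from the origin has `m` disjoint rotated copies of
equal mass and carries at most `1/m` of the total. Inserted in the localized Sobolev inequality on
small balls, this bounds the annular mass by a small multiple of the energy plus a local `L²` term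
(`exists_symmetric_annulus_const`). If the weak limit were zero, Rellich's theorem would send the
local term to zero, and the annular mass could not stay bounded below (`lintegral_annulus_not_ge`).

Finally, let `u₀ ≠ 0` be the weak limit, `a` its mass, `E₀` its energy, `S` the infimum and `t =
2/2*`. The energy splits by weak convergence (`tendsto_energy_sub`), the mass by `brezis_lieb`, and
the remainders are again symmetric, so `S (1 - a)^t ≤ S - E₀`. With `1 ≤ a^t + (1 - a)^t` this gives
`E₀ ≤ S a^t`, so `u₀` is a minimizer. No strict comparison of energy levels is needed, nor that `a =
1`.

Weak convergence is taken for the pairs `(∇u, u/|x|)` in `L² × L²`: functions in `𝒟^{1,2}` need not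
be in `L²`, but by Hardy's inequality `u/|x|` is. -/

lemma two_lt_critExp {N : ℕ} (hN : 3 ≤ N) : 2 < critExp N := by
  have h : (3 : ℝ) ≤ N := by exact_mod_cast hN
  unfold critExp
  rw [lt_div_iff₀ (by linarith)]
  linarith

lemma one_le_ofReal_critExp {N : ℕ} (hN : 3 ≤ N) : 1 ≤ ENNReal.ofReal (critExp N) := by
  simpa using ENNReal.ofReal_le_ofReal (one_le_critExp hN)

lemma toReal_ofReal_critExp {N : ℕ} (hN : 3 ≤ N) :
    (ENNReal.ofReal (critExp N)).toReal = critExp N :=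
  ENNReal.toReal_ofReal (by linarith [two_lt_critExp hN])

lemma ofReal_critExp_ne_zero {N : ℕ} (hN : 3 ≤ N) : ENNReal.ofReal (critExp N) ≠ 0 :=
  (zero_lt_one.trans_le (one_le_ofReal_critExp hN)).ne'

/-! ### Gradients of test functions -/

section Test

variable {N : ℕ} {φ ψ : EuclideanSpace ℝ (Fin N) → ℝ}

lemma IsTest.differentiableAt (h : IsTest φ) (x : EuclideanSpace ℝ (Fin N)) :
    DifferentiableAt ℝ φ x :=
  h.1.differentiable (by simp) x

lemma IsTest.add (h : IsTest φ) (h' : IsTest ψ) : IsTest (fun x => φ x + ψ x) :=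
  ⟨h.1.add h'.1, h.2.add h'.2⟩

lemma IsTest.mul (h : IsTest φ) (h' : IsTest ψ) : IsTest (fun x => φ x * ψ x) :=
  ⟨h.1.mul h'.1, h.2.mul_right⟩

lemma IsTest.const_mul (h : IsTest φ) (c : ℝ) : IsTest (fun x => c * φ x) :=
  ⟨contDiff_const.mul h.1, h.2.mul_left⟩

lemma IsTest.continuous (h : IsTest φ) : Continuous φ := h.1.continuous

lemma IsTest.continuous_gradient (h : IsTest φ) : Continuous (∇ φ) :=
  (InnerProductSpace.toDual ℝ _).symm.continuous.comp (h.1.continuous_fderiv (by simp))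

lemma IsTest.hasCompactSupport_gradient (h : IsTest φ) : HasCompactSupport (∇ φ) :=
  (h.2.fderiv ℝ).comp_left (g := (InnerProductSpace.toDual ℝ _).symm) (by simp)

lemma IsTest.memLp (h : IsTest φ) (p : ℝ≥0∞) : MemLp φ p volume :=
  h.continuous.memLp_of_hasCompactSupport h.2

lemma IsTest.memLp_gradient (h : IsTest φ) (p : ℝ≥0∞) : MemLp (∇ φ) p volume :=
  h.continuous_gradient.memLp_of_hasCompactSupport h.hasCompactSupport_gradient

lemma gradient_add_apply (h : IsTest φ) (h' : IsTest ψ) (x : EuclideanSpace ℝ (Fin N)) :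
    ∇ (fun x => φ x + ψ x) x = ∇ φ x + ∇ ψ x := by
  simp only [gradient]
  rw [fderiv_fun_add (h.differentiableAt x) (h'.differentiableAt x), map_add]

lemma gradient_const_mul_apply (h : IsTest φ) (c : ℝ) (x : EuclideanSpace ℝ (Fin N)) :
    ∇ (fun x => c * φ x) x = c • ∇ φ x := by
  simp only [gradient]
  rw [fderiv_const_mul (h.differentiableAt x)]
  simp

lemma gradient_mul_apply (h : IsTest φ) (h' : IsTest ψ) (x : EuclideanSpace ℝ (Fin N)) :
    ∇ (fun x => φ x * ψ x) x = φ x • ∇ ψ x + ψ x • ∇ φ x := by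
  simp only [gradient]
  rw [fderiv_fun_mul (h.differentiableAt x) (h'.differentiableAt x)]
  simp

lemma norm_gradient (φ : EuclideanSpace ℝ (Fin N) → ℝ) (x : EuclideanSpace ℝ (Fin N)) :
    ‖∇ φ x‖ = ‖fderiv ℝ φ x‖ := by
  simp [gradient]

lemma IsTest.hasDirichletGrad (h : IsTest φ) : HasDirichletGrad φ (∇ φ) :=
  ⟨h.memLp _, h.memLp_gradient _, fun _ => φ, fun _ => h, by simp, by simp⟩

end Test

/-! ### The space as a vector space -/

section Linear

variable {N : ℕ} {u v : EuclideanSpace ℝ (Fin N) → ℝ}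
  {g k : EuclideanSpace ℝ (Fin N) → EuclideanSpace ℝ (Fin N)}

lemma HasDirichletGrad.congr (h : HasDirichletGrad u g) (hu : u =ᵐ[volume] v)
    (hg : g =ᵐ[volume] k) : HasDirichletGrad v k := by
  obtain ⟨h1, h2, φ, hφ, h3, h4⟩ := h
  refine ⟨h1.ae_eq hu, h2.ae_eq hg, φ, hφ, h3.congr fun n => eLpNorm_congr_ae ?_,
    h4.congr fun n => eLpNorm_congr_ae ?_⟩
  · filter_upwards [hu] with x hx
    rw [hx]
  · filter_upwards [hg] with x hx
    rw [hx]

lemma HasDirichletGrad.add (hN : 3 ≤ N) (h : HasDirichletGrad u g) (h' : HasDirichletGrad v k) :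
    HasDirichletGrad (fun x => u x + v x) (fun x => g x + k x) := by
  obtain ⟨h1, h2, φ, hφ, h3, h4⟩ := h
  obtain ⟨h1', h2', φ', hφ', h3', h4'⟩ := h'
  refine ⟨h1.add h1', h2.add h2', fun n x => φ n x + φ' n x, fun n => (hφ n).add (hφ' n),
    ?_, ?_⟩
  · refine tendsto_of_tendsto_of_tendsto_of_le_of_le tendsto_const_nhds
      (by simpa using h3.add h3') (fun _ => zero_le) fun n => ?_
    refine le_trans (le_of_eq ?_) (eLpNorm_add_le ((hφ n).memLp _ |>.sub h1).1
      ((hφ' n).memLp _ |>.sub h1').1 (one_le_ofReal_critExp hN))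
    congr 1
    ext x
    simp only [Pi.add_apply]
    ring
  · refine tendsto_of_tendsto_of_tendsto_of_le_of_le tendsto_const_nhds
      (by simpa using h4.add h4') (fun _ => zero_le) fun n => ?_
    refine le_trans (le_of_eq ?_) (eLpNorm_add_le ((hφ n).memLp_gradient _ |>.sub h2).1
      ((hφ' n).memLp_gradient _ |>.sub h2').1 (by norm_num))
    congr 1
    ext1 x
    simp only [Pi.add_apply]
    rw [gradient_add_apply (hφ n) (hφ' n)]
    abel

lemma HasDirichletGrad.const_mul (h : HasDirichletGrad u g) (c : ℝ) :
    HasDirichletGrad (fun x => c * u x) (fun x => c • g x) := by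
  obtain ⟨h1, h2, φ, hφ, h3, h4⟩ := h
  refine ⟨h1.const_mul c, h2.const_smul c, fun n x => c * φ n x, fun n => (hφ n).const_mul c,
    ?_, ?_⟩
  · have := ENNReal.Tendsto.const_mul (a := ‖c‖ₑ) h3 (Or.inr (by simp))
    rw [mul_zero] at this
    refine this.congr fun n => ?_
    rw [← eLpNorm_const_smul]
    congr 1
    ext x
    simp [mul_sub]
  · have := ENNReal.Tendsto.const_mul (a := ‖c‖ₑ) h4 (Or.inr (by simp))
    rw [mul_zero] at this
    refine this.congr fun n => ?_
    rw [← eLpNorm_const_smul]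
    congr 1
    ext1 x
    simp only [Pi.smul_apply]
    rw [gradient_const_mul_apply (hφ n), smul_sub]

lemma HasDirichletGrad.sub (hN : 3 ≤ N) (h : HasDirichletGrad u g) (h' : HasDirichletGrad v k) :
    HasDirichletGrad (fun x => u x - v x) (fun x => g x - k x) := by
  have := h.add hN (h'.const_mul (-1))
  simpa [sub_eq_add_neg] using this

/-- Test functions approximating `u` almost everywhere, with gradients converging in `L²`. -/
lemma HasDirichletGrad.exists_ae_approx (hN : 3 ≤ N) (h : HasDirichletGrad u g) :
    ∃ φ : ℕ → EuclideanSpace ℝ (Fin N) → ℝ, (∀ n, IsTest (φ n)) ∧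
      (∀ᵐ x, Tendsto (fun n => φ n x) atTop (𝓝 (u x))) ∧
      Tendsto (fun n => eLpNorm (fun x => ∇ (φ n) x - g x) 2 volume) atTop (𝓝 0) := by
  obtain ⟨h1, h2, φ, hφ, h3, h4⟩ := h
  have hm : TendstoInMeasure volume φ atTop u :=
    tendstoInMeasure_of_tendsto_eLpNorm (ofReal_critExp_ne_zero hN)
      (fun n => ((hφ n).memLp ⊤).1) h1.1 h3
  obtain ⟨ns, hns, hae⟩ := hm.exists_seq_tendsto_ae
  exact ⟨fun n => φ (ns n), fun n => hφ _, hae, h4.comp hns.tendsto_atTop⟩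

/-- Inequalities of the form `‖T u‖_q ≤ C ‖∇u‖₂` extend from test functions by Fatou's lemma. -/
lemma HasDirichletGrad.eLpNorm_le_of_isTest (hN : 3 ≤ N) (h : HasDirichletGrad u g)
    {T : (EuclideanSpace ℝ (Fin N) → ℝ) → EuclideanSpace ℝ (Fin N) → ℝ} {q C : ℝ≥0∞}
    (hC : C ≠ ⊤)
    (hT : ∀ φ, IsTest φ → eLpNorm (T φ) q volume ≤ C * eLpNorm (∇ φ) 2 volume)
    (hm : ∀ φ, IsTest φ → AEStronglyMeasurable (T φ) volume)
    (hlim : ∀ φ : ℕ → EuclideanSpace ℝ (Fin N) → ℝ,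
      (∀ᵐ x, Tendsto (fun n => φ n x) atTop (𝓝 (u x))) →
        ∀ᵐ x, Tendsto (fun n => T (φ n) x) atTop (𝓝 (T u x))) :
    eLpNorm (T u) q volume ≤ C * eLpNorm g 2 volume := by
  obtain ⟨φ, hφ, hae, hg⟩ := h.exists_ae_approx hN
  refine (Lp.eLpNorm_lim_le_liminf_eLpNorm (fun n => hm _ (hφ n)) _ (hlim φ hae)).trans ?_
  have h1 : ∀ n, eLpNorm (T (φ n)) q volume ≤
      C * (eLpNorm (fun x => ∇ (φ n) x - g x) 2 volume + eLpNorm g 2 volume) := fun n => by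
    refine (hT _ (hφ n)).trans ?_
    gcongr
    refine le_trans (le_of_eq ?_) (eLpNorm_add_le (((hφ n).memLp_gradient 2).sub h.memLp_grad).1
      h.memLp_grad.1 (by norm_num))
    congr 1
    ext1 x
    simp
  have h2 : Tendsto (fun n => C * (eLpNorm (fun x => ∇ (φ n) x - g x) 2 volume +
      eLpNorm g 2 volume)) atTop (𝓝 (C * (0 + eLpNorm g 2 volume))) :=
    ENNReal.Tendsto.const_mul (hg.add tendsto_const_nhds) (Or.inr hC)
  rw [zero_add] at h2
  rw [← h2.liminf_eq]
  exact liminf_le_liminf (Eventually.of_forall h1)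

end Linear

/-! ### The Sobolev inequality -/

/-- The Gagliardo–Nirenberg–Sobolev inequality for compactly supported `C¹` functions, carried to
the closure by Fatou's lemma. -/
lemma exists_sobolev_const {N : ℕ} (hN : 3 ≤ N) : ∃ C : NNReal,
    ∀ (u : EuclideanSpace ℝ (Fin N) → ℝ) (g : EuclideanSpace ℝ (Fin N) → EuclideanSpace ℝ (Fin N)),
    HasDirichletGrad u g →
      eLpNorm u (ENNReal.ofReal (critExp N)) volume ≤ C * eLpNorm g 2 volume := by
  refine ⟨eLpNormLESNormFDerivOfEqInnerConst (volume : Measure (EuclideanSpace ℝ (Fin N))) (2 : NNReal),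
    fun u g h => ?_⟩
  refine h.eLpNorm_le_of_isTest hN (T := fun φ => φ) (by simp) (fun φ hφ => ?_)
    (fun φ hφ => (hφ.memLp 2).1) fun φ h => h
  have h3 : (3 : ℝ) ≤ N := by exact_mod_cast hN
  have := eLpNorm_le_eLpNorm_fderiv_of_eq_inner (volume : Measure (EuclideanSpace ℝ (Fin N)))
    (u := φ) (hφ.1.of_le (by simp)) hφ.2 (p := 2) (p' := (critExp N).toNNReal)
    (by norm_num) (by simp; omega) (by
      rw [Real.coe_toNNReal _ (by linarith [two_lt_critExp hN]), critExp]
      simp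
      field_simp
      )
  refine this.trans_eq ?_
  congr 1
  refine eLpNorm_congr_norm_ae (Eventually.of_forall fun x => ?_)
  rw [norm_gradient]

/-! ### The Hardy inequality -/

lemma eLpNorm_two_sq {α F : Type*} [MeasurableSpace α] {μ : Measure α} [NormedAddCommGroup F]
    {f : α → F} (hf : MemLp f 2 μ) :
    eLpNorm f 2 μ = ENNReal.ofReal (√(∫ x, ‖f x‖ ^ 2 ∂μ)) := by
  rw [hf.eLpNorm_eq_integral_rpow_norm (by norm_num) (by norm_num), Real.sqrt_eq_rpow]
  norm_num

section Hardy

variable {N : ℕ}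

/-- The regularization `x / (|x|² + ε)` of the vector field `x / |x|²`, in coordinates. -/
lemma hasFDerivAt_coord_div (ε : ℝ) (hε : 0 < ε) (i : Fin N) (x : EuclideanSpace ℝ (Fin N)) :
    HasFDerivAt (fun y : EuclideanSpace ℝ (Fin N) => y i * (‖y‖ ^ 2 + ε)⁻¹)
      (x i • (-((‖x‖ ^ 2 + ε) ^ 2)⁻¹ • (2 • innerSL ℝ x)) +
        (‖x‖ ^ 2 + ε)⁻¹ • (EuclideanSpace.proj i : EuclideanSpace ℝ (Fin N) →L[ℝ] ℝ)) x := by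
  have h1 : HasFDerivAt (fun y : EuclideanSpace ℝ (Fin N) => y i)
      (EuclideanSpace.proj i : EuclideanSpace ℝ (Fin N) →L[ℝ] ℝ) x :=
    (EuclideanSpace.proj i : EuclideanSpace ℝ (Fin N) →L[ℝ] ℝ).hasFDerivAt
  have h2 : HasFDerivAt (fun y : EuclideanSpace ℝ (Fin N) => ‖y‖ ^ 2 + ε) (2 • innerSL ℝ x) x :=
    ((hasStrictFDerivAt_norm_sq x).hasFDerivAt).add_const ε
  have h3 := (hasDerivAt_inv (show ‖x‖ ^ 2 + ε ≠ 0 by positivity)).comp_hasFDerivAt x h2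
  exact h1.mul h3

lemma fderiv_coord_div_single (ε : ℝ) (hε : 0 < ε) (i : Fin N) (x : EuclideanSpace ℝ (Fin N)) :
    fderiv ℝ (fun y : EuclideanSpace ℝ (Fin N) => y i * (‖y‖ ^ 2 + ε)⁻¹) x
      (EuclideanSpace.single i 1) = (‖x‖ ^ 2 + ε)⁻¹ - 2 * x i ^ 2 * ((‖x‖ ^ 2 + ε) ^ 2)⁻¹ := by
  rw [(hasFDerivAt_coord_div ε hε i x).fderiv]
  simp [EuclideanSpace.inner_single_right]
  ring

lemma contDiff_coord_div (ε : ℝ) (hε : 0 < ε) (i : Fin N) :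
    ContDiff ℝ ∞ (fun y : EuclideanSpace ℝ (Fin N) => y i * (‖y‖ ^ 2 + ε)⁻¹) := by
  refine ContDiff.mul (EuclideanSpace.proj i : EuclideanSpace ℝ (Fin N) →L[ℝ] ℝ).contDiff
    (ContDiff.inv ((contDiff_norm_sq ℝ).add contDiff_const) fun x => by positivity)

/-- The bracket on the left is the divergence of the regularized field `x / (|x|² + ε)`; integrate
by parts against `φ²` coordinate by coordinate and sum. -/
lemma IsTest.integral_sq_mul_div (φ : EuclideanSpace ℝ (Fin N) → ℝ) (hφ : IsTest φ) (ε : ℝ)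
    (hε : 0 < ε) :
    ∫ x, φ x ^ 2 * (N * (‖x‖ ^ 2 + ε)⁻¹ - 2 * ‖x‖ ^ 2 * ((‖x‖ ^ 2 + ε) ^ 2)⁻¹) =
      - ∫ x, 2 * φ x * (‖x‖ ^ 2 + ε)⁻¹ * inner ℝ (∇ φ x) x := by
  have hφ2 : IsTest (fun x => φ x ^ 2) := by simpa [sq] using hφ.mul hφ
  have hX := contDiff_coord_div (N := N) ε hε
  have hf : ∀ (x v : EuclideanSpace ℝ (Fin N)),
      fderiv ℝ (fun x => φ x ^ 2) x v = 2 * φ x * fderiv ℝ φ x v := fun x v => by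
    rw [fderiv_fun_pow _ (hφ.differentiableAt x)]
    simp
  have c1 : ∀ i, Continuous fun x => fderiv ℝ (fun y : EuclideanSpace ℝ (Fin N) =>
      y i * (‖y‖ ^ 2 + ε)⁻¹) x (EuclideanSpace.single i 1) := fun i =>
    ((hX i).continuous_fderiv (by simp)).clm_apply continuous_const
  have c2 : ∀ i, Continuous fun x => fderiv ℝ (fun x => φ x ^ 2) x
      (EuclideanSpace.single i (1 : ℝ)) := fun i =>
    (hφ2.1.continuous_fderiv (by simp)).clm_apply continuous_const
  have i1 : ∀ i, Integrable (fun x => φ x ^ 2 * fderiv ℝ (fun y : EuclideanSpace ℝ (Fin N) =>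
      y i * (‖y‖ ^ 2 + ε)⁻¹) x (EuclideanSpace.single i 1)) := fun i =>
    (hφ2.continuous.mul (c1 i)).integrable_of_hasCompactSupport hφ2.2.mul_right
  have i2 : ∀ i, Integrable (fun x => fderiv ℝ (fun x => φ x ^ 2) x
      (EuclideanSpace.single i (1 : ℝ)) * (x i * (‖x‖ ^ 2 + ε)⁻¹)) := fun i =>
    ((c2 i).mul (hX i).continuous).integrable_of_hasCompactSupport
      (hφ2.2.fderiv_apply ℝ _).mul_right
  have key : ∀ i : Fin N, ∫ x, φ x ^ 2 * fderiv ℝ (fun y : EuclideanSpace ℝ (Fin N) =>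
      y i * (‖y‖ ^ 2 + ε)⁻¹) x (EuclideanSpace.single i 1) =
      - ∫ x, fderiv ℝ (fun x => φ x ^ 2) x (EuclideanSpace.single i 1) *
        (x i * (‖x‖ ^ 2 + ε)⁻¹) := fun i =>
    integral_mul_fderiv_eq_neg_fderiv_mul_of_integrable (i2 i) (i1 i)
      ((hφ2.continuous.mul (hX i).continuous).integrable_of_hasCompactSupport hφ2.2.mul_right)
      (fun x _ => hφ2.differentiableAt x) (fun x _ => (hX i).differentiable (by simp) x)
  have hs := Finset.sum_congr rfl fun i (_ : i ∈ Finset.univ) => key i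
  rw [Finset.sum_neg_distrib, ← integral_finsetSum _ fun i _ => i1 i,
    ← integral_finsetSum _ fun i _ => i2 i] at hs
  refine Eq.trans (integral_congr_ae (Eventually.of_forall fun x => ?_)) (hs.trans ?_)
  · simp only [fderiv_coord_div_single ε hε]
    rw [← Finset.mul_sum, Finset.sum_sub_distrib, ← Finset.sum_mul, ← Finset.mul_sum,
      EuclideanSpace.real_norm_sq_eq]
    simp
  · congr 1
    refine integral_congr_ae (Eventually.of_forall fun x => ?_)
    simp only [hf]
    rw [real_inner_comm, PiLp.inner_apply, Finset.mul_sum]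
    refine Finset.sum_congr rfl fun i _ => ?_
    have : fderiv ℝ φ x (EuclideanSpace.single i 1) = ∇ φ x i := by
      rw [← inner_gradient_left, EuclideanSpace.inner_single_right]
      simp
    rw [this]
    simp
    ring

/-- Expand `0 ≤ |w + c t x / (|x|² + ε)|²`. The error left by the regularization is `(c² + 2c) t² (d
- |x|² d²)` with `d = 1/(|x|² + ε)`, which is nonnegative. -/
lemma hardy_pointwise {V : Type*} [NormedAddCommGroup V] [InnerProductSpace ℝ V] (c : ℝ)
    (hc : 0 ≤ c) (ε : ℝ) (hε : 0 < ε) (t : ℝ) (w x : V) :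
    c ^ 2 * ((‖x‖ ^ 2 + ε)⁻¹ * t ^ 2) -
      c * (t ^ 2 * ((2 * c + 2) * (‖x‖ ^ 2 + ε)⁻¹ - 2 * ‖x‖ ^ 2 * ((‖x‖ ^ 2 + ε) ^ 2)⁻¹)) ≤
      ‖w‖ ^ 2 + c * (2 * t * (‖x‖ ^ 2 + ε)⁻¹ * inner ℝ w x) := by
  have hD : 0 < ‖x‖ ^ 2 + ε := by positivity
  have h0 : 0 ≤ ‖w + (c * t * (‖x‖ ^ 2 + ε)⁻¹) • x‖ ^ 2 := sq_nonneg _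
  rw [norm_add_sq_real, inner_smul_right, norm_smul, mul_pow, Real.norm_eq_abs, sq_abs] at h0
  have hx : ‖x‖ ^ 2 * ((‖x‖ ^ 2 + ε)⁻¹) ^ 2 ≤ (‖x‖ ^ 2 + ε)⁻¹ := by
    rw [inv_pow, ← div_eq_mul_inv, div_le_iff₀ (by positivity), sq (‖x‖ ^ 2 + ε),
      inv_mul_cancel_left₀ hD.ne']
    linarith
  simp only [← inv_pow]
  generalize (‖x‖ ^ 2 + ε)⁻¹ = d at h0 hx ⊢
  have h1 : 0 ≤ (c ^ 2 + 2 * c) * t ^ 2 * (d - ‖x‖ ^ 2 * d ^ 2) := by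
    have : 0 ≤ d - ‖x‖ ^ 2 * d ^ 2 := by linarith
    positivity
  linarith [h0, h1]

/-- Integrate `hardy_pointwise` with `c = (N - 2)/2`, so that `2c + 2 = N`; by the divergence
identity the terms with the factor `c` cancel. -/
lemma IsTest.hardy_regularized (hN : 3 ≤ N) (φ : EuclideanSpace ℝ (Fin N) → ℝ) (hφ : IsTest φ)
    (ε : ℝ) (hε : 0 < ε) :
    (((N : ℝ) - 2) / 2) ^ 2 * ∫ x, (√(‖x‖ ^ 2 + ε)⁻¹ * φ x) ^ 2 ≤ ∫ x, ‖∇ φ x‖ ^ 2 := by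
  have h3 : (3 : ℝ) ≤ N := by exact_mod_cast hN
  set c : ℝ := ((N : ℝ) - 2) / 2 with hc
  have hD : ∀ x : EuclideanSpace ℝ (Fin N), 0 < ‖x‖ ^ 2 + ε := fun x => by positivity
  have cD : Continuous fun x : EuclideanSpace ℝ (Fin N) => (‖x‖ ^ 2 + ε)⁻¹ :=
    (by fun_prop : Continuous fun x : EuclideanSpace ℝ (Fin N) => ‖x‖ ^ 2 + ε).inv₀
      fun x => (hD x).ne'
  have cg := hφ.continuous_gradient
  have cφ := hφ.continuous
  have cs : ∀ f : EuclideanSpace ℝ (Fin N) → ℝ, Continuous f → (∀ x, φ x = 0 → f x = 0) →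
      Integrable f := fun f hf h => hf.integrable_of_hasCompactSupport
    (hφ.2.mono fun x hx h0 => hx (h x h0))
  have I1 : Integrable fun x => ‖∇ φ x‖ ^ 2 :=
    (cg.norm.pow 2).integrable_of_hasCompactSupport
      (hφ.hasCompactSupport_gradient.mono fun x hx h0 => hx (by simp [h0]))
  have I2 : Integrable fun x => φ x ^ 2 * (N * (‖x‖ ^ 2 + ε)⁻¹ -
      2 * ‖x‖ ^ 2 * ((‖x‖ ^ 2 + ε) ^ 2)⁻¹) := by
    refine cs _ ?_ fun x hx => by simp [hx]
    simp_rw [← inv_pow]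
    fun_prop
  have I3 : Integrable fun x => 2 * φ x * (‖x‖ ^ 2 + ε)⁻¹ * inner ℝ (∇ φ x) x :=
    cs _ (by fun_prop) fun x hx => by simp [hx]
  have hs : ∀ x, (√(‖x‖ ^ 2 + ε)⁻¹ * φ x) ^ 2 = (‖x‖ ^ 2 + ε)⁻¹ * φ x ^ 2 := fun x => by
    rw [mul_pow, Real.sq_sqrt (inv_nonneg.2 (hD x).le)]
  simp_rw [hs]
  have I4 : Integrable fun x => (‖x‖ ^ 2 + ε)⁻¹ * φ x ^ 2 :=
    cs _ (by fun_prop) fun x hx => by simp [hx]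
  have hkey := IsTest.integral_sq_mul_div φ hφ ε hε
  have hle : ∫ x, (c ^ 2 * ((‖x‖ ^ 2 + ε)⁻¹ * φ x ^ 2) -
      c * (φ x ^ 2 * (N * (‖x‖ ^ 2 + ε)⁻¹ - 2 * ‖x‖ ^ 2 * ((‖x‖ ^ 2 + ε) ^ 2)⁻¹))) ≤
      ∫ x, (‖∇ φ x‖ ^ 2 + c * (2 * φ x * (‖x‖ ^ 2 + ε)⁻¹ * inner ℝ (∇ φ x) x)) := by
    refine integral_mono ((I4.const_mul _).sub (I2.const_mul _)) (I1.add (I3.const_mul _))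
      fun x => ?_
    rw [show (N : ℝ) = 2 * c + 2 by linarith]
    exact hardy_pointwise c (by linarith) ε hε (φ x) (∇ φ x) x
  rw [integral_sub (I4.const_mul _) (I2.const_mul _), integral_add I1 (I3.const_mul _),
    integral_const_mul, integral_const_mul, integral_const_mul, hkey] at hle
  linarith

/-- The Hardy inequality on `𝒟^{1,2}(ℝᴺ)`. -/
lemma HasDirichletGrad.hardy (hN : 3 ≤ N) {u : EuclideanSpace ℝ (Fin N) → ℝ}
    {g : EuclideanSpace ℝ (Fin N) → EuclideanSpace ℝ (Fin N)} (h : HasDirichletGrad u g) :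
    eLpNorm (fun x => ‖x‖⁻¹ * u x) 2 volume ≤
      ENNReal.ofReal (2 / ((N : ℝ) - 2)) * eLpNorm g 2 volume := by
  have h3 : (3 : ℝ) ≤ N := by exact_mod_cast hN
  have hN' : 0 < N := by omega
  have : NeZero N := ⟨hN'.ne'⟩
  refine h.eLpNorm_le_of_isTest hN (T := fun φ x => ‖x‖⁻¹ * φ x) (by simp) (fun φ hφ => ?_)
    (fun φ hφ => ?_) fun φ h => ?_
  -- Take `ε = 1/(n + 1)`; the regularized bound is uniform in `n`, so Fatou's lemma removes the
  -- regularization.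
  · have hm : ∀ n : ℕ, MemLp (fun x => √(‖x‖ ^ 2 + 1 / ((n : ℝ) + 1))⁻¹ * φ x) 2 volume := by
      intro n
      refine Continuous.memLp_of_hasCompactSupport ?_ hφ.2.mul_left
      refine Continuous.mul (Real.continuous_sqrt.comp (Continuous.inv₀ (by fun_prop)
        fun x => by positivity)) hφ.continuous
    refine (Lp.eLpNorm_lim_le_liminf_eLpNorm (f := fun (n : ℕ) x =>
      √(‖x‖ ^ 2 + 1 / ((n : ℝ) + 1))⁻¹ * φ x) (fun n => (hm n).1) _ ?_).trans ?_
    · have : ∀ᵐ x : EuclideanSpace ℝ (Fin N), x ≠ 0 := by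
        simp [ae_iff, measure_singleton]
      filter_upwards [this] with x hx
      refine Tendsto.mul_const _ ?_
      have h1 : Tendsto (fun n : ℕ => ‖x‖ ^ 2 + 1 / ((n : ℝ) + 1)) atTop (𝓝 (‖x‖ ^ 2)) := by
        simpa using tendsto_const_nhds.add (tendsto_one_div_add_atTop_nhds_zero_nat (𝕜 := ℝ))
      have h2 := (h1.inv₀ (by simpa using hx)).sqrt
      rwa [Real.sqrt_inv, Real.sqrt_sq (norm_nonneg x)] at h2
    · refine liminf_le_of_le (by isBoundedDefault) fun b hb => ?_
      obtain ⟨n, hn⟩ := hb.exists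
      refine hn.trans ?_
      rw [eLpNorm_two_sq (hm n), eLpNorm_two_sq (hφ.memLp_gradient 2), ← ENNReal.ofReal_mul
        (by apply div_nonneg <;> linarith)]
      refine ENNReal.ofReal_le_ofReal ?_
      have := IsTest.hardy_regularized hN φ hφ (1 / ((n : ℝ) + 1)) (by positivity)
      simp only [Real.norm_eq_abs, sq_abs]
      rw [Real.sqrt_le_left (by have : 0 < (N : ℝ) - 2 := by linarith
                                positivity), mul_pow,
        Real.sq_sqrt (integral_nonneg fun x => by positivity)]
      have h2 : (0 : ℝ) < (N : ℝ) - 2 := by linarith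
      calc _ = (2 / ((N : ℝ) - 2)) ^ 2 * ((((N : ℝ) - 2) / 2) ^ 2 *
            ∫ x, (√(‖x‖ ^ 2 + 1 / ((n : ℝ) + 1))⁻¹ * φ x) ^ 2) := by
              rw [← mul_assoc, ← mul_pow, div_mul_div_cancel₀ h2.ne', div_self two_ne_zero, one_pow,
                one_mul]
        _ ≤ _ := by gcongr
  · exact (by fun_prop : Measurable fun x : EuclideanSpace ℝ (Fin N) => ‖x‖⁻¹).aestronglyMeasurable.mul
      (hφ.memLp 2).1
  · filter_upwards [h] with x hx using hx.const_mul _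

lemma HasDirichletGrad.memLp_hardy (hN : 3 ≤ N) {u : EuclideanSpace ℝ (Fin N) → ℝ}
    {g : EuclideanSpace ℝ (Fin N) → EuclideanSpace ℝ (Fin N)} (h : HasDirichletGrad u g) :
    MemLp (fun x => ‖x‖⁻¹ * u x) 2 volume :=
  ⟨(by fun_prop : Measurable fun x : EuclideanSpace ℝ (Fin N) =>
    ‖x‖⁻¹).aestronglyMeasurable.mul h.memLp_fun.1,
    (h.hardy hN).trans_lt (ENNReal.mul_lt_top (by simp) h.memLp_grad.2)⟩

end Hardy

/-! ### Multiplication by a test function -/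

/-- The only delicate term is `u ∇η`. As `|x| |∇η|` is bounded, it is dominated by `|u|/|x|`, which
Hardy's inequality puts in `L²`; the same bound applied to `φ n - u` gives the convergence of the
approximations. -/
lemma HasDirichletGrad.test_mul {N : ℕ} (hN : 3 ≤ N) {u : EuclideanSpace ℝ (Fin N) → ℝ}
    {g : EuclideanSpace ℝ (Fin N) → EuclideanSpace ℝ (Fin N)} (h : HasDirichletGrad u g)
    {η : EuclideanSpace ℝ (Fin N) → ℝ} (hη : IsTest η) :
    HasDirichletGrad (fun x => η x * u x) (fun x => η x • g x + u x • ∇ η x) := by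
  have : NeZero N := ⟨by omega⟩
  obtain ⟨B, hB⟩ : ∃ B : NNReal, ∀ x, ‖η x‖ ≤ B := by
    obtain ⟨C, hC⟩ := hη.2.exists_bound_of_continuous hη.continuous
    exact ⟨C.toNNReal, fun x => (hC x).trans (Real.le_coe_toNNReal C)⟩
  obtain ⟨B', hB'⟩ : ∃ B' : NNReal, ∀ x, ‖x‖ * ‖∇ η x‖ ≤ B' := by
    obtain ⟨C, hC⟩ := (hη.hasCompactSupport_gradient.norm.mul_left
      (f := fun x => ‖x‖)).exists_bound_of_continuous
        (continuous_norm.mul hη.continuous_gradient.norm)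
    refine ⟨C.toNNReal, fun x => ?_⟩
    have := hC x
    simp only [Pi.mul_apply] at this
    rw [Real.norm_of_nonneg (by positivity)] at this
    exact this.trans (Real.le_coe_toNNReal C)
  have hne : ∀ᵐ x : EuclideanSpace ℝ (Fin N), x ≠ 0 := by simp [ae_iff, measure_singleton]
  have key : ∀ {v : EuclideanSpace ℝ (Fin N) → ℝ}, eLpNorm (fun x => v x • ∇ η x) 2 volume ≤
      B' * eLpNorm (fun x => ‖x‖⁻¹ * v x) 2 volume := fun {v} => by
    rw [← ENNReal.ofReal_coe_nnreal]
    refine eLpNorm_le_mul_eLpNorm_of_ae_le_mul ?_ 2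
    filter_upwards [hne] with x hx
    have hx' : ‖x‖ ≠ 0 := by simpa using hx
    rw [norm_smul, norm_mul, norm_inv, norm_norm]
    calc ‖v x‖ * ‖∇ η x‖ = (‖x‖ * ‖∇ η x‖) * (‖x‖⁻¹ * ‖v x‖) := by field_simp
      _ ≤ _ := by gcongr; exact hB' x
  have hmη : AEStronglyMeasurable η volume := (hη.memLp 2).1
  have hmη' : AEStronglyMeasurable (∇ η) volume := (hη.memLp_gradient 2).1
  have hu1 : MemLp (fun x => η x * u x) (ENNReal.ofReal (critExp N)) volume :=
    h.memLp_fun.of_le_mul (hmη.mul h.memLp_fun.1) (c := B) (Eventually.of_forall fun x => by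
      rw [norm_mul]; gcongr; exact hB x)
  have hg1 : MemLp (fun x => η x • g x) 2 volume :=
    h.memLp_grad.of_le_mul (hmη.smul h.memLp_grad.1) (c := B) (Eventually.of_forall fun x => by
      rw [norm_smul]; gcongr; exact hB x)
  have hg2 : MemLp (fun x => u x • ∇ η x) 2 volume :=
    ⟨h.memLp_fun.1.smul hmη', key.trans_lt (ENNReal.mul_lt_top (by simp) (h.memLp_hardy hN).2)⟩
  obtain ⟨φ, hφ, h3, h4⟩ := h.approx
  refine ⟨hu1, hg1.add hg2, fun n x => η x * φ n x, fun n => hη.mul (hφ n), ?_, ?_⟩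
  · have := ENNReal.Tendsto.const_mul (a := (B : ℝ≥0∞)) h3 (Or.inr (by simp))
    rw [mul_zero] at this
    refine tendsto_of_tendsto_of_tendsto_of_le_of_le tendsto_const_nhds this
      (fun _ => zero_le) fun n => ?_
    rw [← ENNReal.ofReal_coe_nnreal]
    refine eLpNorm_le_mul_eLpNorm_of_ae_le_mul (Eventually.of_forall fun x => ?_) _
    rw [← mul_sub, norm_mul]
    gcongr
    exact hB x
  · have := ENNReal.Tendsto.const_mul (a := (B + B' * ENNReal.ofReal (2 / ((N : ℝ) - 2)) : ℝ≥0∞))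
      h4 (Or.inr (by finiteness))
    rw [mul_zero] at this
    refine tendsto_of_tendsto_of_tendsto_of_le_of_le tendsto_const_nhds this
      (fun _ => zero_le) fun n => ?_
    have hd := (hφ n).hasDirichletGrad.sub hN h
    have e : (fun x => ∇ (fun x => η x * φ n x) x - (η x • g x + u x • ∇ η x)) =
        (fun x => η x • (∇ (φ n) x - g x)) + fun x => (φ n x - u x) • ∇ η x := by
      ext1 x
      simp only [Pi.add_apply]
      rw [gradient_mul_apply hη (hφ n), smul_sub, sub_smul]
      abel
    simp only []
    rw [e, add_mul]
    refine (eLpNorm_add_le (hmη.smul hd.memLp_grad.1) (hd.memLp_fun.1.smul hmη')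
      (by norm_num)).trans (add_le_add ?_ ?_)
    · rw [← ENNReal.ofReal_coe_nnreal]
      refine eLpNorm_le_mul_eLpNorm_of_ae_le_mul (Eventually.of_forall fun x => ?_) _
      rw [Pi.smul_apply', norm_smul]
      gcongr
      exact hB x
    · refine key.trans ?_
      rw [mul_assoc]
      gcongr
      exact hd.hardy hN

/-! ### Minkowski's integral inequality in `L²` -/

lemma eLpNorm_two_pow {α F : Type*} [MeasurableSpace α] {μ : Measure α} [NormedAddCommGroup F]
    (f : α → F) : eLpNorm f 2 μ ^ 2 = ∫⁻ x, ‖f x‖ₑ ^ 2 ∂μ := by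
  have := eLpNorm_nnreal_pow_eq_lintegral (f := f) (μ := μ) (p := 2) (by norm_num)
  simpa using this

/-- An average of functions of `L²` norm at most `K` has `L²` norm at most `K`. -/
lemma eLpNorm_two_le_of_enorm_le_lintegral {α β F G : Type*} [MeasurableSpace α]
    [MeasurableSpace β] {μ : Measure α} {ν : Measure β} [SFinite μ] [IsProbabilityMeasure ν]
    [NormedAddCommGroup F] [NormedAddCommGroup G] {f : α → β → F} {k : α → G} {K : ℝ≥0∞}
    (hf : AEStronglyMeasurable (Function.uncurry f) (μ.prod ν))
    (hk : ∀ᵐ x ∂μ, ‖k x‖ₑ ≤ ∫⁻ y, ‖f x y‖ₑ ∂ν)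
    (hK : ∀ᵐ y ∂ν, eLpNorm (fun x => f x y) 2 μ ≤ K) : eLpNorm k 2 μ ≤ K := by
  have h1 : eLpNorm k 2 μ ^ 2 ≤ K ^ 2 := by
    rw [eLpNorm_two_pow]
    have hx := hf.prodMk_left
    calc ∫⁻ x, ‖k x‖ₑ ^ 2 ∂μ ≤ ∫⁻ x, ∫⁻ y, ‖f x y‖ₑ ^ 2 ∂ν ∂μ := by
          refine lintegral_mono_ae ?_
          filter_upwards [hk, hx] with x h1 h2
          refine (pow_le_pow_left₀ (zero_le) h1 2).trans ?_
          have h2' : AEStronglyMeasurable (f x) ν := h2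
          rw [← eLpNorm_one_eq_lintegral_enorm, ← eLpNorm_two_pow]
          exact pow_le_pow_left₀ (zero_le)
            (eLpNorm_le_eLpNorm_of_exponent_le (by norm_num) h2') 2
      _ = ∫⁻ y, ∫⁻ x, ‖f x y‖ₑ ^ 2 ∂μ ∂ν :=
          lintegral_lintegral_swap (hf.enorm.pow_const 2)
      _ ≤ ∫⁻ _, K ^ 2 ∂ν := by
          refine lintegral_mono_ae ?_
          filter_upwards [hK] with y hy
          rw [← eLpNorm_two_pow]
          exact pow_le_pow_left₀ (zero_le) hy 2
      _ = K ^ 2 := by simp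
  exact (ENNReal.pow_le_pow_left_iff two_ne_zero).1 h1

/-! ### Translation differences in `L²` -/

section Translation

variable {N : ℕ} {u : EuclideanSpace ℝ (Fin N) → ℝ}
  {g : EuclideanSpace ℝ (Fin N) → EuclideanSpace ℝ (Fin N)}

/-- By the fundamental theorem of calculus the difference is the average over `t ∈ (0, 1]` of the
derivative along the segment from `x` to `x + h`, and every translate of the gradient has the same
`L²` norm. -/
lemma IsTest.eLpNorm_translate_sub_le {φ : EuclideanSpace ℝ (Fin N) → ℝ} (hφ : IsTest φ)
    (h : EuclideanSpace ℝ (Fin N)) :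
    eLpNorm (fun x => φ (x + h) - φ x) 2 volume ≤ ‖h‖ₑ * eLpNorm (∇ φ) 2 volume := by
  have : IsProbabilityMeasure ((volume : Measure ℝ).restrict (Set.Ioc 0 1)) := ⟨by simp⟩
  refine eLpNorm_two_le_of_enorm_le_lintegral (ν := (volume : Measure ℝ).restrict (Set.Ioc 0 1))
    (f := fun x t => fderiv ℝ φ (x + t • h) h) ?_ (Eventually.of_forall fun x => ?_)
    (Eventually.of_forall fun t => ?_)
  · refine Continuous.aestronglyMeasurable ?_
    exact ((hφ.1.continuous_fderiv (by simp)).comp (by fun_prop)).clm_apply continuous_const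
  · have hd : ∀ t : ℝ, HasDerivAt (fun t : ℝ => φ (x + t • h)) (fderiv ℝ φ (x + t • h) h) t := by
      intro t
      have h1 : HasDerivAt (fun t : ℝ => x + t • h) h t := by
        simpa using ((hasDerivAt_id t).smul_const h).const_add x
      exact (hφ.differentiableAt (x + t • h)).hasFDerivAt.comp_hasDerivAt t h1
    have hc : Continuous fun t : ℝ => fderiv ℝ φ (x + t • h) h :=
      ((hφ.1.continuous_fderiv (by simp)).comp (by fun_prop)).clm_apply continuous_const
    have hi := intervalIntegral.integral_eq_sub_of_hasDerivAt (a := 0) (b := 1)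
      (fun t _ => hd t) (hc.intervalIntegrable _ _)
    rw [intervalIntegral.integral_of_le zero_le_one] at hi
    simp only [one_smul, zero_smul, add_zero] at hi
    rw [← hi]
    exact enorm_integral_le_lintegral_enorm _
  · calc eLpNorm (fun x => fderiv ℝ φ (x + t • h) h) 2 volume
        ≤ ENNReal.ofReal ‖h‖ * eLpNorm (fun x => ∇ φ (x + t • h)) 2 volume := by
          refine eLpNorm_le_mul_eLpNorm_of_ae_le_mul (Eventually.of_forall fun x => ?_) _
          rw [mul_comm, norm_gradient]
          exact ContinuousLinearMap.le_opNorm _ _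
      _ = _ := by
          rw [ofReal_norm]
          congr 1
          exact eLpNorm_comp_measurePreserving hφ.continuous_gradient.aestronglyMeasurable
            (measurePreserving_add_right volume (t • h))

lemma HasDirichletGrad.eLpNorm_translate_sub_le (hN : 3 ≤ N) (hu : HasDirichletGrad u g)
    (h : EuclideanSpace ℝ (Fin N)) :
    eLpNorm (fun x => u (x + h) - u x) 2 volume ≤ ‖h‖ₑ * eLpNorm g 2 volume := by
  refine hu.eLpNorm_le_of_isTest hN (T := fun φ x => φ (x + h) - φ x) (by simp)
    (fun φ hφ => hφ.eLpNorm_translate_sub_le h) (fun φ hφ => ?_) fun φ hφ => ?_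
  · have := hφ.continuous
    exact Continuous.aestronglyMeasurable (by fun_prop)
  · have h1 := (measurePreserving_add_right volume h).quasiMeasurePreserving.ae hφ
    filter_upwards [hφ, h1] with x hx hx'
    exact hx'.sub hx

end Translation

/-! ### Mollification -/

section Mollify

variable {N : ℕ} {u : EuclideanSpace ℝ (Fin N) → ℝ}
  {g : EuclideanSpace ℝ (Fin N) → EuclideanSpace ℝ (Fin N)}

/-- The mollification of `u` by a normalized bump function. -/
def mollify (b : ContDiffBump (0 : EuclideanSpace ℝ (Fin N))) (u : EuclideanSpace ℝ (Fin N) → ℝ) :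
    EuclideanSpace ℝ (Fin N) → ℝ :=
  fun x => ∫ y, b.normed volume (x - y) * u y

lemma mollify_eq_convolution (b : ContDiffBump (0 : EuclideanSpace ℝ (Fin N)))
    (u : EuclideanSpace ℝ (Fin N) → ℝ) :
    mollify b u = convolution (b.normed volume) u (ContinuousLinearMap.lsmul ℝ ℝ) volume := by
  ext x
  rw [convolution_eq_swap]
  rfl

lemma continuous_mollify (b : ContDiffBump (0 : EuclideanSpace ℝ (Fin N)))
    (hu : LocallyIntegrable u volume) : Continuous (mollify b u) := by
  rw [mollify_eq_convolution]
  exact b.hasCompactSupport_normed.continuous_convolution_left _ b.continuous_normed hu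

lemma HasDirichletGrad.locallyIntegrable (hN : 3 ≤ N) (hu : HasDirichletGrad u g) :
    LocallyIntegrable u volume :=
  hu.memLp_fun.locallyIntegrable (one_le_ofReal_critExp hN)

/-- The mollification error is the average of `u (x - h) - u x` over the probability measure with
density the bump, which charges only `|h| < b.rOut`; each translation difference is bounded by the
previous estimate. -/
lemma HasDirichletGrad.eLpNorm_mollify_sub_le (hN : 3 ≤ N) (hu : HasDirichletGrad u g)
    (b : ContDiffBump (0 : EuclideanSpace ℝ (Fin N))) :
    eLpNorm (fun x => mollify b u x - u x) 2 volume ≤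
      ENNReal.ofReal b.rOut * eLpNorm g 2 volume := by
  set ψ := b.normed volume with hψ
  have hm : Measurable fun h => ENNReal.ofReal (ψ h) :=
    b.continuous_normed.measurable.ennreal_ofReal
  set ν := (volume : Measure (EuclideanSpace ℝ (Fin N))).withDensity
    (fun h => ENNReal.ofReal (ψ h)) with hν
  have : IsProbabilityMeasure ν := by
    constructor
    rw [hν, withDensity_apply _ MeasurableSet.univ, Measure.restrict_univ,
      ← ofReal_integral_eq_lintegral_ofReal b.integrable_normed
        (Eventually.of_forall fun x => b.nonneg_normed x), b.integral_normed, ENNReal.ofReal_one]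
  have hli := hu.locallyIntegrable hN
  refine eLpNorm_two_le_of_enorm_le_lintegral (ν := ν) (f := fun x h => u (x - h) - u x) ?_
    (Eventually.of_forall fun x => ?_) ?_
  · have h1 : AEStronglyMeasurable (fun p : EuclideanSpace ℝ (Fin N) × EuclideanSpace ℝ (Fin N) =>
        u (p.1 - p.2) - u p.1) ((volume : Measure (EuclideanSpace ℝ (Fin N))).prod volume) :=
      (hu.memLp_fun.1.comp_quasiMeasurePreserving
        (quasiMeasurePreserving_sub_of_right_invariant volume volume)).sub
        (hu.memLp_fun.1.comp_quasiMeasurePreserving Measure.quasiMeasurePreserving_fst)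
    exact h1.mono_ac (Measure.AbsolutelyContinuous.rfl.prod (withDensity_absolutelyContinuous _ _))
  · have i1 : Integrable (fun h => ψ h * u (x - h)) :=
      b.hasCompactSupport_normed.convolutionExists_left (ContinuousLinearMap.lsmul ℝ ℝ)
        b.continuous_normed hli x
    have i2 : Integrable (fun h => ψ h * u x) := b.integrable_normed.mul_const _
    have e : mollify b u x - u x = ∫ h, ψ h * (u (x - h) - u x) := by
      simp_rw [mul_sub]
      rw [integral_sub i1 i2, integral_mul_const, hψ, b.integral_normed, one_mul,
        mollify_eq_convolution]
      rfl
    rw [e]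
    refine (enorm_integral_le_lintegral_enorm _).trans (le_of_eq ?_)
    rw [hν, lintegral_withDensity_eq_lintegral_mul_non_measurable _ hm (by simp)]
    refine lintegral_congr fun h => ?_
    rw [enorm_mul, Pi.mul_apply, Real.enorm_of_nonneg (b.nonneg_normed h)]
  · rw [hν, ae_withDensity_iff hm]
    refine Eventually.of_forall fun h hh => ?_
    have h1 : h ∈ Function.support ψ := by
      intro h0
      simp [h0] at hh
    rw [hψ, b.support_normed_eq, mem_ball_zero_iff] at h1
    have h2 := hu.eLpNorm_translate_sub_le hN (-h)
    simp only [← sub_eq_add_neg, enorm_neg] at h2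
    refine h2.trans ?_
    gcongr
    rw [← ofReal_norm]
    exact ENNReal.ofReal_le_ofReal h1.le

end Mollify

/-! ### Local compactness -/

section Rellich

variable {N : ℕ} {v : ℕ → EuclideanSpace ℝ (Fin N) → ℝ}
  {g : ℕ → EuclideanSpace ℝ (Fin N) → EuclideanSpace ℝ (Fin N)}

/-- Weak convergence is available only for `u/|x|` tested against `L²` functions; moving the factor
`|y|` to the compactly supported kernel puts mollification in that form. -/
lemma mollify_eq_integral_hardy (hN : 3 ≤ N) (b : ContDiffBump (0 : EuclideanSpace ℝ (Fin N)))
    (u : EuclideanSpace ℝ (Fin N) → ℝ) (x : EuclideanSpace ℝ (Fin N)) :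
    mollify b u x = ∫ y, (b.normed volume (x - y) * ‖y‖) * (‖y‖⁻¹ * u y) := by
  have : NeZero N := ⟨by omega⟩
  have hne : ∀ᵐ y : EuclideanSpace ℝ (Fin N), y ≠ 0 := by simp [ae_iff, measure_singleton]
  refine integral_congr_ae ?_
  filter_upwards [hne] with y hy
  have : ‖y‖ ≠ 0 := by simpa using hy
  field_simp

lemma hasCompactSupport_normed_sub (b : ContDiffBump (0 : EuclideanSpace ℝ (Fin N)))
    (x : EuclideanSpace ℝ (Fin N)) : HasCompactSupport fun y => b.normed volume (x - y) :=
  b.hasCompactSupport_normed.comp_homeomorph (Homeomorph.subLeft x)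

/-- Cauchy–Schwarz, with `|y| ≤ R + b.rOut` on the support of the kernel. This is the majorant for
dominated convergence on a ball. -/
lemma enorm_mollify_le (hN : 3 ≤ N) (b : ContDiffBump (0 : EuclideanSpace ℝ (Fin N)))
    {u : EuclideanSpace ℝ (Fin N) → ℝ}
    (hu : AEStronglyMeasurable u volume) {R : ℝ}
    {x : EuclideanSpace ℝ (Fin N)} (hx : ‖x‖ < R) :
    ‖mollify b u x‖ₑ ≤ ENNReal.ofReal (R + b.rOut) * eLpNorm (b.normed volume) 2 volume *
      eLpNorm (fun y => ‖y‖⁻¹ * u y) 2 volume := by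
  have cb := b.continuous_normed (μ := volume)
  have hc : Continuous fun y => b.normed volume (x - y) := cb.comp (by fun_prop)
  rw [mollify_eq_integral_hardy hN]
  refine (enorm_integral_le_lintegral_enorm _).trans ?_
  rw [← eLpNorm_one_eq_lintegral_enorm]
  refine (eLpNorm_smul_le_mul_eLpNorm (p := 2) (q := 2) (r := 1)
    (φ := fun y => b.normed volume (x - y) * ‖y‖) (f := fun y => ‖y‖⁻¹ * u y)
    ((by fun_prop : Measurable fun x : EuclideanSpace ℝ (Fin N) =>
      ‖x‖⁻¹).aestronglyMeasurable.mul hu) (hc.mul continuous_norm).aestronglyMeasurable).trans ?_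
  gcongr
  calc eLpNorm (fun y => b.normed volume (x - y) * ‖y‖) 2 volume
      ≤ ENNReal.ofReal (R + b.rOut) * eLpNorm (fun y => b.normed volume (x - y)) 2 volume := by
        refine eLpNorm_le_mul_eLpNorm_of_ae_le_mul (Eventually.of_forall fun y => ?_) _
        rw [norm_mul, norm_norm, mul_comm]
        by_cases hy : b.normed volume (x - y) = 0
        · simp [hy]
        · have : x - y ∈ Function.support (b.normed volume) := hy
          rw [b.support_normed_eq, mem_ball_zero_iff] at this
          gcongr
          have := norm_sub_norm_le y x
          rw [norm_sub_rev] at this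
          linarith
    _ = _ := by
        congr 1
        exact eLpNorm_comp_measurePreserving (g := b.normed volume) (f := fun y => x - y)
          cb.aestronglyMeasurable (Measure.measurePreserving_sub_left volume x)

/-- Rellich's theorem: a sequence bounded in `𝒟^{1,2}` that tends weakly to zero tends to zero in
`L²` of every ball. -/
lemma tendsto_eLpNorm_ball_of_weak (hN : 3 ≤ N) (hv : ∀ n, HasDirichletGrad (v n) (g n))
    {K : ℝ≥0∞} (hK : K ≠ ⊤) (hg : ∀ n, eLpNorm (g n) 2 volume ≤ K)
    (hw : ∀ f : EuclideanSpace ℝ (Fin N) → ℝ, MemLp f 2 volume →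
      Tendsto (fun n => ∫ x, f x * (‖x‖⁻¹ * v n x)) atTop (𝓝 0)) (R : ℝ) :
    Tendsto (fun n => eLpNorm (v n) 2 (volume.restrict (Metric.ball 0 R))) atTop (𝓝 0) := by
  refine ENNReal.tendsto_nhds_zero.2 fun δ hδ => ?_
  -- A mollification radius for which the error is at most `δ / 2` for all `n` at once; at this
  -- fixed radius the mollifications tend to zero pointwise by weak convergence.
  obtain ⟨ε, hε, hεK⟩ : ∃ ε : ℝ, 0 < ε ∧ ENNReal.ofReal ε * K ≤ δ / 2 := by
    have h1 : Tendsto (fun ε : ℝ => ENNReal.ofReal ε * K) (𝓝[>] 0) (𝓝 0) := by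
      have : Tendsto (fun ε : ℝ => ENNReal.ofReal ε * K) (𝓝[>] 0) (𝓝 (ENNReal.ofReal 0 * K)) :=
        ENNReal.Tendsto.mul_const ((ENNReal.continuous_ofReal.tendsto 0).mono_left
          nhdsWithin_le_nhds) (Or.inr hK)
      simpa using this
    have h2 := (ENNReal.tendsto_nhds_zero.1 h1) (δ / 2) (ENNReal.half_pos hδ.ne')
    obtain ⟨ε, h3, h4⟩ := (h2.and self_mem_nhdsWithin).exists
    exact ⟨ε, h4, h3⟩
  let b : ContDiffBump (0 : EuclideanSpace ℝ (Fin N)) := ⟨ε / 2, ε, by linarith, by linarith⟩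
  have cm : ∀ n, Continuous (mollify b (v n)) := fun n =>
    continuous_mollify b ((hv n).locallyIntegrable hN)
  have h1 : Tendsto (fun n => eLpNorm (mollify b (v n)) 2 (volume.restrict (Metric.ball 0 R)))
      atTop (𝓝 0) := by
    set B : ℝ≥0∞ := ENNReal.ofReal (R + b.rOut) * eLpNorm (b.normed volume) 2 volume *
      (ENNReal.ofReal (2 / ((N : ℝ) - 2)) * K) with hB
    have hBt : B ≠ ⊤ := by
      have h0 : eLpNorm (b.normed volume) 2 (volume : Measure (EuclideanSpace ℝ (Fin N))) ≠ ⊤ :=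
        (b.continuous_normed.memLp_of_hasCompactSupport b.hasCompactSupport_normed).2.ne
      finiteness
    have h2 : Tendsto (fun n => ∫⁻ x in Metric.ball 0 R, ‖mollify b (v n) x‖ₑ ^ 2) atTop
        (𝓝 (∫⁻ x in Metric.ball (0 : EuclideanSpace ℝ (Fin N)) R, 0)) := by
      refine tendsto_lintegral_of_dominated_convergence (fun _ => B ^ 2)
        (fun n => ((cm n).measurable.enorm.pow_const 2)) (fun n => ?_) ?_
        (Eventually.of_forall fun x => ?_)
      · refine (ae_restrict_iff' measurableSet_ball).2 (Eventually.of_forall fun x hx => ?_)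
        rw [mem_ball_zero_iff] at hx
        refine pow_le_pow_left₀ zero_le ((enorm_mollify_le hN b (hv n).memLp_fun.1 hx).trans ?_) 2
        rw [hB]
        gcongr
        exact ((hv n).hardy hN).trans (by gcongr; exact hg n)
      · rw [setLIntegral_const]
        exact ENNReal.mul_ne_top (by finiteness) measure_ball_lt_top.ne
      · have hc : Continuous fun y => b.normed volume (x - y) * ‖y‖ :=
          ((b.continuous_normed (μ := volume)).comp (by fun_prop)).mul continuous_norm
        have := hw (fun y => b.normed volume (x - y) * ‖y‖)
          (hc.memLp_of_hasCompactSupport (hasCompactSupport_normed_sub b x).mul_right)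
        simp only [← mollify_eq_integral_hardy hN] at this
        have h3 := (((ENNReal.continuous_pow 2).comp continuous_enorm).tendsto _).comp this
        simpa [Function.comp_def] using h3
    simp only [← eLpNorm_two_pow, lintegral_zero] at h2
    have h3 := (ENNReal.continuous_rpow_const (y := 1 / 2)).tendsto 0 |>.comp h2
    refine (h3.congr fun n => ?_).trans (by simp)
    simp only [Function.comp]
    rw [← ENNReal.rpow_natCast, ← ENNReal.rpow_mul]
    norm_num
  have h2 := (ENNReal.tendsto_nhds_zero.1 h1) (δ / 2) (ENNReal.half_pos hδ.ne')
  filter_upwards [h2] with n hn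
  have e : v n = mollify b (v n) - fun x => mollify b (v n) x - v n x := by
    ext x
    simp
  rw [e]
  have hm : AEStronglyMeasurable (fun x => mollify b (v n) x - v n x) volume :=
    (cm n).aestronglyMeasurable.sub (hv n).memLp_fun.1
  refine (eLpNorm_sub_le (cm n).aestronglyMeasurable hm.restrict (by norm_num)).trans ?_
  rw [← ENNReal.add_halves δ]
  refine add_le_add hn ((eLpNorm_restrict_le _ _ _ _).trans
    (((hv n).eLpNorm_mollify_sub_le hN b).trans (le_trans ?_ hεK)))
  gcongr
  exact hg n

/-- Convergence in `L²` of all balls implies almost everywhere convergence of a subsequence. -/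
lemma exists_seq_tendsto_ae_of_ball (hN : 3 ≤ N) (hv : ∀ n, HasDirichletGrad (v n) (g n))
    {K : ℝ≥0∞} (hK : K ≠ ⊤) (hg : ∀ n, eLpNorm (g n) 2 volume ≤ K)
    (hb : ∀ R : ℝ, Tendsto (fun n => eLpNorm (v n) 2 (volume.restrict (Metric.ball 0 R)))
      atTop (𝓝 0)) :
    ∃ ns : ℕ → ℕ, StrictMono ns ∧ ∀ᵐ x, Tendsto (fun n => v (ns n) x) atTop (𝓝 0) := by
  -- With this weight, `W v n` tends to zero in `L²` of the whole space: outside the ball of radius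
  -- `R` one has `W ≤ 1/(R |x|)`, and Hardy's inequality bounds the tail. One extraction then
  -- suffices, without a diagonal argument over balls.
  set W : EuclideanSpace ℝ (Fin N) → ℝ := fun x => (1 + ‖x‖ ^ 2)⁻¹ with hW
  have hWpos : ∀ x, 0 < W x := fun x => by positivity
  have hWm : Measurable W := by fun_prop
  have hm : ∀ n, AEStronglyMeasurable (fun x => W x * v n x) volume := fun n =>
    hWm.aestronglyMeasurable.mul (hv n).memLp_fun.1
  have h0 : Tendsto (fun n => eLpNorm (fun x => W x * v n x) 2 volume) atTop (𝓝 0) := by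
    refine ENNReal.tendsto_nhds_zero.2 fun δ hδ => ?_
    obtain ⟨R, hR, hRK⟩ : ∃ R : ℝ, 0 < R ∧
        ENNReal.ofReal R⁻¹ * (ENNReal.ofReal (2 / ((N : ℝ) - 2)) * K) ≤ δ / 2 := by
      have h1 : Tendsto (fun R : ℝ => ENNReal.ofReal R⁻¹ *
          (ENNReal.ofReal (2 / ((N : ℝ) - 2)) * K)) atTop (𝓝 0) := by
        have := ENNReal.Tendsto.mul_const (b := ENNReal.ofReal (2 / ((N : ℝ) - 2)) * K)
          ((ENNReal.continuous_ofReal.tendsto 0).comp tendsto_inv_atTop_zero)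
          (Or.inr (by finiteness))
        simpa using this
      have h2 := (ENNReal.tendsto_nhds_zero.1 h1) (δ / 2) (ENNReal.half_pos hδ.ne')
      obtain ⟨R, h3, h4⟩ := (h2.and (eventually_gt_atTop 0)).exists
      exact ⟨R, h4, h3⟩
    filter_upwards [(ENNReal.tendsto_nhds_zero.1 (hb R)) (δ / 2) (ENNReal.half_pos hδ.ne')] with n hn
    rw [← Set.indicator_self_add_compl (Metric.ball 0 R) fun x => W x * v n x]
    refine (eLpNorm_add_le ((hm n).indicator measurableSet_ball)
      ((hm n).indicator measurableSet_ball.compl) (by norm_num)).trans ?_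
    rw [← ENNReal.add_halves δ]
    refine add_le_add (le_trans ?_ hn) (le_trans ?_ hRK)
    · rw [eLpNorm_indicator_eq_eLpNorm_restrict measurableSet_ball]
      refine eLpNorm_mono fun x => ?_
      rw [norm_mul, Real.norm_of_nonneg (hWpos x).le]
      refine mul_le_of_le_one_left (norm_nonneg _) (inv_le_one_of_one_le₀ ?_)
      linarith [sq_nonneg ‖x‖]
    · refine le_trans ?_ (mul_le_mul_right (((hv n).hardy hN).trans
        (mul_le_mul_right (hg n) _)) _)
      refine eLpNorm_le_mul_eLpNorm_of_ae_le_mul (Eventually.of_forall fun x => ?_) _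
      by_cases hx : x ∈ Metric.ball (0 : EuclideanSpace ℝ (Fin N)) R
      · rw [Set.indicator_of_notMem (by simpa using hx), norm_zero]
        positivity
      · rw [Set.indicator_of_mem hx, norm_mul, norm_mul, Real.norm_of_nonneg (hWpos x).le, norm_inv,
          norm_norm, ← mul_assoc, ← mul_inv]
        rw [mem_ball_zero_iff, not_lt] at hx
        have : W x ≤ (R * ‖x‖)⁻¹ :=
          inv_anti₀ (mul_pos hR (hR.trans_le hx)) (by nlinarith [norm_nonneg x])
        gcongr
  have hT : TendstoInMeasure volume (fun n x => W x * v n x) atTop (fun _ => (0 : ℝ)) :=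
    tendstoInMeasure_of_tendsto_eLpNorm (p := 2) (by norm_num) hm aestronglyMeasurable_const
      (h0.congr fun n => eLpNorm_congr_ae (Eventually.of_forall fun x => by simp))
  obtain ⟨ns, hns, hae⟩ := hT.exists_seq_tendsto_ae
  refine ⟨ns, hns, ?_⟩
  filter_upwards [hae] with x hx
  have := hx.const_mul (W x)⁻¹
  simpa [← mul_assoc, inv_mul_cancel₀ (hWpos x).ne'] using this

end Rellich

/-! ### Weak sequential compactness -/

/-- Bounded sequences in a separable Hilbert space have weakly convergent subsequences. -/
lemma exists_weakly_convergent_subseq {H : Type*} [NormedAddCommGroup H] [InnerProductSpace ℝ H]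
    [CompleteSpace H] [TopologicalSpace.SeparableSpace H] {X : ℕ → H} {K : ℝ}
    (hX : ∀ n, ‖X n‖ ≤ K) : ∃ (X₀ : H) (ns : ℕ → ℕ), StrictMono ns ∧
      ∀ Y, Tendsto (fun n => inner ℝ Y (X (ns n))) atTop (𝓝 (inner ℝ Y X₀)) := by
  obtain ⟨a, -, ns, hns, ha⟩ := WeakDual.isSeqCompact_closedBall ℝ H 0 K
    (x := fun n => StrongDual.toWeakDual (InnerProductSpace.toDual ℝ H (X n)))
    (fun n => by simpa using hX n)
  refine ⟨(InnerProductSpace.toDual ℝ H).symm (WeakDual.toStrongDual a), ns, hns, fun Y => ?_⟩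
  have h1 := ((WeakDual.eval_continuous Y).tendsto a).comp ha
  rw [real_inner_comm, InnerProductSpace.toDual_symm_apply]
  refine Tendsto.congr (fun n => ?_) h1
  simp only [Function.comp]
  rw [real_inner_comm]
  rfl

/-- Orthogonality to each vector of `Sᗮ` survives the weak limit, and a closed subspace is its own
double orthogonal complement. -/
lemma mem_of_weakly_convergent {H : Type*} [NormedAddCommGroup H] [InnerProductSpace ℝ H]
    [CompleteSpace H] {S : Submodule ℝ H} (hS : IsClosed (S : Set H)) {X : ℕ → H} {X₀ : H}
    (hX : ∀ n, X n ∈ S)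
    (h : ∀ Y, Tendsto (fun n => inner ℝ Y (X n)) atTop (𝓝 (inner ℝ Y X₀))) : X₀ ∈ S := by
  rw [← hS.submodule_topologicalClosure_eq, ← Submodule.orthogonal_orthogonal_eq_closure]
  rw [Submodule.mem_orthogonal]
  intro Y hY
  refine tendsto_nhds_unique (h Y) ?_
  simp_rw [fun n => (Submodule.mem_orthogonal' _ _).1 hY (X n) (hX n)]
  exact tendsto_const_nhds

/-! ### Completeness of `𝒟^{1,2}` -/

section Complete

variable {N : ℕ} {u : ℕ → EuclideanSpace ℝ (Fin N) → ℝ}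
  {g : ℕ → EuclideanSpace ℝ (Fin N) → EuclideanSpace ℝ (Fin N)}

/-- Replace each `u n` by a test function whose gradient is within `1/n` of `g n`. These gradients
still tend to `g₀`, so by Sobolev's inequality the test functions are Cauchy in `L^{2*}`, and their
limit is the required function. -/
lemma exists_hasDirichletGrad_of_tendsto (hN : 3 ≤ N) (hu : ∀ n, HasDirichletGrad (u n) (g n))
    {g₀ : EuclideanSpace ℝ (Fin N) → EuclideanSpace ℝ (Fin N)} (hg₀ : MemLp g₀ 2 volume)
    (hg : Tendsto (fun n => eLpNorm (fun x => g n x - g₀ x) 2 volume) atTop (𝓝 0)) :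
    ∃ u₀, HasDirichletGrad u₀ g₀ := by
  have hp : Fact (1 ≤ ENNReal.ofReal (critExp N)) := ⟨one_le_ofReal_critExp hN⟩
  have h1 : ∀ n : ℕ, ∃ φ : EuclideanSpace ℝ (Fin N) → ℝ, IsTest φ ∧
      eLpNorm (fun x => ∇ φ x - g n x) 2 volume ≤ ((n : ℝ≥0∞))⁻¹ := fun n => by
    obtain ⟨φ, hφ, -, h2⟩ := (hu n).approx
    obtain ⟨m, hm⟩ := ((ENNReal.tendsto_nhds_zero.1 h2) ((n : ℝ≥0∞))⁻¹ (by simp)).exists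
    exact ⟨φ m, hφ m, hm⟩
  choose φ hφ hφg using h1
  set a : ℕ → ℝ≥0∞ := fun n => eLpNorm (fun x => ∇ (φ n) x - g₀ x) 2 volume with ha_def
  have ha : Tendsto a atTop (𝓝 0) := by
    refine tendsto_of_tendsto_of_tendsto_of_le_of_le tendsto_const_nhds
      (by simpa using ENNReal.tendsto_inv_nat_nhds_zero.add hg) (fun _ => zero_le) fun n => ?_
    have e : (fun x => ∇ (φ n) x - g₀ x) = (fun x => ∇ (φ n) x - g n x) +
        fun x => g n x - g₀ x := by
      ext1 x
      simp
    have h2 := eLpNorm_add_le (f := fun x => ∇ (φ n) x - g n x) (g := fun x => g n x - g₀ x)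
      (μ := volume) (p := 2) (((hφ n).memLp_gradient 2).sub (hu n).memLp_grad).1
      ((hu n).memLp_grad.sub hg₀).1 (by norm_num)
    rw [← e] at h2
    exact h2.trans (add_le_add (hφg n) le_rfl)
  obtain ⟨C, hC⟩ := exists_sobolev_const hN
  have hb : Tendsto (fun n => C * a n) atTop (𝓝 0) := by
    simpa using ENNReal.Tendsto.const_mul ha (Or.inr (ENNReal.coe_ne_top (r := C)))
  have hmem := fun n => (hφ n).memLp (ENNReal.ofReal (critExp N))
  have hle : ∀ n m, edist ((hmem n).toLp (φ n)) ((hmem m).toLp (φ m)) ≤ C * a n + C * a m := by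
    intro n m
    rw [Lp.edist_toLp_toLp, ← mul_add]
    have h2 := (hφ n).hasDirichletGrad.sub hN (hφ m).hasDirichletGrad
    refine (hC _ _ h2).trans ?_
    gcongr
    have e : (fun x => ∇ (φ n) x - ∇ (φ m) x) = (fun x => ∇ (φ n) x - g₀ x) -
        fun x => ∇ (φ m) x - g₀ x := by
      ext1 x
      simp
    rw [e]
    exact eLpNorm_sub_le (((hφ n).memLp_gradient 2).sub
      hg₀).1 (((hφ m).memLp_gradient 2).sub hg₀).1 (by norm_num)
  have hcau : CauchySeq fun n => (hmem n).toLp (φ n) := by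
    refine EMetric.cauchySeq_iff.2 fun ε hε => ?_
    obtain ⟨n₀, hn₀⟩ := eventually_atTop.1
      (hb.eventually (gt_mem_nhds (ENNReal.half_pos hε.ne')))
    refine ⟨n₀, fun m hm n hn => (hle m n).trans_lt ?_⟩
    rw [← ENNReal.add_halves ε]
    exact ENNReal.add_lt_add (hn₀ m hm) (hn₀ n hn)
  obtain ⟨U, hU⟩ := cauchySeq_tendsto_of_complete hcau
  refine ⟨U, Lp.memLp U, hg₀, φ, hφ, ?_, ha⟩
  have := (Lp.tendsto_Lp_iff_tendsto_eLpNorm' _ _).1 hU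
  refine this.congr fun n => eLpNorm_congr_ae ?_
  filter_upwards [(hmem n).coeFn_toLp] with x hx
  simp [hx]

end Complete

/-! ### Weak limits in `𝒟^{1,2}` -/

section WeakLimit

variable {N : ℕ}

/-- The pairs `(∇u, u / |x|)`, as a subspace of a Hilbert space. -/
def dirichletPairs (N : ℕ) (hN : 3 ≤ N) : Submodule ℝ
    (WithLp 2 (Lp (EuclideanSpace ℝ (Fin N)) 2 (volume : Measure (EuclideanSpace ℝ (Fin N))) ×
      Lp ℝ 2 (volume : Measure (EuclideanSpace ℝ (Fin N))))) where
  carrier := {X | ∃ u g, HasDirichletGrad u g ∧ X.fst =ᵐ[volume] g ∧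
    X.snd =ᵐ[volume] fun x => ‖x‖⁻¹ * u x}
  add_mem' := by
    rintro X Y ⟨u, g, h, h1, h2⟩ ⟨v, k, h', h1', h2'⟩
    refine ⟨_, _, h.add hN h', ?_, ?_⟩
    · filter_upwards [Lp.coeFn_add X.fst Y.fst, h1, h1'] with x a b c
      rw [WithLp.add_fst, a, Pi.add_apply, b, c]
    · filter_upwards [Lp.coeFn_add X.snd Y.snd, h2, h2'] with x a b c
      rw [WithLp.add_snd, a, Pi.add_apply, b, c, mul_add]
  zero_mem' := by
    have h0 : HasDirichletGrad (N := N) (fun _ => 0) (fun _ => 0) := by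
      have h : IsTest (N := N) (fun _ => 0) := ⟨contDiff_const, HasCompactSupport.zero⟩
      refine h.hasDirichletGrad.congr ae_eq_rfl (Eventually.of_forall fun x => ?_)
      simp
    refine ⟨_, _, h0, ?_, ?_⟩
    · exact Lp.coeFn_zero _ 2 _
    · filter_upwards [Lp.coeFn_zero ℝ 2 (volume : Measure (EuclideanSpace ℝ (Fin N)))] with x hx
      rw [mul_zero]
      exact hx
  smul_mem' := by
    rintro c X ⟨u, g, h, h1, h2⟩
    refine ⟨_, _, h.const_mul c, ?_, ?_⟩
    · filter_upwards [Lp.coeFn_smul c X.fst, h1] with x a b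
      rw [WithLp.smul_fst, a, Pi.smul_apply, b]
    · filter_upwards [Lp.coeFn_smul c X.snd, h2] with x a b
      rw [WithLp.smul_snd, a, Pi.smul_apply, b, smul_eq_mul]
      ring

/-- Convergence of the first components yields a function `u₀` with the limiting gradient; Hardy's
inequality for `u n - u₀` identifies the limit of the second components as `u₀ / |x|`. -/
lemma isClosed_dirichletPairs (hN : 3 ≤ N) :
    IsClosed (dirichletPairs N hN : Set (WithLp 2 (Lp (EuclideanSpace ℝ (Fin N)) 2
      (volume : Measure (EuclideanSpace ℝ (Fin N))) × Lp ℝ 2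
        (volume : Measure (EuclideanSpace ℝ (Fin N)))))) := by
  refine IsSeqClosed.isClosed fun X X₀ hX hlim => ?_
  choose u g h h1 h2 using hX
  have hf : Tendsto (fun n => (X n).fst) atTop (𝓝 X₀.fst) :=
    ((WithLp.continuous_fst 2 _ _).tendsto _).comp hlim
  have hs : Tendsto (fun n => (X n).snd) atTop (𝓝 X₀.snd) :=
    ((WithLp.continuous_snd 2 _ _).tendsto _).comp hlim
  rw [Lp.tendsto_Lp_iff_tendsto_eLpNorm'] at hf hs
  have hf' : Tendsto (fun n => eLpNorm (fun x => g n x - X₀.fst x) 2 volume) atTop (𝓝 0) := by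
    refine hf.congr fun n => eLpNorm_congr_ae ?_
    filter_upwards [h1 n] with x hx
    rw [Pi.sub_apply, hx]
  obtain ⟨u₀, hu₀⟩ := exists_hasDirichletGrad_of_tendsto hN h (Lp.memLp X₀.fst) hf'
  refine ⟨u₀, _, hu₀, ae_eq_rfl, ?_⟩
  have h3 : Tendsto (fun n => eLpNorm (fun x => ‖x‖⁻¹ * (u n x - u₀ x)) 2 volume) atTop (𝓝 0) := by
    refine tendsto_of_tendsto_of_tendsto_of_le_of_le tendsto_const_nhds ?_ (fun _ => zero_le)
      fun n => ((h n).sub hN hu₀).hardy hN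
    simpa using ENNReal.Tendsto.const_mul hf' (Or.inr ENNReal.ofReal_ne_top)
  have hw₀ := hu₀.memLp_hardy hN
  have hz : eLpNorm (fun x => X₀.snd x - ‖x‖⁻¹ * u₀ x) 2 volume = 0 := by
    refine le_antisymm (ge_of_tendsto' (by simpa using hs.add h3) fun n => ?_) zero_le
    rw [← eLpNorm_neg (⇑(X n).snd - ⇑X₀.snd)]
    refine le_trans (le_of_eq ?_) (eLpNorm_add_le ((Lp.memLp (X n).snd).sub
      (Lp.memLp X₀.snd)).neg.1 (((h n).sub hN hu₀).memLp_hardy hN).1 (by norm_num))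
    refine eLpNorm_congr_ae ?_
    filter_upwards [h2 n] with x hx
    simp only [Pi.add_apply, Pi.neg_apply, Pi.sub_apply, hx]
    ring
  have hm : AEStronglyMeasurable (fun x => X₀.snd x - ‖x‖⁻¹ * u₀ x) volume :=
    ((Lp.memLp X₀.snd).sub hw₀).1
  rw [eLpNorm_eq_zero_iff hm (by norm_num)] at hz
  filter_upwards [hz] with x hx
  simpa [sub_eq_zero] using hx

/-- Working in the closed subspace of pairs provides a single subsequence for the gradients and for
`u/|x|`, and ensures that both limits come from the same function. -/
lemma exists_weak_limit (hN : 3 ≤ N) {u : ℕ → EuclideanSpace ℝ (Fin N) → ℝ}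
    {g : ℕ → EuclideanSpace ℝ (Fin N) → EuclideanSpace ℝ (Fin N)}
    (hu : ∀ n, HasDirichletGrad (u n) (g n)) {K : ℝ≥0∞} (hK : K ≠ ⊤)
    (hg : ∀ n, eLpNorm (g n) 2 volume ≤ K) :
    ∃ u₀ g₀, ∃ ns : ℕ → ℕ, StrictMono ns ∧ HasDirichletGrad u₀ g₀ ∧
      (∀ f : EuclideanSpace ℝ (Fin N) → ℝ, MemLp f 2 volume →
        Tendsto (fun n => ∫ x, f x * (‖x‖⁻¹ * u (ns n) x)) atTop
          (𝓝 (∫ x, f x * (‖x‖⁻¹ * u₀ x)))) ∧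
      (∀ k : EuclideanSpace ℝ (Fin N) → EuclideanSpace ℝ (Fin N), MemLp k 2 volume →
        Tendsto (fun n => ∫ x, inner ℝ (k x) (g (ns n) x)) atTop
          (𝓝 (∫ x, inner ℝ (k x) (g₀ x)))) := by
  let G := fun n => (hu n).memLp_grad.toLp (g n)
  let W := fun n => ((hu n).memLp_hardy hN).toLp (fun x => ‖x‖⁻¹ * u n x)
  let X : ℕ → WithLp 2 (Lp (EuclideanSpace ℝ (Fin N)) 2
    (volume : Measure (EuclideanSpace ℝ (Fin N))) × Lp ℝ 2
      (volume : Measure (EuclideanSpace ℝ (Fin N)))) := fun n => WithLp.toLp 2 (G n, W n)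
  have hXmem : ∀ n, X n ∈ dirichletPairs N hN := fun n =>
    ⟨u n, g n, hu n, (hu n).memLp_grad.coeFn_toLp, ((hu n).memLp_hardy hN).coeFn_toLp⟩
  have hXb : ∀ n, ‖X n‖ ≤ √(K.toReal ^ 2 + (ENNReal.ofReal (2 / ((N : ℝ) - 2)) * K).toReal ^ 2) := by
    intro n
    rw [WithLp.prod_norm_eq_of_L2]
    refine Real.sqrt_le_sqrt (add_le_add ?_ ?_)
    · refine pow_le_pow_left₀ (norm_nonneg _) ?_ 2
      rw [show (X n).fst = G n from rfl, Lp.norm_toLp]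
      exact ENNReal.toReal_mono hK (hg n)
    · refine pow_le_pow_left₀ (norm_nonneg _) ?_ 2
      rw [show (X n).snd = W n from rfl, Lp.norm_toLp]
      exact ENNReal.toReal_mono (by finiteness) (((hu n).hardy hN).trans (by gcongr; exact hg n))
  have : TopologicalSpace.SeparableSpace (WithLp 2 (Lp (EuclideanSpace ℝ (Fin N)) 2
    (volume : Measure (EuclideanSpace ℝ (Fin N))) × Lp ℝ 2
      (volume : Measure (EuclideanSpace ℝ (Fin N))))) := by
    have : Fact ((2 : ℝ≥0∞) ≠ ⊤) := ⟨by norm_num⟩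
    have s1 : SecondCountableTopology (Lp (EuclideanSpace ℝ (Fin N)) 2
      (volume : Measure (EuclideanSpace ℝ (Fin N)))) := inferInstance
    have s2 : SecondCountableTopology (Lp ℝ 2
      (volume : Measure (EuclideanSpace ℝ (Fin N)))) := inferInstance
    have s3 := WithLp.secondCountableTopology 2 (Lp (EuclideanSpace ℝ (Fin N)) 2
      (volume : Measure (EuclideanSpace ℝ (Fin N)))) (Lp ℝ 2
        (volume : Measure (EuclideanSpace ℝ (Fin N))))
    exact @TopologicalSpace.SecondCountableTopology.to_separableSpace _ _ s3
  obtain ⟨X₀, ns, hns, hX⟩ := exists_weakly_convergent_subseq hXb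
  obtain ⟨u₀, g₀, h, h1, h2⟩ := mem_of_weakly_convergent (isClosed_dirichletPairs hN)
    (fun n => hXmem (ns n)) hX
  refine ⟨u₀, g₀, ns, hns, h, fun f hf => ?_, fun k hk => ?_⟩
  · have := hX (WithLp.toLp 2 (0, hf.toLp f))
    simp only [WithLp.prod_inner_apply, inner_zero_left, zero_add,
      L2.inner_def] at this
    convert this using 1
    · ext n
      refine integral_congr_ae ?_
      filter_upwards [hf.coeFn_toLp, ((hu (ns n)).memLp_hardy hN).coeFn_toLp] with x a b
      rw [a, real_inner_comm]
      change _ = f x * W (ns n) x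
      rw [b]
    · congr 1
      refine integral_congr_ae ?_
      filter_upwards [hf.coeFn_toLp, h2] with x a b
      rw [a, real_inner_comm]
      change _ = f x * X₀.snd x
      rw [b]
  · have := hX (WithLp.toLp 2 (hk.toLp k, 0))
    simp only [WithLp.prod_inner_apply, inner_zero_left, add_zero,
      L2.inner_def] at this
    convert this using 1
    · ext n
      refine integral_congr_ae ?_
      filter_upwards [hk.coeFn_toLp, (hu (ns n)).memLp_grad.coeFn_toLp] with x a b
      rw [a]
      change _ = inner ℝ (k x) (G (ns n) x)
      rw [b]
    · congr 1
      refine integral_congr_ae ?_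
      filter_upwards [hk.coeFn_toLp, h1] with x a b
      rw [a]
      change _ = inner ℝ (k x) (X₀.fst x)
      rw [b]

end WeakLimit

/-! ### The Brezis–Lieb lemma -/

/-- Convexity of the power, with `|a| + |b|` written as a combination of `|a|/(1 - t)` and `|b|/t`
with weights `1 - t` and `t`; for `t` small the first coefficient `(1 - t)^(1 - p)` is below `1 +
ε`. -/
lemma exists_abs_add_rpow_le {p : ℝ} (hp : 1 ≤ p) {ε : ℝ} (hε : 0 < ε) :
    ∃ C, 0 ≤ C ∧ ∀ a b : ℝ, |a + b| ^ p ≤ (1 + ε) * |a| ^ p + C * |b| ^ p := by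
  obtain ⟨t, ht, ht0, ht1⟩ : ∃ t : ℝ, (1 - t) ^ (1 - p) < 1 + ε ∧ 0 < t ∧ t < 1 := by
    have h1 : Tendsto (fun t : ℝ => (1 - t) ^ (1 - p)) (𝓝[>] 0) (𝓝 1) := by
      have : ContinuousAt (fun t : ℝ => (1 - t) ^ (1 - p)) 0 :=
        ContinuousAt.rpow_const (by fun_prop) (Or.inl (by norm_num))
      have h2 := this.tendsto.mono_left (nhdsWithin_le_nhds (s := Set.Ioi 0))
      simpa using h2
    obtain ⟨t, h3, h4⟩ := ((h1.eventually (gt_mem_nhds (by linarith : (1 : ℝ) < 1 + ε))).and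
      (Ioo_mem_nhdsGT (zero_lt_one' ℝ))).exists
    exact ⟨t, h3, h4.1, h4.2⟩
  have hs : 0 < 1 - t := by linarith
  refine ⟨t ^ (1 - p), by positivity, fun a b => ?_⟩
  have hconv := (convexOn_rpow hp).2 (x := |a| / (1 - t)) (y := |b| / t)
    (show (0 : ℝ) ≤ _ by positivity) (show (0 : ℝ) ≤ _ by positivity) hs.le ht0.le (by ring)
  simp only [smul_eq_mul] at hconv
  rw [mul_div_cancel₀ _ hs.ne', mul_div_cancel₀ _ ht0.ne',
    Real.div_rpow (abs_nonneg _) hs.le, Real.div_rpow (abs_nonneg _) ht0.le] at hconv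
  have e : ∀ s : ℝ, 0 < s → ∀ x : ℝ, s * (x / s ^ p) = s ^ (1 - p) * x := fun s hs x => by
    rw [Real.rpow_sub hs, Real.rpow_one]
    ring
  rw [e _ hs, e _ ht0] at hconv
  calc |a + b| ^ p ≤ (|a| + |b|) ^ p :=
        Real.rpow_le_rpow (abs_nonneg _) (abs_add_le a b) (by linarith)
    _ ≤ _ := hconv
    _ ≤ _ := by gcongr

/-- Apply the one-sided inequality to `(a, b)` for the upper bound and to `(a + b, -b)` for the
lower one. -/
lemma exists_abs_add_rpow_sub_le {p : ℝ} (hp : 1 ≤ p) {ε : ℝ} (hε : 0 < ε) :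
    ∃ C, 0 ≤ C ∧ ∀ a b : ℝ, |(|a + b| ^ p - |a| ^ p)| ≤ ε * |a| ^ p + C * |b| ^ p := by
  obtain ⟨δ, hδ, hδ1, hδε⟩ : ∃ δ : ℝ, 0 < δ ∧ δ ≤ 1 ∧ 2 * δ ≤ ε :=
    ⟨min 1 (ε / 2), by positivity, min_le_left _ _, by linarith [min_le_right 1 (ε / 2)]⟩
  obtain ⟨C, hC, h⟩ := exists_abs_add_rpow_le hp hδ
  refine ⟨2 * C, by positivity, fun a b => ?_⟩
  have h1 := h a b
  have h2 := h (a + b) (-b)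
  rw [add_neg_cancel_right, abs_neg] at h2
  have ha : 0 ≤ |a| ^ p := by positivity
  have hb : 0 ≤ C * |b| ^ p := by positivity
  have h3 : δ * |a + b| ^ p ≤ δ * ((1 + δ) * |a| ^ p + C * |b| ^ p) := by gcongr
  have h4 : δ * (δ * |a| ^ p) ≤ δ * |a| ^ p := mul_le_of_le_one_left (by positivity) hδ1
  have h5 : δ * (C * |b| ^ p) ≤ C * |b| ^ p := mul_le_of_le_one_left hb hδ1
  have h6 : 2 * δ * |a| ^ p ≤ ε * |a| ^ p := by gcongr
  rw [abs_le]
  constructor <;> nlinarith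

lemma integrable_abs_rpow {α : Type*} [MeasurableSpace α] {μ : Measure α} {p : ℝ}
    (hp : 0 < p) {f : α → ℝ} (hf : MemLp f (ENNReal.ofReal p) μ) :
    Integrable (fun x => |f x| ^ p) μ := by
  have := hf.integrable_norm_rpow (by simpa using hp) (by simp)
  simpa [ENNReal.toReal_ofReal hp.le] using this

/-- Let `d n` be the defect of additivity of the `p`-th powers. The part of `|d n|` exceeding `ε |f
n - f₀|^p` is dominated by `(C + 1) |f₀|^p`, so its integral tends to zero; the rest contributes at
most `ε M`, with `ε` arbitrary. -/
theorem brezis_lieb {α : Type*} [MeasurableSpace α] {μ : Measure α} {p : ℝ} (hp : 1 ≤ p)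
    {f : ℕ → α → ℝ} {f₀ : α → ℝ} (hf : ∀ n, MemLp (f n) (ENNReal.ofReal p) μ)
    (hf₀ : MemLp f₀ (ENNReal.ofReal p) μ) {M : ℝ}
    (hM : ∀ n, ∫ x, |f n x - f₀ x| ^ p ∂μ ≤ M)
    (hlim : ∀ᵐ x ∂μ, Tendsto (fun n => f n x) atTop (𝓝 (f₀ x))) :
    Tendsto (fun n => ∫ x, |f n x| ^ p ∂μ - ∫ x, |f n x - f₀ x| ^ p ∂μ) atTop
      (𝓝 (∫ x, |f₀ x| ^ p ∂μ)) := by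
  have hp0 : 0 < p := by linarith
  have i1 := fun n => integrable_abs_rpow hp0 (hf n)
  have i2 := integrable_abs_rpow hp0 hf₀
  have i3 : ∀ n, Integrable (fun x => |f n x - f₀ x| ^ p) μ := fun n =>
    integrable_abs_rpow hp0 ((hf n).sub hf₀)
  rw [← tendsto_sub_nhds_zero_iff]
  refine Metric.tendsto_nhds.2 fun δ hδ => ?_
  obtain ⟨ε, hε, hεM⟩ : ∃ ε : ℝ, 0 < ε ∧ ε * M ≤ δ / 2 := by
    refine ⟨δ / 2 / (|M| + 1), by positivity, ?_⟩
    rw [div_mul_eq_mul_div, div_le_iff₀ (by positivity)]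
    have := le_abs_self M
    gcongr
    linarith
  obtain ⟨C, hC, hineq⟩ := exists_abs_add_rpow_sub_le hp hε
  set d : ℕ → α → ℝ := fun n x => |f n x| ^ p - |f n x - f₀ x| ^ p - |f₀ x| ^ p with hd
  set G : ℕ → α → ℝ := fun n x => max (|d n x| - ε * |f n x - f₀ x| ^ p) 0 with hG
  have id : ∀ n, Integrable (d n) μ := fun n => ((i1 n).sub (i3 n)).sub i2
  have iG : ∀ n, Integrable (G n) μ := fun n => ((id n).abs.sub ((i3 n).const_mul ε)).pos_part
  have hGlim : Tendsto (fun n => ∫ x, G n x ∂μ) atTop (𝓝 (∫ x, (0 : ℝ) ∂μ)) := by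
    refine tendsto_integral_of_dominated_convergence (fun x => (C + 1) * |f₀ x| ^ p)
      (fun n => (iG n).1) (i2.const_mul _) (fun n => Eventually.of_forall fun x => ?_) ?_
    · have h1 := hineq (f n x - f₀ x) (f₀ x)
      rw [sub_add_cancel] at h1
      have h2 : 0 ≤ |f₀ x| ^ p := by positivity
      rw [Real.norm_of_nonneg (le_max_right _ _)]
      refine max_le ?_ (by positivity)
      have h3 : |d n x| ≤ |(|f n x| ^ p - |f n x - f₀ x| ^ p)| + |f₀ x| ^ p := by
        have := abs_sub (|f n x| ^ p - |f n x - f₀ x| ^ p) (|f₀ x| ^ p)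
        rwa [abs_of_nonneg h2] at this
      linarith
    · filter_upwards [hlim] with x hx
      have c : Continuous fun t : ℝ => |t| ^ p :=
        continuous_abs.rpow_const fun _ => Or.inr hp0.le
      have h1 := (c.tendsto _).comp hx
      have h2 := (c.tendsto 0).comp (tendsto_sub_nhds_zero_iff.2 hx)
      simp only [Function.comp_def, abs_zero, Real.zero_rpow hp0.ne'] at h1 h2
      have h3 := (((h1.sub h2).sub_const (|f₀ x| ^ p)).abs.sub (h2.const_mul ε)).max
        (tendsto_const_nhds (x := (0 : ℝ)))
      simpa using h3
  rw [integral_zero] at hGlim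
  filter_upwards [Metric.tendsto_nhds.1 hGlim (δ / 2) (by positivity)] with n hn
  rw [Real.dist_eq, sub_zero] at hn ⊢
  have e := integral_sub ((i1 n).sub (i3 n)) i2
  simp only [Pi.sub_apply] at e
  rw [integral_sub (i1 n) (i3 n)] at e
  rw [← e]
  calc |∫ x, d n x ∂μ| ≤ ∫ x, |d n x| ∂μ := abs_integral_le_integral_abs
    _ ≤ ∫ x, (G n x + ε * |f n x - f₀ x| ^ p) ∂μ :=
        integral_mono (id n).abs ((iG n).add ((i3 n).const_mul ε)) fun x => by
          have := le_max_left (|d n x| - ε * |f n x - f₀ x| ^ p) 0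
          simp only [hG]
          linarith
    _ = ∫ x, G n x ∂μ + ε * ∫ x, |f n x - f₀ x| ^ p ∂μ := by
        rw [integral_add (iG n) ((i3 n).const_mul ε), integral_const_mul]
    _ < δ / 2 + δ / 2 := by
        refine add_lt_add_of_lt_of_le ((le_abs_self _).trans_lt hn) (le_trans ?_ hεM)
        gcongr
        exact hM n
    _ = δ := add_halves δ

/-! ### Localized Sobolev inequalities -/

section Localize

variable {N : ℕ}

lemma eLpNorm_critExp_rpow (hN : 3 ≤ N) (u : EuclideanSpace ℝ (Fin N) → ℝ) :
    eLpNorm u (ENNReal.ofReal (critExp N)) volume ^ critExp N = ∫⁻ x, ‖u x‖ₑ ^ critExp N := by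
  have hp : 0 < critExp N := by linarith [two_lt_critExp hN]
  rw [eLpNorm_eq_lintegral_rpow_enorm_toReal (ofReal_critExp_ne_zero hN) (by simp),
    toReal_ofReal_critExp hN, ← ENNReal.rpow_mul, one_div, inv_mul_cancel₀ hp.ne', ENNReal.rpow_one]

lemma one_sub_two_div_critExp_pos (hN : 3 ≤ N) : 0 < 1 - 2 / critExp N := by
  have hp := two_lt_critExp hN
  rw [sub_pos, div_lt_one (by linarith)]
  exact hp

/-- Write the localized mass as `I = I^(1 - 2/2*) * I^(2/2*)`. The first factor is at most `M^(1 -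
2/2*)`, and Sobolev's inequality for `η u` bounds the second by an energy. The positive power of `M`
is what makes small local masses useful. -/
lemma exists_cutoff_const (hN : 3 ≤ N) : ∃ C : NNReal,
    ∀ (u : EuclideanSpace ℝ (Fin N) → ℝ) (g : EuclideanSpace ℝ (Fin N) → EuclideanSpace ℝ (Fin N)),
    HasDirichletGrad u g → ∀ η : EuclideanSpace ℝ (Fin N) → ℝ, IsTest η → ∀ M : ℝ≥0∞,
      ∫⁻ x, ‖η x‖ₑ ^ critExp N * ‖u x‖ₑ ^ critExp N ≤ M →
      ∫⁻ x, ‖η x‖ₑ ^ critExp N * ‖u x‖ₑ ^ critExp N ≤ M ^ (1 - 2 / critExp N) *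
        (C * ((∫⁻ x, ‖η x‖ₑ ^ 2 * ‖g x‖ₑ ^ 2) + ∫⁻ x, ‖∇ η x‖ₑ ^ 2 * ‖u x‖ₑ ^ 2)) := by
  obtain ⟨C, hC⟩ := exists_sobolev_const hN
  have hp : 2 < critExp N := two_lt_critExp hN
  have hpos := one_sub_two_div_critExp_pos hN
  refine ⟨2 * C ^ 2, fun u g h η hη M hM => ?_⟩
  have e : ∀ x, ‖η x‖ₑ ^ critExp N * ‖u x‖ₑ ^ critExp N = ‖η x * u x‖ₑ ^ critExp N := fun x => by
    rw [enorm_mul, ENNReal.mul_rpow_of_nonneg _ _ (by linarith)]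
  simp_rw [e] at hM ⊢
  set I := ∫⁻ x, ‖η x * u x‖ₑ ^ critExp N with hI
  have h1 := hC _ _ (h.test_mul hN hη)
  have h2 : I ^ (2 / critExp N) = eLpNorm (fun x => η x * u x) (ENNReal.ofReal (critExp N))
      volume ^ 2 := by
    rw [hI, ← eLpNorm_critExp_rpow hN, ← ENNReal.rpow_mul, mul_div_cancel₀ _ (by linarith)]
    norm_num
  have mη : AEStronglyMeasurable η volume := (hη.memLp 2).1
  have mη' : AEStronglyMeasurable (∇ η) volume := (hη.memLp_gradient 2).1
  have h3 : eLpNorm (fun x => η x • g x + u x • ∇ η x) 2 volume ^ 2 ≤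
      2 * ((∫⁻ x, ‖η x‖ₑ ^ 2 * ‖g x‖ₑ ^ 2) + ∫⁻ x, ‖∇ η x‖ₑ ^ 2 * ‖u x‖ₑ ^ 2) := by
    have m : AEMeasurable (fun x => ‖η x‖ₑ ^ 2 * ‖g x‖ₑ ^ 2) volume :=
      (mη.enorm.pow_const 2).mul (h.memLp_grad.1.enorm.pow_const 2)
    rw [eLpNorm_two_pow, ← lintegral_add_left' m, ← lintegral_const_mul' _ _ (by norm_num)]
    refine lintegral_mono fun x => ?_
    have h4 : ‖η x • g x + u x • ∇ η x‖ₑ ≤ ‖η x‖ₑ * ‖g x‖ₑ + ‖∇ η x‖ₑ * ‖u x‖ₑ := by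
      refine (enorm_add_le _ _).trans_eq ?_
      rw [enorm_smul, enorm_smul, mul_comm ‖u x‖ₑ]
    refine (pow_le_pow_left₀ zero_le h4 2).trans ?_
    rw [← mul_pow, ← mul_pow]
    have := ENNReal.rpow_add_le_mul_rpow_add_rpow (‖η x‖ₑ * ‖g x‖ₑ) (‖∇ η x‖ₑ * ‖u x‖ₑ)
      (p := 2) (by norm_num)
    norm_num at this
    exact this
  calc I = I ^ (1 - 2 / critExp N) * I ^ (2 / critExp N) := by
        rw [← ENNReal.rpow_add_of_nonneg _ _ hpos.le (by positivity)]
        simp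
    _ ≤ M ^ (1 - 2 / critExp N) * (C * eLpNorm (fun x => η x • g x + u x • ∇ η x) 2 volume) ^ 2 := by
        rw [h2]
        exact mul_le_mul' (ENNReal.rpow_le_rpow hM hpos.le) (pow_le_pow_left₀ zero_le h1 2)
    _ ≤ _ := by
        rw [mul_pow]
        push_cast
        rw [mul_comm (2 : ℝ≥0∞), mul_assoc ((C : ℝ≥0∞) ^ 2)]
        gcongr

/-- Integrating the localized Sobolev inequality over a family of cutoff functions. -/
lemma exists_cutoff_family_const (hN : 3 ≤ N) : ∃ C : NNReal,
    ∀ (u : EuclideanSpace ℝ (Fin N) → ℝ) (g : EuclideanSpace ℝ (Fin N) → EuclideanSpace ℝ (Fin N)),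
    HasDirichletGrad u g → ∀ {Ω : Type} [MeasurableSpace Ω] (μ : Measure Ω) [SFinite μ]
      (η : Ω → EuclideanSpace ℝ (Fin N) → ℝ), (∀ s, IsTest (η s)) →
      Measurable (Function.uncurry η) → Measurable (Function.uncurry fun s => ∇ (η s)) →
      ∀ (M : ℝ≥0∞), M ≠ ⊤ → (∀ᵐ s ∂μ, ∫⁻ x, ‖η s x‖ₑ ^ critExp N * ‖u x‖ₑ ^ critExp N ≤ M) →
      ∀ (S : Set (EuclideanSpace ℝ (Fin N))), MeasurableSet S → ∀ (c : ℝ≥0∞), c ≠ ⊤ →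
        (∀ x ∈ S, c ≤ ∫⁻ s, ‖η s x‖ₑ ^ critExp N ∂μ) →
      ∀ (A : ℝ≥0∞), A ≠ ⊤ → (∀ x, ∫⁻ s, ‖η s x‖ₑ ^ 2 ∂μ ≤ A) →
      ∀ (B : EuclideanSpace ℝ (Fin N) → ℝ≥0∞), (∀ᵐ x, ∫⁻ s, ‖∇ (η s) x‖ₑ ^ 2 ∂μ ≤ B x) →
      c * ∫⁻ x in S, ‖u x‖ₑ ^ critExp N ≤ M ^ (1 - 2 / critExp N) *
        (C * (A * (∫⁻ x, ‖g x‖ₑ ^ 2) + ∫⁻ x, B x * ‖u x‖ₑ ^ 2)) := by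
  obtain ⟨C, hC⟩ := exists_cutoff_const hN
  have hpos := one_sub_two_div_critExp_pos hN
  refine ⟨C, fun u g h Ω _ μ _ η hη hm hm' M hMt hM S hS c hct hc A hAt hA B hB => ?_⟩
  have mu : AEMeasurable (fun z : Ω × EuclideanSpace ℝ (Fin N) => ‖u z.2‖ₑ) (μ.prod volume) :=
    AEMeasurable.comp_snd (f := fun x => ‖u x‖ₑ) h.memLp_fun.1.enorm
  have mg : AEMeasurable (fun z : Ω × EuclideanSpace ℝ (Fin N) => ‖g z.2‖ₑ) (μ.prod volume) :=
    AEMeasurable.comp_snd (f := fun x => ‖g x‖ₑ) h.memLp_grad.1.enorm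
  have mη : Measurable (fun z : Ω × EuclideanSpace ℝ (Fin N) => ‖η z.1 z.2‖ₑ) := hm.enorm
  have mη' : Measurable (fun z : Ω × EuclideanSpace ℝ (Fin N) => ‖∇ (η z.1) z.2‖ₑ) := hm'.enorm
  have m1 : AEMeasurable (fun z : Ω × EuclideanSpace ℝ (Fin N) => ‖η z.1 z.2‖ₑ ^ critExp N *
      ‖u z.2‖ₑ ^ critExp N) (μ.prod volume) :=
    (mη.pow_const (critExp N)).aemeasurable.mul (mu.pow_const (critExp N))
  have m2 : AEMeasurable (fun z : Ω × EuclideanSpace ℝ (Fin N) => ‖η z.1 z.2‖ₑ ^ 2 *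
      ‖g z.2‖ₑ ^ 2) (μ.prod volume) := (mη.pow_const 2).aemeasurable.mul (mg.pow_const 2)
  have m3 : AEMeasurable (fun z : Ω × EuclideanSpace ℝ (Fin N) => ‖∇ (η z.1) z.2‖ₑ ^ 2 *
      ‖u z.2‖ₑ ^ 2) (μ.prod volume) := (mη'.pow_const 2).aemeasurable.mul (mu.pow_const 2)
  have mηx : ∀ x, Measurable fun s => ‖η s x‖ₑ := fun x =>
    (hm.of_uncurry_right (y := x)).enorm
  have mηx' : ∀ x, Measurable fun s => ‖∇ (η s) x‖ₑ := fun x =>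
    (hm'.of_uncurry_right (y := x)).enorm
  have m2' : AEMeasurable (fun s => ∫⁻ x, ‖η s x‖ₑ ^ 2 * ‖g x‖ₑ ^ 2) μ := m2.lintegral_prod_right'
  calc c * ∫⁻ x in S, ‖u x‖ₑ ^ critExp N = ∫⁻ x in S, c * ‖u x‖ₑ ^ critExp N :=
        (lintegral_const_mul' _ _ hct).symm
    _ ≤ ∫⁻ x in S, ∫⁻ s, ‖η s x‖ₑ ^ critExp N * ‖u x‖ₑ ^ critExp N ∂μ := by
        refine setLIntegral_mono' hS fun x hx => ?_
        rw [lintegral_mul_const _ ((mηx x).pow_const _)]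
        exact mul_le_mul_left (hc x hx) _
    _ ≤ ∫⁻ x, ∫⁻ s, ‖η s x‖ₑ ^ critExp N * ‖u x‖ₑ ^ critExp N ∂μ := setLIntegral_le_lintegral _ _
    _ = ∫⁻ s, (∫⁻ x, ‖η s x‖ₑ ^ critExp N * ‖u x‖ₑ ^ critExp N) ∂μ :=
        (lintegral_lintegral_swap m1).symm
    _ ≤ ∫⁻ s, M ^ (1 - 2 / critExp N) * (C * ((∫⁻ x, ‖η s x‖ₑ ^ 2 * ‖g x‖ₑ ^ 2) +
          ∫⁻ x, ‖∇ (η s) x‖ₑ ^ 2 * ‖u x‖ₑ ^ 2)) ∂μ := by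
        refine lintegral_mono_ae ?_
        filter_upwards [hM] with s hs
        exact hC u g h (η s) (hη s) M hs
    _ = M ^ (1 - 2 / critExp N) * (C * ((∫⁻ s, (∫⁻ x, ‖η s x‖ₑ ^ 2 * ‖g x‖ₑ ^ 2) ∂μ) +
          ∫⁻ s, (∫⁻ x, ‖∇ (η s) x‖ₑ ^ 2 * ‖u x‖ₑ ^ 2) ∂μ)) := by
        rw [lintegral_const_mul' _ _ (ENNReal.rpow_ne_top_of_nonneg hpos.le hMt),
          lintegral_const_mul' _ _ ENNReal.coe_ne_top, lintegral_add_left' m2']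
    _ = M ^ (1 - 2 / critExp N) * (C * ((∫⁻ x, ∫⁻ s, ‖η s x‖ₑ ^ 2 * ‖g x‖ₑ ^ 2 ∂μ) +
          ∫⁻ x, ∫⁻ s, ‖∇ (η s) x‖ₑ ^ 2 * ‖u x‖ₑ ^ 2 ∂μ)) := by
        rw [lintegral_lintegral_swap (f := fun s x => ‖η s x‖ₑ ^ 2 * ‖g x‖ₑ ^ 2) m2,
          lintegral_lintegral_swap (f := fun s x => ‖∇ (η s) x‖ₑ ^ 2 * ‖u x‖ₑ ^ 2) m3]
    _ ≤ _ := by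
        gcongr _ * (_ * (?_ + ?_))
        · rw [← lintegral_const_mul' _ _ hAt]
          refine lintegral_mono fun x => ?_
          rw [lintegral_mul_const _ ((mηx x).pow_const _)]
          exact mul_le_mul_left (hA x) _
        · refine lintegral_mono_ae ?_
          filter_upwards [hB] with x hx
          rw [lintegral_mul_const _ ((mηx' x).pow_const _)]
          exact mul_le_mul_left hx _

end Localize

/-! ### Vanishing on all annuli -/

section Annuli

variable {N : ℕ}

/-- A cutoff function of the annulus `1/2 < |x| < 4`. -/
def annularCutoff (N : ℕ) : EuclideanSpace ℝ (Fin N) → ℝ := fun x =>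
  (⟨2, 4, by norm_num, by norm_num⟩ : ContDiffBump (0 : EuclideanSpace ℝ (Fin N))) x *
    (1 - (⟨1 / 2, 1, by norm_num, by norm_num⟩ : ContDiffBump (0 : EuclideanSpace ℝ (Fin N))) x)

lemma isTest_annularCutoff : IsTest (annularCutoff N) :=
  ⟨(ContDiffBump.contDiff _).mul (contDiff_const.sub (ContDiffBump.contDiff _)),
    (ContDiffBump.hasCompactSupport _).mul_right⟩

lemma annularCutoff_eq_one {x : EuclideanSpace ℝ (Fin N)} (h1 : 1 ≤ ‖x‖) (h2 : ‖x‖ ≤ 2) :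
    annularCutoff N x = 1 := by
  rw [annularCutoff, ContDiffBump.one_of_mem_closedBall _ (by simpa using h2),
    ContDiffBump.zero_of_le_dist _ (by simpa using h1)]
  simp

lemma annularCutoff_eq_zero {x : EuclideanSpace ℝ (Fin N)} (h : ‖x‖ ≤ 1 / 2 ∨ 4 ≤ ‖x‖) :
    annularCutoff N x = 0 := by
  rcases h with h | h
  · rw [annularCutoff, ContDiffBump.one_of_mem_closedBall (⟨1 / 2, 1, by norm_num, by norm_num⟩ :
      ContDiffBump (0 : EuclideanSpace ℝ (Fin N))) (by simpa using h)]
    simp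
  · rw [annularCutoff, ContDiffBump.zero_of_le_dist (⟨2, 4, by norm_num, by norm_num⟩ :
      ContDiffBump (0 : EuclideanSpace ℝ (Fin N))) (by simpa using h)]
    simp

lemma abs_annularCutoff_le_one (x : EuclideanSpace ℝ (Fin N)) : ‖annularCutoff N x‖ ≤ 1 := by
  rw [annularCutoff, norm_mul]
  have h1 := ContDiffBump.nonneg (⟨2, 4, by norm_num, by norm_num⟩ :
    ContDiffBump (0 : EuclideanSpace ℝ (Fin N))) (x := x)
  have h2 := ContDiffBump.le_one (⟨2, 4, by norm_num, by norm_num⟩ :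
    ContDiffBump (0 : EuclideanSpace ℝ (Fin N))) (x := x)
  have h3 := ContDiffBump.nonneg (⟨1 / 2, 1, by norm_num, by norm_num⟩ :
    ContDiffBump (0 : EuclideanSpace ℝ (Fin N))) (x := x)
  have h4 := ContDiffBump.le_one (⟨1 / 2, 1, by norm_num, by norm_num⟩ :
    ContDiffBump (0 : EuclideanSpace ℝ (Fin N))) (x := x)
  rw [Real.norm_of_nonneg h1, Real.norm_of_nonneg (by linarith)]
  exact mul_le_one₀ h2 (by linarith) (by linarith)

lemma gradient_annularCutoff_eq_zero {x : EuclideanSpace ℝ (Fin N)} (h : ‖x‖ < 1 / 2 ∨ 4 < ‖x‖) :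
    ∇ (annularCutoff N) x = 0 := by
  have : annularCutoff N =ᶠ[𝓝 x] fun _ => 0 := by
    rcases h with h | h
    · filter_upwards [continuous_norm.continuousAt.eventually (gt_mem_nhds h)] with y hy
      exact annularCutoff_eq_zero (Or.inl hy.le)
    · filter_upwards [continuous_norm.continuousAt.eventually (lt_mem_nhds h)] with y hy
      exact annularCutoff_eq_zero (Or.inr hy.le)
  rw [this.gradient_eq]
  simp

lemma IsTest.comp_smul {φ : EuclideanSpace ℝ (Fin N) → ℝ} (h : IsTest φ) {c : ℝ} (hc : c ≠ 0) :
    IsTest fun x => φ (c • x) :=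
  ⟨h.1.comp (contDiff_const_smul c), h.2.comp_homeomorph (Homeomorph.smulOfNeZero c hc)⟩

lemma gradient_comp_smul {φ : EuclideanSpace ℝ (Fin N) → ℝ} (h : IsTest φ) (c : ℝ)
    (x : EuclideanSpace ℝ (Fin N)) : ∇ (fun x => φ (c • x)) x = c • ∇ φ (c • x) := by
  simp only [gradient]
  have h1 : HasFDerivAt (fun x : EuclideanSpace ℝ (Fin N) => c • x)
      (c • ContinuousLinearMap.id ℝ _) x := (hasFDerivAt_id x).const_smul c
  have h2 : HasFDerivAt (fun x => φ (c • x)) _ x :=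
    (h.differentiableAt (c • x)).hasFDerivAt.comp x h1
  rw [h2.fderiv]
  simp

/-- If the `L^{2*}` mass of `u` on every dilated annulus is small then `u` is small in `L^{2*}`. -/
lemma exists_annuli_const (hN : 3 ≤ N) : ∃ C : NNReal,
    ∀ (u : EuclideanSpace ℝ (Fin N) → ℝ) (g : EuclideanSpace ℝ (Fin N) → EuclideanSpace ℝ (Fin N)),
    HasDirichletGrad u g → ∀ M : ℝ≥0∞, M ≠ ⊤ →
      (∀ t : ℝ, ∫⁻ x, ‖annularCutoff N (Real.exp (-t) • x)‖ₑ ^ critExp N *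
        ‖u x‖ₑ ^ critExp N ≤ M) →
      ∫⁻ x, ‖u x‖ₑ ^ critExp N ≤ M ^ (1 - 2 / critExp N) * (C * eLpNorm g 2 volume ^ 2) := by
  have : NeZero N := ⟨by omega⟩
  have hp := two_lt_critExp hN
  obtain ⟨C, hC⟩ := exists_cutoff_family_const hN
  obtain ⟨L, hL⟩ : ∃ L : NNReal, ∀ x, ‖∇ (annularCutoff N) x‖ ≤ L := by
    obtain ⟨L, hL⟩ := isTest_annularCutoff.hasCompactSupport_gradient.exists_bound_of_continuous
      (isTest_annularCutoff (N := N)).continuous_gradient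
    exact ⟨L.toNNReal, fun x => (hL x).trans (Real.le_coe_toNNReal L)⟩
  -- The length of the set of `t` with `1 ≤ |exp(-t) x| ≤ 2`, where the dilated cutoff equals one.
  set c : ℝ≥0∞ := ENNReal.ofReal (Real.log 2) with hc
  have hlog2 : 0 < Real.log 2 := Real.log_pos (by norm_num)
  have hc0 : c ≠ 0 := by simpa [hc] using hlog2
  -- The length of the set of `t` with `1/2 ≤ |exp(-t) x| ≤ 4`, outside which the cutoff and its
  -- gradient vanish.
  set A : ℝ≥0∞ := ENNReal.ofReal (Real.log 4 + Real.log 2) with hA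
  -- On that set `exp(-t) ≤ 4/|x|`, so the dilated cutoff has gradient at most `4L/|x|`. Squaring
  -- and integrating in `t` gives `D/|x|²`, which Hardy's inequality absorbs.
  set D : ℝ≥0∞ := (4 * L) ^ 2 * A with hD
  set H : ℝ≥0∞ := ENNReal.ofReal (2 / ((N : ℝ) - 2)) with hH
  have hfin : c⁻¹ * (C * (A + D * H ^ 2)) ≠ ⊤ := by
    have : c⁻¹ ≠ ⊤ := by simpa using hc0
    finiteness
  have hmem : ∀ {x : EuclideanSpace ℝ (Fin N)} {t : ℝ}, x ≠ 0 →
      1 / 2 ≤ ‖Real.exp (-t) • x‖ → ‖Real.exp (-t) • x‖ ≤ 4 →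
        t ∈ Set.Icc (Real.log ‖x‖ - Real.log 4) (Real.log ‖x‖ + Real.log 2) := by
    intro x t hx h1 h2
    have hx' : 0 < ‖x‖ := by simpa using hx
    rw [norm_smul, Real.norm_of_nonneg (Real.exp_pos _).le] at h1 h2
    have h3 := Real.log_le_log (by positivity) h1
    have h4 := Real.log_le_log (by positivity) h2
    rw [Real.log_mul (Real.exp_pos _).ne' hx'.ne', Real.log_exp] at h3 h4
    rw [one_div, Real.log_inv] at h3
    constructor <;> linarith
  have hvol : ∀ x : EuclideanSpace ℝ (Fin N),
      volume (Set.Icc (Real.log ‖x‖ - Real.log 4) (Real.log ‖x‖ + Real.log 2)) = A := fun x => by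
    rw [Real.volume_Icc, hA]
    congr 1
    ring
  have hne : ∀ᵐ x : EuclideanSpace ℝ (Fin N), x ≠ 0 := by simp [ae_iff, measure_singleton]
  refine ⟨(c⁻¹ * (C * (A + D * H ^ 2))).toNNReal, fun u g h M hMt hM => ?_⟩
  rw [ENNReal.coe_toNNReal hfin]
  have key := hC u g h (volume : Measure ℝ)
    (fun t x => annularCutoff N (Real.exp (-t) • x))
    (fun t => isTest_annularCutoff.comp_smul (Real.exp_pos _).ne') ?_ ?_ M hMt
    (Eventually.of_forall hM) {0}ᶜ (measurableSet_singleton 0).compl c (by simp [hc]) ?_ A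
    (by simp [hA]) ?_ (fun x => D * ‖(‖x‖⁻¹)‖ₑ ^ 2) ?_
  · rw [Measure.restrict_congr_set (show ({0}ᶜ : Set (EuclideanSpace ℝ (Fin N))) =ᵐ[volume] Set.univ
      by simp), Measure.restrict_univ] at key
    have e : ∫⁻ x, D * ‖(‖x‖⁻¹)‖ₑ ^ 2 * ‖u x‖ₑ ^ 2 ≤ D * (H ^ 2 * eLpNorm g 2 volume ^ 2) := by
      calc _ = ∫⁻ x, D * ‖‖x‖⁻¹ * u x‖ₑ ^ 2 := by
            refine lintegral_congr fun x => ?_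
            rw [enorm_mul, mul_pow, mul_assoc]
        _ = D * eLpNorm (fun x => ‖x‖⁻¹ * u x) 2 volume ^ 2 := by
            rw [lintegral_const_mul' _ _ (by finiteness), eLpNorm_two_pow]
        _ ≤ _ := by
            rw [← mul_pow]
            gcongr
            exact h.hardy hN
    rw [← eLpNorm_two_pow] at key
    have hct : c ≠ ⊤ := by simp [hc]
    calc ∫⁻ x, ‖u x‖ₑ ^ critExp N = c⁻¹ * (c * ∫⁻ x, ‖u x‖ₑ ^ critExp N) := by
          rw [← mul_assoc, ENNReal.inv_mul_cancel hc0 hct, one_mul]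
      _ ≤ c⁻¹ * (M ^ (1 - 2 / critExp N) * (C * (A * eLpNorm g 2 volume ^ 2 +
          D * (H ^ 2 * eLpNorm g 2 volume ^ 2)))) := by
          exact mul_le_mul_right (key.trans (by gcongr)) _
      _ = _ := by ring
  · exact ((isTest_annularCutoff (N := N)).continuous.comp
      (by fun_prop : Continuous fun z : ℝ × EuclideanSpace ℝ (Fin N) =>
        Real.exp (-z.1) • z.2)).measurable
  · have e : (Function.uncurry fun t : ℝ => ∇ fun x : EuclideanSpace ℝ (Fin N) =>
        annularCutoff N (Real.exp (-t) • x)) = fun z : ℝ × EuclideanSpace ℝ (Fin N) =>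
          Real.exp (-z.1) • ∇ (annularCutoff N) (Real.exp (-z.1) • z.2) := by
      ext1 ⟨t, x⟩
      exact gradient_comp_smul isTest_annularCutoff _ _
    rw [e]
    refine Continuous.measurable ?_
    exact (by fun_prop : Continuous fun z : ℝ × EuclideanSpace ℝ (Fin N) => Real.exp (-z.1)).smul
      ((isTest_annularCutoff (N := N)).continuous_gradient.comp
        (by fun_prop : Continuous fun z : ℝ × EuclideanSpace ℝ (Fin N) => Real.exp (-z.1) • z.2))
  · intro x hx
    have hx' : 0 < ‖x‖ := by simpa using hx
    calc c = volume (Set.Icc (Real.log ‖x‖ - Real.log 2) (Real.log ‖x‖)) := by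
          rw [Real.volume_Icc, hc]
          congr 1
          ring
      _ = ∫⁻ t, (Set.Icc (Real.log ‖x‖ - Real.log 2) (Real.log ‖x‖)).indicator 1 t := by
          rw [lintegral_indicator_one measurableSet_Icc]
      _ ≤ _ := by
          refine lintegral_mono fun t => ?_
          by_cases ht : t ∈ Set.Icc (Real.log ‖x‖ - Real.log 2) (Real.log ‖x‖)
          swap
          · rw [Set.indicator_of_notMem ht]
            exact zero_le
          rw [Set.indicator_of_mem ht, annularCutoff_eq_one, enorm_one, ENNReal.one_rpow]
          · exact le_rfl
          · rw [norm_smul, Real.norm_of_nonneg (Real.exp_pos _).le, Real.exp_neg, ← div_eq_inv_mul,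
              one_le_div (Real.exp_pos _), ← Real.le_log_iff_exp_le hx']
            exact ht.2
          · rw [norm_smul, Real.norm_of_nonneg (Real.exp_pos _).le, Real.exp_neg, ← div_eq_inv_mul,
              div_le_iff₀ (Real.exp_pos _), ← div_le_iff₀' two_pos, ← Real.log_le_iff_le_exp
                (by positivity), Real.log_div hx'.ne' two_ne_zero]
            exact ht.1
  · intro x
    by_cases hx : x = 0
    · have : ∀ t : ℝ, annularCutoff N (Real.exp (-t) • x) = 0 := fun t =>
        annularCutoff_eq_zero (Or.inl (by simp [hx]))
      simp [this]
    rw [← hvol x, ← lintegral_indicator_one measurableSet_Icc]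
    refine lintegral_mono fun t => ?_
    by_cases h0 : annularCutoff N (Real.exp (-t) • x) = 0
    · simp [h0]
    have h1 : 1 / 2 ≤ ‖Real.exp (-t) • x‖ ∧ ‖Real.exp (-t) • x‖ ≤ 4 := by
      by_contra hcon
      rw [not_and_or, not_le, not_le] at hcon
      exact h0 (annularCutoff_eq_zero (hcon.imp le_of_lt le_of_lt))
    rw [Set.indicator_of_mem (hmem hx h1.1 h1.2), Pi.one_apply]
    refine pow_le_one₀ zero_le ?_
    rw [← ofReal_norm, ← ENNReal.ofReal_one]
    exact ENNReal.ofReal_le_ofReal (abs_annularCutoff_le_one _)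
  · filter_upwards [hne] with x hx
    have hx' : 0 < ‖x‖ := by simpa using hx
    have hDt : (4 * L * ‖(‖x‖⁻¹)‖ₑ : ℝ≥0∞) ^ 2 ≠ ⊤ := by finiteness
    calc _ ≤ ∫⁻ t, (4 * L * ‖(‖x‖⁻¹)‖ₑ) ^ 2 *
          (Set.Icc (Real.log ‖x‖ - Real.log 4) (Real.log ‖x‖ + Real.log 2)).indicator 1 t := by
          refine lintegral_mono fun t => ?_
          simp only [gradient_comp_smul isTest_annularCutoff]
          by_cases h0 : ∇ (annularCutoff N) (Real.exp (-t) • x) = 0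
          · simp [h0]
          have h1 : 1 / 2 ≤ ‖Real.exp (-t) • x‖ ∧ ‖Real.exp (-t) • x‖ ≤ 4 := by
            by_contra hcon
            rw [not_and_or, not_le, not_le] at hcon
            exact h0 (gradient_annularCutoff_eq_zero hcon)
          rw [Set.indicator_of_mem (hmem hx h1.1 h1.2), Pi.one_apply, mul_one]
          refine pow_le_pow_left₀ zero_le ?_ 2
          rw [← ofReal_norm, ← ofReal_norm, ← ENNReal.ofReal_coe_nnreal,
            show (4 : ℝ≥0∞) = ENNReal.ofReal 4 by norm_num,
            ← ENNReal.ofReal_mul (by norm_num), ← ENNReal.ofReal_mul (by positivity)]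
          refine ENNReal.ofReal_le_ofReal ?_
          rw [norm_smul, norm_inv, norm_norm]
          have h2 := h1.2
          rw [norm_smul, ← le_div_iff₀ hx'] at h2
          calc _ ≤ 4 / ‖x‖ * L := by
                gcongr
                exact hL _
            _ = _ := by ring
      _ = _ := by
          rw [lintegral_const_mul' _ _ hDt, lintegral_indicator_one measurableSet_Icc, hvol, hD]
          ring

end Annuli

/-! ### Rotations in coordinate planes -/

section Rotation

variable {N : ℕ}

/-- The rotation by the angle with cosine `c` and sine `s` in the plane of the coordinates
`i` and `k`, as a linear map. -/
def planeRotationAux (i k : Fin N) (c s : ℝ) :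
    EuclideanSpace ℝ (Fin N) →ₗ[ℝ] EuclideanSpace ℝ (Fin N) where
  toFun x := WithLp.toLp 2 fun j =>
    if j = i then c * x i - s * x k else if j = k then s * x i + c * x k else x j
  map_add' x y := by
    ext j
    simp only [PiLp.add_apply]
    split_ifs <;> ring
  map_smul' r x := by
    ext j
    simp only [PiLp.smul_apply, smul_eq_mul, RingHom.id_apply]
    split_ifs <;> ring

lemma planeRotationAux_fst (i k : Fin N) (c s : ℝ) (x : EuclideanSpace ℝ (Fin N)) :
    planeRotationAux i k c s x i = c * x i - s * x k := by
  simp [planeRotationAux]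

lemma planeRotationAux_snd {i k : Fin N} (hik : i ≠ k) (c s : ℝ) (x : EuclideanSpace ℝ (Fin N)) :
    planeRotationAux i k c s x k = s * x i + c * x k := by
  simp [planeRotationAux, hik.symm]

lemma planeRotationAux_of_ne {i k j : Fin N} (hi : j ≠ i) (hk : j ≠ k) (c s : ℝ)
    (x : EuclideanSpace ℝ (Fin N)) : planeRotationAux i k c s x j = x j := by
  simp [planeRotationAux, hi, hk]

lemma sum_sq_planeRotationAux {i k : Fin N} (hik : i ≠ k) {c s : ℝ} (hcs : c ^ 2 + s ^ 2 = 1)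
    (T : Finset (Fin N)) (hT : i ∈ T ↔ k ∈ T) (x : EuclideanSpace ℝ (Fin N)) :
    ∑ j ∈ T, planeRotationAux i k c s x j ^ 2 = ∑ j ∈ T, x j ^ 2 := by
  by_cases hi : i ∈ T
  · have hk : k ∈ T.erase i := Finset.mem_erase.2 ⟨hik.symm, hT.1 hi⟩
    rw [← Finset.add_sum_erase T _ hi, ← Finset.add_sum_erase _ _ hk,
      ← Finset.add_sum_erase T (fun j => x j ^ 2) hi, ← Finset.add_sum_erase _ _ hk,
      planeRotationAux_fst, planeRotationAux_snd hik, ← add_assoc, ← add_assoc]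
    congr 1
    · linear_combination (x i ^ 2 + x k ^ 2) * hcs
    · refine Finset.sum_congr rfl fun j hj => ?_
      rw [Finset.mem_erase, Finset.mem_erase] at hj
      rw [planeRotationAux_of_ne hj.2.1 hj.1]
  · refine Finset.sum_congr rfl fun j hj => ?_
    rw [planeRotationAux_of_ne (ne_of_mem_of_not_mem hj hi)
      (ne_of_mem_of_not_mem hj fun h => hi (hT.2 h))]

/-- The rotation by the angle with cosine `c` and sine `s` in the plane of the coordinates
`i` and `k`. -/
def planeRotation {i k : Fin N} (hik : i ≠ k) {c s : ℝ} (hcs : c ^ 2 + s ^ 2 = 1) :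
    EuclideanSpace ℝ (Fin N) ≃ₗᵢ[ℝ] EuclideanSpace ℝ (Fin N) :=
  LinearIsometry.toLinearIsometryEquiv ⟨planeRotationAux i k c s, fun x => by
    rw [EuclideanSpace.norm_eq, EuclideanSpace.norm_eq]
    congr 1
    simpa only [Real.norm_eq_abs, sq_abs] using
      sum_sq_planeRotationAux hik hcs Finset.univ (by simp) x⟩ rfl

lemma planeRotation_apply {i k : Fin N} (hik : i ≠ k) {c s : ℝ} (hcs : c ^ 2 + s ^ 2 = 1)
    (x : EuclideanSpace ℝ (Fin N)) : planeRotation hik hcs x = planeRotationAux i k c s x := rfl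

lemma normZ_planeRotation {i k : Fin N} (hik : i ≠ k) {c s : ℝ} (hcs : c ^ 2 + s ^ 2 = 1)
    (h : i.val < 2 ↔ k.val < 2) (x : EuclideanSpace ℝ (Fin N)) :
    normZ (planeRotation hik hcs x) = normZ x := by
  rw [normZ, normZ, planeRotation_apply, sum_sq_planeRotationAux hik hcs _ (by simpa using h)]

lemma normY_planeRotation {i k : Fin N} (hik : i ≠ k) {c s : ℝ} (hcs : c ^ 2 + s ^ 2 = 1)
    (h : i.val < 2 ↔ k.val < 2) (x : EuclideanSpace ℝ (Fin N)) :
    normY (planeRotation hik hcs x) = normY x := by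
  rw [normY, normY, planeRotation_apply,
    sum_sq_planeRotationAux hik hcs _ (by simp only [Finset.mem_filter_univ]; omega)]

/-- In the `(i, k)` plane the squared distance of the two images is `((c - c')² + (s - s')²)(x i ² +
x k ²)`, of which one term is kept. It separates the rotated copies of a ball. -/
lemma abs_mul_abs_le_norm_planeRotation_sub {i k : Fin N} (hik : i ≠ k) {c s c' s' : ℝ}
    (hcs : c ^ 2 + s ^ 2 = 1) (hcs' : c' ^ 2 + s' ^ 2 = 1) (x : EuclideanSpace ℝ (Fin N)) :
    |c - c'| * |x i| ≤ ‖planeRotation hik hcs x - planeRotation hik hcs' x‖ := by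
  set v := planeRotation hik hcs x - planeRotation hik hcs' x with hv
  have h1 : v i ^ 2 + v k ^ 2 ≤ ‖v‖ ^ 2 := by
    rw [EuclideanSpace.real_norm_sq_eq, ← Finset.sum_pair hik (f := fun j => v j ^ 2)]
    exact Finset.sum_le_sum_of_subset_of_nonneg (Finset.subset_univ _) fun j _ _ => sq_nonneg _
  refine abs_le_of_sq_le_sq' ?_ (norm_nonneg _) |>.2
  rw [mul_pow, sq_abs, sq_abs]
  refine le_trans ?_ h1
  rw [hv, PiLp.sub_apply, PiLp.sub_apply, planeRotation_apply, planeRotation_apply,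
    planeRotationAux_fst, planeRotationAux_fst, planeRotationAux_snd hik,
    planeRotationAux_snd hik]
  nlinarith [sq_nonneg ((c - c') * x k), sq_nonneg ((s - s') * x i), sq_nonneg ((s - s') * x k)]

/-- Take for `i` a coordinate of largest modulus. Each of the two blocks has at least two
coordinates because `N ≥ 4`, so `i` has a partner `k` in its own block, and rotations in their plane
preserve `|z|` and `|y|`. -/
lemma exists_norm_sq_le_coord (hN : 4 ≤ N) (a : EuclideanSpace ℝ (Fin N)) :
    ∃ i k : Fin N, i ≠ k ∧ (i.val < 2 ↔ k.val < 2) ∧ ‖a‖ ≤ N * |a i| := by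
  have : NeZero N := ⟨by omega⟩
  obtain ⟨i, -, hi⟩ := Finset.exists_max_image Finset.univ (fun j => |a j|) ⟨0, Finset.mem_univ _⟩
  have hle : ‖a‖ ≤ N * |a i| := by
    have hN1 : (1 : ℝ) ≤ N := by exact_mod_cast (by omega : 1 ≤ N)
    refine abs_le_of_sq_le_sq' ?_ (by positivity) |>.2
    rw [EuclideanSpace.real_norm_sq_eq, mul_pow]
    calc ∑ j, a j ^ 2 ≤ ∑ _j : Fin N, |a i| ^ 2 := Finset.sum_le_sum fun j hj => by
          rw [← sq_abs]
          exact pow_le_pow_left₀ (abs_nonneg _) (hi j hj) 2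
      _ = N * |a i| ^ 2 := by simp
      _ ≤ (N : ℝ) ^ 2 * |a i| ^ 2 := by
          gcongr
          nlinarith
  by_cases h2 : i.val < 2
  · by_cases h0 : i.val = 0
    · exact ⟨i, ⟨1, by omega⟩, by simp [Fin.ext_iff, h0], by simp [h2], hle⟩
    · exact ⟨i, ⟨0, by omega⟩, by simp [Fin.ext_iff, h0], by simp [h2], hle⟩
  · by_cases h0 : i.val = 2
    · exact ⟨i, ⟨3, by omega⟩, by simp [Fin.ext_iff, h0], by simp [h2], hle⟩
    · exact ⟨i, ⟨2, by omega⟩, by simp [Fin.ext_iff, h0], by simp [h2], hle⟩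

end Rotation

/-! ### Symmetric functions do not concentrate away from the origin -/

section Symmetric

variable {N : ℕ}

/-- `u(z, y) = u(|z|, |y|)` almost everywhere. -/
def IsCirc (u : EuclideanSpace ℝ (Fin N) → ℝ) : Prop :=
  ∃ f : ℝ → ℝ → ℝ, ∀ᵐ x, u x = f (normZ x) (normY x)

lemma IsCirc.comp_ae_eq {u : EuclideanSpace ℝ (Fin N) → ℝ} (hu : IsCirc u)
    (R : EuclideanSpace ℝ (Fin N) ≃ₗᵢ[ℝ] EuclideanSpace ℝ (Fin N))
    (hZ : ∀ x, normZ (R x) = normZ x) (hY : ∀ x, normY (R x) = normY x) :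
    ∀ᵐ x, u (R x) = u x := by
  obtain ⟨f, hf⟩ := hu
  filter_upwards [hf, R.measurePreserving.quasiMeasurePreserving.ae hf] with x h1 h2
  rw [h1, h2, hZ, hY]

lemma IsCirc.lintegral_ball_eq {u : EuclideanSpace ℝ (Fin N) → ℝ} (hu : IsCirc u)
    (R : EuclideanSpace ℝ (Fin N) ≃ₗᵢ[ℝ] EuclideanSpace ℝ (Fin N))
    (hZ : ∀ x, normZ (R x) = normZ x) (hY : ∀ x, normY (R x) = normY x)
    (F : ℝ → ℝ≥0∞) (a : EuclideanSpace ℝ (Fin N)) (ρ : ℝ) :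
    ∫⁻ x in Metric.ball (R a) ρ, F (u x) = ∫⁻ x in Metric.ball a ρ, F (u x) := by
  have e : R ⁻¹' Metric.ball (R a) ρ = Metric.ball a ρ := by
    rw [R.preimage_ball, R.symm_apply_apply]
  rw [← R.measurePreserving.setLIntegral_comp_preimage_emb
    R.toHomeomorph.measurableEmbedding, e]
  refine lintegral_congr_ae (ae_restrict_of_ae ?_)
  filter_upwards [hu.comp_ae_eq R hZ hY] with x hx
  rw [hx]

/-- A ball of small radius away from the origin has many disjoint images under rotations that
leave symmetric functions invariant. -/
lemma IsCirc.card_mul_lintegral_ball_le (hN : 4 ≤ N) {u : EuclideanSpace ℝ (Fin N) → ℝ}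
    (hu : IsCirc u) (F : ℝ → ℝ≥0∞) {m : ℕ} (hm : 0 < m) {a : EuclideanSpace ℝ (Fin N)}
    (ha : 1 / 4 ≤ ‖a‖) :
    m * ∫⁻ x in Metric.ball a (1 / (8 * N * m)), F (u x) ≤ ∫⁻ x, F (u x) := by
  obtain ⟨i, k, hik, hblock, hle⟩ := exists_norm_sq_le_coord hN a
  have hN0 : (0 : ℝ) < N := by exact_mod_cast (by omega : 0 < N)
  have hm0 : (0 : ℝ) < m := by exact_mod_cast hm
  -- The rotations have cosines `j/m`, hence pairwise distance at least `1/m`. With `|a i| ≥ 1/(4N)`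
  -- the centres are at least `1/(4Nm)` apart, which is twice the radius `1/(8Nm)`.
  have hcs : ∀ j : Fin m, ((j.val : ℝ) / m) ^ 2 + √(1 - ((j.val : ℝ) / m) ^ 2) ^ 2 = 1 := by
    intro j
    have h1 : (j.val : ℝ) / m ≤ 1 := by
      rw [div_le_one hm0]
      exact_mod_cast j.2.le
    rw [Real.sq_sqrt]
    · ring
    · have : ((j.val : ℝ) / m) ^ 2 ≤ 1 := pow_le_one₀ (by positivity) h1
      linarith
  set R : Fin m → EuclideanSpace ℝ (Fin N) ≃ₗᵢ[ℝ] EuclideanSpace ℝ (Fin N) := fun j =>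
    planeRotation hik (hcs j) with hR
  set ρ : ℝ := 1 / (8 * N * m) with hρ
  have hdisj : Pairwise (Function.onFun Disjoint fun j => Metric.ball (R j a) ρ) := by
    intro j l hjl
    refine Metric.ball_disjoint_ball ?_
    rw [dist_eq_norm]
    refine le_trans ?_ (abs_mul_abs_le_norm_planeRotation_sub hik (hcs j) (hcs l) a)
    have h1 : 1 / (m : ℝ) ≤ |(j.val : ℝ) / m - (l.val : ℝ) / m| := by
      rw [← sub_div, abs_div, abs_of_pos hm0]
      gcongr
      have : (1 : ℤ) ≤ |(j.val : ℤ) - l.val| :=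
        Int.one_le_abs (sub_ne_zero.2 fun h => hjl (Fin.ext (by exact_mod_cast h)))
      exact_mod_cast this
    have h2 : 1 / (4 * (N : ℝ)) ≤ |a i| := by
      rw [div_le_iff₀ (by positivity)]
      linarith
    calc ρ + ρ = 1 / (m : ℝ) * (1 / (4 * N)) := by
          rw [hρ]
          field_simp
          norm_num
      _ ≤ _ := by gcongr
  calc (m : ℝ≥0∞) * ∫⁻ x in Metric.ball a ρ, F (u x)
      = ∑ j : Fin m, ∫⁻ x in Metric.ball (R j a) ρ, F (u x) := by
        simp_rw [fun j => hu.lintegral_ball_eq (R j) (normZ_planeRotation hik (hcs j) hblock)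
          (normY_planeRotation hik (hcs j) hblock) F a ρ]
        simp
    _ = ∫⁻ x in ⋃ j, Metric.ball (R j a) ρ, F (u x) := by
        rw [lintegral_iUnion (fun j => measurableSet_ball) hdisj, tsum_fintype]
    _ ≤ _ := setLIntegral_le_lintegral _ _

end Symmetric

/-! ### Local compactness at the critical exponent for symmetric functions -/

section LocalCritical

variable {N : ℕ}

lemma volume_ball_two_mul (ρ : ℝ) :
    volume (Metric.ball (0 : EuclideanSpace ℝ (Fin N)) ρ) =
      2 ^ N * volume (Metric.ball (0 : EuclideanSpace ℝ (Fin N)) (ρ / 2)) := by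
  have h := Measure.addHaar_ball_mul_of_pos (volume : Measure (EuclideanSpace ℝ (Fin N)))
    (0 : EuclideanSpace ℝ (Fin N)) (r := 2) (by norm_num) (ρ / 2)
  rw [mul_div_cancel₀ _ two_ne_zero] at h
  rw [h, ENNReal.ofReal_pow (by norm_num)]
  simp

lemma IsTest.comp_sub {φ : EuclideanSpace ℝ (Fin N) → ℝ} (h : IsTest φ)
    (a : EuclideanSpace ℝ (Fin N)) : IsTest fun x => φ (x - a) :=
  ⟨h.1.comp (contDiff_id.sub contDiff_const), h.2.comp_homeomorph (Homeomorph.subRight a)⟩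

lemma gradient_comp_sub {φ : EuclideanSpace ℝ (Fin N) → ℝ} (a x : EuclideanSpace ℝ (Fin N)) :
    ∇ (fun x => φ (x - a)) x = ∇ φ (x - a) := by
  simp only [gradient]
  rw [fderiv_comp_sub]

/-- Only centres `a` within `ρ` of `x` contribute, so the overlap of the translated cutoffs at any
point is bounded by the volume of one ball. -/
lemma lintegral_sub_left_le (f : EuclideanSpace ℝ (Fin N) → ℝ≥0∞) {ρ : ℝ} {A : ℝ≥0∞}
    (hf : ∀ x, f x ≤ A) (h0 : ∀ x, ρ ≤ ‖x‖ → f x = 0) (hA : A ≠ ⊤)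
    (S : Set (EuclideanSpace ℝ (Fin N))) (x : EuclideanSpace ℝ (Fin N)) :
    ∫⁻ a in S, f (x - a) ≤ A * volume (Metric.ball (0 : EuclideanSpace ℝ (Fin N)) ρ) := by
  calc ∫⁻ a in S, f (x - a) ≤ ∫⁻ a, f (x - a) := setLIntegral_le_lintegral _ _
    _ ≤ ∫⁻ a, A * (Metric.ball x ρ).indicator 1 a := by
        refine lintegral_mono fun a => ?_
        by_cases ha : a ∈ Metric.ball x ρ
        · simpa [Set.indicator_of_mem ha] using hf _
        · rw [h0 _ (by rw [mem_ball_iff_norm', not_lt] at ha; exact ha)]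
          exact zero_le
    _ = A * volume (Metric.ball (0 : EuclideanSpace ℝ (Fin N)) ρ) := by
        rw [lintegral_const_mul' _ _ hA, lintegral_indicator_one measurableSet_ball,
          Measure.addHaar_ball_center]

/-- On the annulus, the `L^{2*}` mass of a symmetric function is controlled by a small multiple of
its Dirichlet energy and a large multiple of its local `L²` mass. -/
lemma exists_symmetric_annulus_const (hN : 4 ≤ N) : ∃ C : NNReal, ∀ m : ℕ, 0 < m → ∃ D : NNReal,
    ∀ (u : EuclideanSpace ℝ (Fin N) → ℝ) (g : EuclideanSpace ℝ (Fin N) → EuclideanSpace ℝ (Fin N)),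
    HasDirichletGrad u g → IsCirc u →
      ∫⁻ x in {x | 1 / 2 ≤ ‖x‖ ∧ ‖x‖ ≤ 4}, ‖u x‖ₑ ^ critExp N ≤
        ((m : ℝ≥0∞)⁻¹ * ∫⁻ x, ‖u x‖ₑ ^ critExp N) ^ (1 - 2 / critExp N) *
          (C * eLpNorm g 2 volume ^ 2 +
            D * eLpNorm u 2 (volume.restrict (Metric.ball 0 6)) ^ 2) := by
  have hN3 : 3 ≤ N := by omega
  have hp := two_lt_critExp hN3
  obtain ⟨C, hC⟩ := exists_cutoff_family_const hN3
  -- The constant must not depend on `m`. It does not, because the overlap volume `V` and the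
  -- covering volume `c` of balls of radius `ρ` and `ρ/2` have the fixed ratio `2 ^ N`; only the
  -- gradient bound `L`, and so `D`, sees the radius.
  refine ⟨C * 2 ^ N, fun m hm => ?_⟩
  have hN0 : (4 : ℝ) ≤ N := by exact_mod_cast hN
  have hm0 : (1 : ℝ) ≤ m := by exact_mod_cast hm
  have hmE : (m : ℝ≥0∞) ≠ 0 := by simpa using hm.ne'
  set ρ : ℝ := 1 / (8 * N * m) with hρ
  have hρ0 : 0 < ρ := by positivity
  have hρ1 : ρ ≤ 1 / 4 := by
    rw [hρ]
    gcongr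
    nlinarith
  let b : ContDiffBump (0 : EuclideanSpace ℝ (Fin N)) := ⟨ρ / 2, ρ, by linarith, by linarith⟩
  have hb : IsTest b := ⟨b.contDiff, b.hasCompactSupport⟩
  have hb0 : ∀ x, ρ ≤ ‖x‖ → b x = 0 := fun x hx => b.zero_of_le_dist (by simpa using hx)
  have hbn : ∀ x, ‖b x‖ₑ ≤ 1 := fun x => by
    rw [← ofReal_norm, ← ENNReal.ofReal_one]
    refine ENNReal.ofReal_le_ofReal ?_
    rw [Real.norm_of_nonneg b.nonneg]
    exact b.le_one
  -- On the sphere `|x| = ρ` as well: the bump attains its minimum zero there, so its derivative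
  -- vanishes.
  have hg0 : ∀ x, ρ ≤ ‖x‖ → ‖∇ b x‖ₑ ^ 2 = 0 := by
    intro x hx
    have h1 : IsLocalMin b x := Eventually.of_forall fun y => by
      rw [hb0 x hx]
      exact b.nonneg
    simp [gradient, h1.fderiv_eq_zero]
  obtain ⟨L, hL⟩ : ∃ L : NNReal, ∀ x, ‖∇ b x‖ₑ ≤ L := by
    obtain ⟨L, hL⟩ := hb.hasCompactSupport_gradient.exists_bound_of_continuous
      hb.continuous_gradient
    refine ⟨L.toNNReal, fun x => ?_⟩
    rw [← ofReal_norm]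
    exact ENNReal.ofReal_le_ofReal (hL x)
  set V := volume (Metric.ball (0 : EuclideanSpace ℝ (Fin N)) ρ) with hV
  set c := volume (Metric.ball (0 : EuclideanSpace ℝ (Fin N)) (ρ / 2)) with hc
  have hVc : V = 2 ^ N * c := volume_ball_two_mul ρ
  have hVt : V ≠ ⊤ := measure_ball_lt_top.ne
  have hct : c ≠ ⊤ := measure_ball_lt_top.ne
  have hc0 : c ≠ 0 := (Metric.measure_ball_pos volume 0 (by positivity)).ne'
  -- The centres of the balls: they stay at distance `1/4` from the origin, as the rotation argument
  -- requires, include all centres within `ρ/2` of the annulus, and keep every support inside the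
  -- ball of radius 6.
  set A : Set (EuclideanSpace ℝ (Fin N)) := {a | 1 / 4 ≤ ‖a‖ ∧ ‖a‖ ≤ 5} with hA
  have hAm : MeasurableSet A :=
    (measurableSet_le measurable_const measurable_norm).inter
      (measurableSet_le measurable_norm measurable_const)
  have hSm : MeasurableSet {x : EuclideanSpace ℝ (Fin N) | 1 / 2 ≤ ‖x‖ ∧ ‖x‖ ≤ 4} :=
    (measurableSet_le measurable_const measurable_norm).inter
      (measurableSet_le measurable_norm measurable_const)
  refine ⟨C * 2 ^ N * L ^ 2, fun u g h hu => ?_⟩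
  have hI : ∫⁻ x, ‖u x‖ₑ ^ critExp N ≠ ⊤ := by
    rw [← eLpNorm_critExp_rpow hN3]
    exact ENNReal.rpow_ne_top_of_nonneg (by linarith) h.memLp_fun.2.ne
  have key := hC u g h (volume.restrict A) (fun a x => b (x - a)) (fun a => hb.comp_sub a) ?_ ?_
    ((m : ℝ≥0∞)⁻¹ * ∫⁻ x, ‖u x‖ₑ ^ critExp N) (ENNReal.mul_ne_top (by simpa using hm.ne') hI)
    ?_ {x | 1 / 2 ≤ ‖x‖ ∧ ‖x‖ ≤ 4} hSm c hct ?_ V hVt ?_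
    ((Metric.ball 0 6).indicator fun _ => L ^ 2 * V) (Eventually.of_forall ?_)
  · rw [← eLpNorm_two_pow] at key
    have e : ∫⁻ x, (Metric.ball 0 6).indicator (fun _ => (L : ℝ≥0∞) ^ 2 * V) x * ‖u x‖ₑ ^ 2 =
        L ^ 2 * V * eLpNorm u 2 (volume.restrict (Metric.ball 0 6)) ^ 2 := by
      rw [eLpNorm_two_pow, ← lintegral_const_mul' _ _ (by finiteness),
        ← lintegral_indicator measurableSet_ball]
      refine lintegral_congr fun x => ?_
      by_cases hx : x ∈ Metric.ball (0 : EuclideanSpace ℝ (Fin N)) 6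
      · rw [Set.indicator_of_mem hx, Set.indicator_of_mem hx]
      · rw [Set.indicator_of_notMem hx, Set.indicator_of_notMem hx, zero_mul]
    rw [e, hVc] at key
    rw [← ENNReal.mul_le_mul_iff_right hc0 hct]
    refine key.trans (le_of_eq ?_)
    push_cast
    ring
  · exact (hb.continuous.comp (by fun_prop : Continuous fun z : EuclideanSpace ℝ (Fin N) ×
      EuclideanSpace ℝ (Fin N) => z.2 - z.1)).measurable
  · have e : (Function.uncurry fun a : EuclideanSpace ℝ (Fin N) => ∇ fun x => b (x - a)) =
        fun z : EuclideanSpace ℝ (Fin N) × EuclideanSpace ℝ (Fin N) => ∇ b (z.2 - z.1) := by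
      ext1 ⟨a, x⟩
      exact gradient_comp_sub a x
    rw [e]
    exact (hb.continuous_gradient.comp (by fun_prop)).measurable
  · refine (ae_restrict_iff' hAm).2 (Eventually.of_forall fun a ha => ?_)
    rw [← ENNReal.mul_le_mul_iff_right hmE (by simp), ← mul_assoc,
      ENNReal.mul_inv_cancel hmE (by simp), one_mul]
    refine le_trans ?_ (hu.card_mul_lintegral_ball_le hN (fun t => ‖t‖ₑ ^ critExp N) hm ha.1)
    refine mul_le_mul_right ?_ _
    rw [← lintegral_indicator measurableSet_ball]
    refine lintegral_mono fun x => ?_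
    by_cases hx : x ∈ Metric.ball a ρ
    · rw [Set.indicator_of_mem hx]
      exact mul_le_of_le_one_left zero_le (ENNReal.rpow_le_one (hbn _) (by linarith))
    · rw [mem_ball_iff_norm, not_lt] at hx
      rw [hb0 _ hx, enorm_zero, ENNReal.zero_rpow_of_pos (by linarith), zero_mul]
      exact zero_le
  · intro x hx
    have hsub : Metric.ball x (ρ / 2) ⊆ A := by
      intro a ha
      rw [mem_ball_iff_norm] at ha
      have h1 := norm_sub_norm_le a x
      have h2 := norm_sub_norm_le x a
      rw [norm_sub_rev] at h2
      exact ⟨by linarith [hx.1], by linarith [hx.2]⟩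
    calc c = volume (Metric.ball x (ρ / 2)) := (Measure.addHaar_ball_center _ x _).symm
      _ = ∫⁻ a in A, (Metric.ball x (ρ / 2)).indicator 1 a := by
          rw [lintegral_indicator_one measurableSet_ball,
            Measure.restrict_apply measurableSet_ball, Set.inter_eq_left.2 hsub]
      _ ≤ _ := by
          refine lintegral_mono fun a => ?_
          by_cases ha : a ∈ Metric.ball x (ρ / 2)
          · rw [Set.indicator_of_mem ha, b.one_of_mem_closedBall, enorm_one, ENNReal.one_rpow]
            · exact le_rfl
            · rw [mem_closedBall_zero_iff]
              rw [mem_ball_iff_norm'] at ha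
              exact ha.le
          · rw [Set.indicator_of_notMem ha]
            exact zero_le
  · intro x
    have := lintegral_sub_left_le (fun x => ‖b x‖ₑ ^ 2) (A := 1) (ρ := ρ)
      (fun x => pow_le_one₀ zero_le (hbn x)) (fun x hx => by simp [hb0 x hx]) (by simp) A x
    simpa using this
  · intro x
    simp only [gradient_comp_sub]
    by_cases hx : x ∈ Metric.ball (0 : EuclideanSpace ℝ (Fin N)) 6
    · rw [Set.indicator_of_mem hx]
      exact lintegral_sub_left_le (fun x => ‖∇ b x‖ₑ ^ 2) (A := L ^ 2) (ρ := ρ)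
        (fun x => pow_le_pow_left₀ zero_le (hL x) 2) hg0 (by finiteness) A x
    · rw [Set.indicator_of_notMem hx, nonpos_iff_eq_zero]
      refine setLIntegral_eq_zero hAm fun a ha => hg0 _ ?_
      rw [mem_ball_zero_iff, not_lt] at hx
      have := norm_sub_norm_le x a
      linarith [ha.2]

end LocalCritical

/-! ### Dilations -/

section Dilation

variable {N : ℕ} {u : EuclideanSpace ℝ (Fin N) → ℝ}
  {g : EuclideanSpace ℝ (Fin N) → EuclideanSpace ℝ (Fin N)}

/-- Composition with the dilation multiplies the norm by `s^(-N/q)`, and `ha` says that `a = N/q`.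
-/
lemma eLpNorm_rpow_smul_comp_smul {F : Type*} [NormedAddCommGroup F] [NormedSpace ℝ F]
    (f : EuclideanSpace ℝ (Fin N) → F) {q : ℝ≥0∞} (hq : q ≠ ⊤) (hq0 : q ≠ 0) {a : ℝ}
    (ha : q.toReal * a = N) {s : ℝ} (hs : 0 < s) :
    eLpNorm (fun x => s ^ a • f (s • x)) q volume = eLpNorm f q volume := by
  have h1 : eLpNorm (fun x => f (s • x)) q volume =
      ENNReal.ofReal |(s ^ N)⁻¹| ^ (1 / q).toReal • eLpNorm f q volume := by
    have := (Homeomorph.smulOfNeZero (α := EuclideanSpace ℝ (Fin N)) s hs.ne').measurableEmbedding.eLpNorm_map_measure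
      (g := f) (p := q) (μ := volume)
    have e : Measure.map (Homeomorph.smulOfNeZero (α := EuclideanSpace ℝ (Fin N)) s hs.ne') volume =
        ENNReal.ofReal |(s ^ N)⁻¹| • volume := by
      have := Measure.map_addHaar_smul (volume : Measure (EuclideanSpace ℝ (Fin N))) hs.ne'
      simpa using this
    rw [e, eLpNorm_smul_measure_of_ne_top hq] at this
    exact this.symm
  have hq' : 0 < q.toReal := ENNReal.toReal_pos hq0 hq
  have hq'' : (1 / q).toReal = 1 / q.toReal := by simp
  have h2 := eLpNorm_const_smul (s ^ a) (fun x => f (s • x)) q volume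
  rw [h1] at h2
  refine h2.trans ?_
  rw [smul_eq_mul, ← mul_assoc, Real.enorm_of_nonneg (by positivity), abs_of_pos (by positivity),
    ENNReal.ofReal_rpow_of_pos (by positivity), ← ENNReal.ofReal_mul (by positivity), hq'']
  have h3 : s ^ a * ((s ^ N)⁻¹) ^ (1 / q.toReal) = 1 := by
    rw [← Real.rpow_natCast, ← Real.rpow_neg hs.le, ← Real.rpow_mul hs.le, ← Real.rpow_add hs, ← ha]
    have : a + -(q.toReal * a) * (1 / q.toReal) = 0 := by
      field_simp
      ring
    rw [this, Real.rpow_zero]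
  rw [h3, ENNReal.ofReal_one, one_mul]

lemma critExp_mul_half (hN : 3 ≤ N) : (ENNReal.ofReal (critExp N)).toReal * (((N : ℝ) - 2) / 2) =
    N := by
  have h3 : (3 : ℝ) ≤ N := by exact_mod_cast hN
  rw [toReal_ofReal_critExp hN, critExp]
  field_simp [show (N : ℝ) - 2 ≠ 0 by linarith]

lemma eLpNorm_dilate_critExp (hN : 3 ≤ N) (f : EuclideanSpace ℝ (Fin N) → ℝ) {s : ℝ}
    (hs : 0 < s) : eLpNorm (fun x => s ^ (((N : ℝ) - 2) / 2) * f (s • x))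
      (ENNReal.ofReal (critExp N)) volume = eLpNorm f (ENNReal.ofReal (critExp N)) volume :=
  eLpNorm_rpow_smul_comp_smul f (by simp) (ofReal_critExp_ne_zero hN) (critExp_mul_half hN) hs

lemma eLpNorm_dilate_two {F : Type*} [NormedAddCommGroup F] [NormedSpace ℝ F]
    (f : EuclideanSpace ℝ (Fin N) → F) {s : ℝ} (hs : 0 < s) :
    eLpNorm (fun x => s ^ ((N : ℝ) / 2) • f (s • x)) 2 volume = eLpNorm f 2 volume :=
  eLpNorm_rpow_smul_comp_smul f (by simp) (by simp) (by simp; ring) hs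

lemma rpow_half_eq {s : ℝ} (hs : 0 < s) : s ^ ((N : ℝ) / 2) = s ^ (((N : ℝ) - 2) / 2) * s := by
  rw [← Real.rpow_add_one hs.ne']
  congr 1
  ring

/-- The exponent `(N - 2)/2` is the one preserving the `L^{2*}` norm; the chain rule adds one power
of `s` to the gradient, giving `N/2`, the one preserving `L²`. -/
lemma HasDirichletGrad.dilate (hN : 3 ≤ N) (h : HasDirichletGrad u g) {s : ℝ} (hs : 0 < s) :
    HasDirichletGrad (fun x => s ^ (((N : ℝ) - 2) / 2) * u (s • x))
      (fun x => s ^ ((N : ℝ) / 2) • g (s • x)) := by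
  obtain ⟨h1, h2, φ, hφ, h3, h4⟩ := h
  have hq := Measure.quasiMeasurePreserving_smul (volume : Measure (EuclideanSpace ℝ (Fin N))) hs.ne'
  have hm : AEStronglyMeasurable (fun x => s ^ ((N : ℝ) / 2) • g (s • x)) volume :=
    (h2.1.comp_quasiMeasurePreserving hq).const_smul (s ^ ((N : ℝ) / 2))
  refine ⟨⟨(h1.1.comp_quasiMeasurePreserving hq).const_mul _, ?_⟩, ⟨hm, ?_⟩,
    fun n x => s ^ (((N : ℝ) - 2) / 2) * φ n (s • x),
    fun n => ((hφ n).comp_smul hs.ne').const_mul _, ?_, ?_⟩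
  · exact (eLpNorm_dilate_critExp hN u hs).trans_lt h1.2
  · exact (eLpNorm_dilate_two g hs).trans_lt h2.2
  · refine h3.congr fun n => ?_
    rw [← eLpNorm_dilate_critExp hN _ hs]
    simp only [mul_sub]
  · refine h4.congr fun n => ?_
    rw [← eLpNorm_dilate_two _ hs]
    congr 1
    ext1 x
    rw [gradient_const_mul_apply ((hφ n).comp_smul hs.ne'), gradient_comp_smul (hφ n), smul_smul,
      ← rpow_half_eq hs, smul_sub]

lemma eLpNorm_hardy_dilate (u : EuclideanSpace ℝ (Fin N) → ℝ) {s : ℝ} (hs : 0 < s) :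
    eLpNorm (fun x => ‖x‖⁻¹ * (s ^ (((N : ℝ) - 2) / 2) * u (s • x))) 2 volume =
      eLpNorm (fun x => ‖x‖⁻¹ * u x) 2 volume := by
  rw [← eLpNorm_dilate_two (fun x => ‖x‖⁻¹ * u x) hs]
  congr 1
  ext x
  rw [rpow_half_eq hs, norm_smul, Real.norm_of_nonneg hs.le, mul_inv, smul_eq_mul]
  field_simp

lemma normZ_smul (s : ℝ) (hs : 0 < s) (x : EuclideanSpace ℝ (Fin N)) :
    normZ (s • x) = s * normZ x := by
  rw [normZ, normZ]
  simp only [PiLp.smul_apply, smul_eq_mul, mul_pow]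
  rw [← Finset.mul_sum, Real.sqrt_mul (sq_nonneg s), Real.sqrt_sq hs.le]

lemma normY_smul (s : ℝ) (hs : 0 < s) (x : EuclideanSpace ℝ (Fin N)) :
    normY (s • x) = s * normY x := by
  rw [normY, normY]
  simp only [PiLp.smul_apply, smul_eq_mul, mul_pow]
  rw [← Finset.mul_sum, Real.sqrt_mul (sq_nonneg s), Real.sqrt_sq hs.le]

lemma IsCirc.dilate (hu : IsCirc u) {s : ℝ} (hs : 0 < s) (c : ℝ) :
    IsCirc fun x => c * u (s • x) := by
  obtain ⟨f, hf⟩ := hu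
  refine ⟨fun a b => c * f (s * a) (s * b), ?_⟩
  have hq := Measure.quasiMeasurePreserving_smul (volume : Measure (EuclideanSpace ℝ (Fin N))) hs.ne'
  filter_upwards [hq.ae hf] with x hx
  rw [hx, normZ_smul s hs, normY_smul s hs]

lemma IsCirc.const_mul (hu : IsCirc u) (c : ℝ) : IsCirc fun x => c * u x := by
  simpa using hu.dilate one_pos c

lemma IsCirc.sub {v : EuclideanSpace ℝ (Fin N) → ℝ} (hu : IsCirc u) (hv : IsCirc v) :
    IsCirc fun x => u x - v x := by
  obtain ⟨f, hf⟩ := hu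
  obtain ⟨f', hf'⟩ := hv
  refine ⟨fun a b => f a b - f' a b, ?_⟩
  filter_upwards [hf, hf'] with x h1 h2
  rw [h1, h2]

/-- The limit profile is the pointwise limit of the profiles; its junk values where they diverge are
met only on a null set of `x`. -/
lemma IsCirc.of_tendsto {v : ℕ → EuclideanSpace ℝ (Fin N) → ℝ} (hv : ∀ n, IsCirc (v n))
    (h : ∀ᵐ x, Tendsto (fun n => v n x) atTop (𝓝 (u x))) : IsCirc u := by
  choose f hf using hv
  refine ⟨fun a b => limUnder atTop fun n => f n a b, ?_⟩
  filter_upwards [h, ae_all_iff.2 hf] with x h1 h2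
  refine (Tendsto.limUnder_eq ?_).symm
  simpa only [← h2] using h1

/-- Changing variables at the invariant scaling moves the cutoff at scale `s` back to the fixed
annulus, where it is at most one and outside which it vanishes. -/
lemma lintegral_annularCutoff_dilate (hN : 3 ≤ N) (u : EuclideanSpace ℝ (Fin N) → ℝ) {s : ℝ}
    (hs : 0 < s) : ∫⁻ x, ‖annularCutoff N (s⁻¹ • x)‖ₑ ^ critExp N * ‖u x‖ₑ ^ critExp N ≤
      ∫⁻ x in {x | 1 / 2 ≤ ‖x‖ ∧ ‖x‖ ≤ 4},
        ‖s ^ (((N : ℝ) - 2) / 2) * u (s • x)‖ₑ ^ critExp N := by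
  have hp : 0 < critExp N := by linarith [two_lt_critExp hN]
  have hSm : MeasurableSet {x : EuclideanSpace ℝ (Fin N) | 1 / 2 ≤ ‖x‖ ∧ ‖x‖ ≤ 4} :=
    (measurableSet_le measurable_const measurable_norm).inter
      (measurableSet_le measurable_norm measurable_const)
  calc _ = ∫⁻ x, ‖annularCutoff N (s⁻¹ • x) * u x‖ₑ ^ critExp N := by
        refine lintegral_congr fun x => ?_
        rw [enorm_mul, ENNReal.mul_rpow_of_nonneg _ _ hp.le]
    _ = ∫⁻ x, ‖annularCutoff N x * (s ^ (((N : ℝ) - 2) / 2) * u (s • x))‖ₑ ^ critExp N := by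
        rw [← eLpNorm_critExp_rpow hN, ← eLpNorm_critExp_rpow hN, ← eLpNorm_dilate_critExp hN _ hs]
        congr 2
        ext x
        rw [smul_smul, inv_mul_cancel₀ hs.ne', one_smul]
        ring
    _ ≤ _ := by
        rw [← lintegral_indicator hSm]
        refine lintegral_mono fun x => ?_
        by_cases hx : x ∈ {x : EuclideanSpace ℝ (Fin N) | 1 / 2 ≤ ‖x‖ ∧ ‖x‖ ≤ 4}
        · rw [Set.indicator_of_mem hx]
          refine ENNReal.rpow_le_rpow ?_ hp.le
          rw [enorm_mul]
          refine mul_le_of_le_one_left zero_le ?_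
          rw [← ofReal_norm, ← ENNReal.ofReal_one]
          exact ENNReal.ofReal_le_ofReal (abs_annularCutoff_le_one _)
        · rw [Set.mem_ofPred_eq, not_and_or, not_le, not_le] at hx
          rw [annularCutoff_eq_zero (hx.imp le_of_lt le_of_lt), zero_mul, enorm_zero,
            ENNReal.zero_rpow_of_pos hp]
          exact zero_le

end Dilation

/-! ### The energy -/

section Energy

variable {N : ℕ} {lam : ℝ} {u v : EuclideanSpace ℝ (Fin N) → ℝ}
  {g k : EuclideanSpace ℝ (Fin N) → EuclideanSpace ℝ (Fin N)}

/-- The numerator of the quotient. -/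
def energy (lam : ℝ) (u : EuclideanSpace ℝ (Fin N) → ℝ)
    (g : EuclideanSpace ℝ (Fin N) → EuclideanSpace ℝ (Fin N)) : ℝ :=
  (∫ x, ‖g x‖ ^ 2) - lam * ∫ x, (‖x‖⁻¹ * u x) ^ 2

/-- The integral `∫ |u|^{2*}`. -/
def mass (u : EuclideanSpace ℝ (Fin N) → ℝ) : ℝ := ∫ x, |u x| ^ critExp N

lemma quotient_eq (hN : 3 ≤ N) (h : HasDirichletGrad u g) :
    quotient lam u = energy lam u g / mass u ^ (2 / critExp N) := by
  rw [quotient, energy, mass]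
  congr 2
  · refine integral_congr_ae ?_
    filter_upwards [h.grad_ae_eq hN] with x hx
    rw [hx]
  · congr 1
    refine integral_congr_ae (Eventually.of_forall fun x => ?_)
    simp only
    rw [mul_pow, inv_pow, div_eq_inv_mul]

lemma integral_norm_sq_eq {F : Type*} [NormedAddCommGroup F] {f : EuclideanSpace ℝ (Fin N) → F}
    (hf : MemLp f 2 volume) : ∫ x, ‖f x‖ ^ 2 = (eLpNorm f 2 volume).toReal ^ 2 := by
  rw [eLpNorm_two_sq hf, ENNReal.toReal_ofReal (Real.sqrt_nonneg _),
    Real.sq_sqrt (integral_nonneg fun x => by positivity)]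

lemma energy_eq (hN : 3 ≤ N) (h : HasDirichletGrad u g) :
    energy lam u g = (eLpNorm g 2 volume).toReal ^ 2 -
      lam * (eLpNorm (fun x => ‖x‖⁻¹ * u x) 2 volume).toReal ^ 2 := by
  rw [energy, integral_norm_sq_eq h.memLp_grad, ← integral_norm_sq_eq (h.memLp_hardy hN)]
  simp only [Real.norm_eq_abs, sq_abs]

lemma ofReal_mass (hN : 3 ≤ N) (h : HasDirichletGrad u g) :
    ENNReal.ofReal (mass u) = ∫⁻ x, ‖u x‖ₑ ^ critExp N := by
  have hp : 0 < critExp N := by linarith [two_lt_critExp hN]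
  rw [mass, ofReal_integral_eq_lintegral_ofReal (integrable_abs_rpow hp h.memLp_fun)
    (Eventually.of_forall fun x => by positivity)]
  refine lintegral_congr fun x => ?_
  rw [← ENNReal.ofReal_rpow_of_nonneg (abs_nonneg _) hp.le, ← Real.norm_eq_abs, ofReal_norm]

lemma mass_nonneg (u : EuclideanSpace ℝ (Fin N) → ℝ) : 0 ≤ mass u :=
  integral_nonneg fun x => by positivity

lemma mass_eq (hN : 3 ≤ N) (h : HasDirichletGrad u g) :
    mass u = (eLpNorm u (ENNReal.ofReal (critExp N)) volume).toReal ^ critExp N := by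
  rw [ENNReal.toReal_rpow, eLpNorm_critExp_rpow hN, ← ofReal_mass hN h,
    ENNReal.toReal_ofReal (mass_nonneg u)]

lemma mass_pos (hN : 3 ≤ N) (h : HasDirichletGrad u g) (hu : ¬ u =ᵐ[volume] 0) : 0 < mass u := by
  rw [mass_eq hN h]
  refine Real.rpow_pos_of_pos (ENNReal.toReal_pos (fun h0 => hu ?_) h.memLp_fun.2.ne) _
  rwa [eLpNorm_eq_zero_iff h.memLp_fun.1 (ofReal_critExp_ne_zero hN)] at h0

lemma mass_eq_zero (hN : 3 ≤ N) (hu : u =ᵐ[volume] 0) : mass u = 0 := by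
  have hp : 0 < critExp N := by linarith [two_lt_critExp hN]
  rw [mass, ← integral_zero (EuclideanSpace ℝ (Fin N)) ℝ]
  refine integral_congr_ae ?_
  filter_upwards [hu] with x hx
  rw [hx, Pi.zero_apply, abs_zero, Real.zero_rpow hp.ne']

lemma mass_const_mul (c : ℝ) (u : EuclideanSpace ℝ (Fin N) → ℝ) :
    mass (fun x => c * u x) = |c| ^ critExp N * mass u := by
  rw [mass, mass, ← integral_const_mul]
  refine integral_congr_ae (Eventually.of_forall fun x => ?_)
  simp only
  rw [abs_mul, Real.mul_rpow (abs_nonneg _) (abs_nonneg _)]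

lemma energy_const_mul (c : ℝ) :
    energy lam (fun x => c * u x) (fun x => c • g x) = c ^ 2 * energy lam u g := by
  have e1 : ∀ x, ‖c • g x‖ ^ 2 = c ^ 2 * ‖g x‖ ^ 2 := fun x => by
    rw [norm_smul, mul_pow, Real.norm_eq_abs, sq_abs]
  have e2 : ∀ x, (‖x‖⁻¹ * (c * u x)) ^ 2 = c ^ 2 * (‖x‖⁻¹ * u x) ^ 2 := fun x => by ring
  rw [energy, energy]
  simp_rw [e1, e2]
  rw [integral_const_mul, integral_const_mul]
  ring

/-- The energy is coercive below the Hardy constant. -/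
lemma exists_coercive (hN : 3 ≤ N) (hlam : lam < ((N : ℝ) - 2) ^ 2 / 4) :
    ∃ c : ℝ, 0 < c ∧ ∀ (u : EuclideanSpace ℝ (Fin N) → ℝ)
      (g : EuclideanSpace ℝ (Fin N) → EuclideanSpace ℝ (Fin N)), HasDirichletGrad u g →
        c * (eLpNorm g 2 volume).toReal ^ 2 ≤ energy lam u g := by
  have h3 : (3 : ℝ) ≤ N := by exact_mod_cast hN
  have h2 : 0 < (N : ℝ) - 2 := by linarith
  -- For `lam ≤ 0` the potential term only helps and 1 suffices; for `lam ≥ 0` Hardy's inequality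
  -- costs `lam * (2/(N - 2))²`.
  refine ⟨min 1 (1 - lam * (2 / ((N : ℝ) - 2)) ^ 2), lt_min one_pos ?_, fun u g h => ?_⟩
  · rw [sub_pos, div_pow, ← mul_div_assoc, div_lt_one (by positivity)]
    linarith
  · rw [energy_eq hN h]
    have hh : (eLpNorm (fun x => ‖x‖⁻¹ * u x) 2 volume).toReal ≤
        2 / ((N : ℝ) - 2) * (eLpNorm g 2 volume).toReal := by
      have := ENNReal.toReal_mono (ENNReal.mul_ne_top (by simp) h.memLp_grad.2.ne) (h.hardy hN)
      rwa [ENNReal.toReal_mul, ENNReal.toReal_ofReal (by positivity)] at this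
    have hh2 := pow_le_pow_left₀ ENNReal.toReal_nonneg hh 2
    rw [mul_pow] at hh2
    set G := (eLpNorm g 2 volume).toReal ^ 2
    set W := (eLpNorm (fun x => ‖x‖⁻¹ * u x) 2 volume).toReal ^ 2
    have hG : 0 ≤ G := sq_nonneg _
    have hW : 0 ≤ W := sq_nonneg _
    rcases le_total 0 lam with hl | hl
    · have := mul_le_mul_of_nonneg_left hh2 hl
      have h4 := mul_le_mul_of_nonneg_right
        (min_le_right 1 (1 - lam * (2 / ((N : ℝ) - 2)) ^ 2)) hG
      linarith
    · have := mul_nonneg_of_nonpos_of_nonpos hl (neg_nonpos.2 hW)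
      have h4 := mul_le_mul_of_nonneg_right
        (min_le_left 1 (1 - lam * (2 / ((N : ℝ) - 2)) ^ 2)) hG
      linarith

lemma energy_nonneg (hN : 3 ≤ N) (hlam : lam < ((N : ℝ) - 2) ^ 2 / 4)
    (h : HasDirichletGrad u g) : 0 ≤ energy lam u g := by
  obtain ⟨c, hc, hcoer⟩ := exists_coercive hN hlam
  exact le_trans (by positivity) (hcoer u g h)

lemma energy_dilate (hN : 3 ≤ N) (h : HasDirichletGrad u g) {s : ℝ} (hs : 0 < s) :
    energy lam (fun x => s ^ (((N : ℝ) - 2) / 2) * u (s • x))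
      (fun x => s ^ ((N : ℝ) / 2) • g (s • x)) = energy lam u g := by
  rw [energy_eq hN (h.dilate hN hs), energy_eq hN h, eLpNorm_dilate_two g hs,
    eLpNorm_hardy_dilate u hs]

lemma mass_dilate (hN : 3 ≤ N) (h : HasDirichletGrad u g) {s : ℝ} (hs : 0 < s) :
    mass (fun x => s ^ (((N : ℝ) - 2) / 2) * u (s • x)) = mass u := by
  rw [mass_eq hN (h.dilate hN hs), mass_eq hN h, eLpNorm_dilate_critExp hN u hs]

/-- The energy of a weakly convergent sequence splits. -/
lemma tendsto_energy_sub (hN : 3 ≤ N) {u₀ : EuclideanSpace ℝ (Fin N) → ℝ}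
    {g₀ : EuclideanSpace ℝ (Fin N) → EuclideanSpace ℝ (Fin N)} (h₀ : HasDirichletGrad u₀ g₀)
    {v : ℕ → EuclideanSpace ℝ (Fin N) → ℝ}
    {k : ℕ → EuclideanSpace ℝ (Fin N) → EuclideanSpace ℝ (Fin N)}
    (hv : ∀ n, HasDirichletGrad (v n) (k n))
    (hw : ∀ f : EuclideanSpace ℝ (Fin N) → ℝ, MemLp f 2 volume →
      Tendsto (fun n => ∫ x, f x * (‖x‖⁻¹ * v n x)) atTop (𝓝 (∫ x, f x * (‖x‖⁻¹ * u₀ x))))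
    (hg : ∀ f : EuclideanSpace ℝ (Fin N) → EuclideanSpace ℝ (Fin N), MemLp f 2 volume →
      Tendsto (fun n => ∫ x, inner ℝ (f x) (k n x)) atTop (𝓝 (∫ x, inner ℝ (f x) (g₀ x)))) :
    Tendsto (fun n => energy lam (v n) (k n) -
      energy lam (fun x => v n x - u₀ x) (fun x => k n x - g₀ x)) atTop
        (𝓝 (energy lam u₀ g₀)) := by
  have mul2 : ∀ {f f' : EuclideanSpace ℝ (Fin N) → ℝ}, MemLp f 2 volume → MemLp f' 2 volume →
      Integrable (fun x => f x * f' x) := fun hf hf' =>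
    memLp_one_iff_integrable.1 (hf'.smul (p := 2) (q := 2) hf)
  -- In the difference the squares of `k n` and `v n` cancel, leaving terms affine in them, which
  -- pass to the weak limit.
  have key : ∀ n, energy lam (v n) (k n) -
      energy lam (fun x => v n x - u₀ x) (fun x => k n x - g₀ x) =
      (2 * (∫ x, inner ℝ (g₀ x) (k n x)) - ∫ x, ‖g₀ x‖ ^ 2) -
        lam * (2 * (∫ x, ‖x‖⁻¹ * u₀ x * (‖x‖⁻¹ * v n x)) - ∫ x, (‖x‖⁻¹ * u₀ x) ^ 2) := by
    intro n
    have i1 : Integrable (fun x => ‖k n x‖ ^ 2) := (hv n).memLp_grad.integrable_norm_pow (by norm_num)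
    have i2 : Integrable (fun x => ‖g₀ x‖ ^ 2) := h₀.memLp_grad.integrable_norm_pow (by norm_num)
    have i3 : Integrable (fun x => inner ℝ (g₀ x) (k n x)) := by
      refine ((mul2 h₀.memLp_grad.norm (hv n).memLp_grad.norm)).mono
        (h₀.memLp_grad.1.inner (hv n).memLp_grad.1) (Eventually.of_forall fun x => ?_)
      refine (norm_inner_le_norm _ _).trans (le_of_eq ?_)
      simp
    have m1 := (hv n).memLp_hardy hN
    have m2 := h₀.memLp_hardy hN
    have i4 : Integrable (fun x => (‖x‖⁻¹ * v n x) ^ 2) := m1.integrable_sq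
    have i5 : Integrable (fun x => (‖x‖⁻¹ * u₀ x) ^ 2) := m2.integrable_sq
    have i6 : Integrable (fun x => ‖x‖⁻¹ * u₀ x * (‖x‖⁻¹ * v n x)) := mul2 m2 m1
    have e1 : ∫ x, ‖k n x - g₀ x‖ ^ 2 = (∫ x, ‖k n x‖ ^ 2) -
        2 * (∫ x, inner ℝ (g₀ x) (k n x)) + ∫ x, ‖g₀ x‖ ^ 2 := by
      have i7 : Integrable (fun x => ‖k n x‖ ^ 2 - 2 * inner ℝ (g₀ x) (k n x)) :=
        i1.sub (i3.const_mul 2)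
      rw [← integral_const_mul, ← integral_sub i1 (i3.const_mul 2), ← integral_add i7 i2]
      refine integral_congr_ae (Eventually.of_forall fun x => ?_)
      simp only
      rw [norm_sub_sq_real, real_inner_comm]
    have e2 : ∫ x, (‖x‖⁻¹ * (v n x - u₀ x)) ^ 2 = (∫ x, (‖x‖⁻¹ * v n x) ^ 2) -
        2 * (∫ x, ‖x‖⁻¹ * u₀ x * (‖x‖⁻¹ * v n x)) + ∫ x, (‖x‖⁻¹ * u₀ x) ^ 2 := by
      have i7 : Integrable
          (fun x => (‖x‖⁻¹ * v n x) ^ 2 - 2 * (‖x‖⁻¹ * u₀ x * (‖x‖⁻¹ * v n x))) :=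
        i4.sub (i6.const_mul 2)
      rw [← integral_const_mul, ← integral_sub i4 (i6.const_mul 2), ← integral_add i7 i5]
      refine integral_congr_ae (Eventually.of_forall fun x => ?_)
      simp only
      ring
    rw [energy, energy, e1, e2]
    ring
  simp_rw [key]
  have h1 := hg g₀ h₀.memLp_grad
  have h2 := hw _ (h₀.memLp_hardy hN)
  have h3 := ((h1.const_mul 2).sub_const (∫ x, ‖g₀ x‖ ^ 2)).sub
    (((h2.const_mul 2).sub_const (∫ x, (‖x‖⁻¹ * u₀ x) ^ 2)).const_mul lam)
  refine h3.trans (le_of_eq ?_)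
  congr 1
  rw [energy]
  simp_rw [real_inner_self_eq_norm_sq, ← sq]
  ring

end Energy

/-! ### Existence of a minimizer -/

section Minimizer

variable {N : ℕ} {lam : ℝ} {u : EuclideanSpace ℝ (Fin N) → ℝ}
  {g : EuclideanSpace ℝ (Fin N) → EuclideanSpace ℝ (Fin N)}

lemma normZ_sq_add_normY_sq (x : EuclideanSpace ℝ (Fin N)) :
    normZ x ^ 2 + normY x ^ 2 = ‖x‖ ^ 2 := by
  rw [normZ, normY, Real.sq_sqrt (Finset.sum_nonneg fun i _ => sq_nonneg _),
    Real.sq_sqrt (Finset.sum_nonneg fun i _ => sq_nonneg _), EuclideanSpace.norm_sq_eq,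
    ← Finset.sum_filter_add_sum_filter_not Finset.univ (fun i : Fin N => i.val < 2)]
  simp only [not_lt, Real.norm_eq_abs, sq_abs]

lemma quotientValues_nonempty (N : ℕ) (lam : ℝ) : (quotientValues N lam).Nonempty := by
  set u : EuclideanSpace ℝ (Fin N) → ℝ := fun x => Real.smoothTransition (2 - ‖x‖ ^ 2) with hu
  have ht : IsTest u := by
    refine ⟨Real.smoothTransition.contDiff.comp (contDiff_const.sub (contDiff_norm_sq ℝ)),
      HasCompactSupport.intro (isCompact_closedBall 0 2) fun x hx => ?_⟩
    rw [mem_closedBall_zero_iff, not_le] at hx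
    exact Real.smoothTransition.zero_of_nonpos (by nlinarith)
  refine ⟨_, u, ⟨⟨_, ht.hasDirichletGrad⟩,
    fun a b => Real.smoothTransition (2 - (a ^ 2 + b ^ 2)), Eventually.of_forall fun x => ?_⟩,
    fun h0 => ?_, rfl⟩
  · simp only [hu, normZ_sq_add_normY_sq]
  · have h1 := congrFun ((Continuous.ae_eq_iff_eq volume ht.continuous continuous_const).1 h0) 0
    simp only [hu, norm_zero] at h1
    rw [Real.smoothTransition.one_of_one_le (by norm_num)] at h1
    exact one_ne_zero h1

lemma quotientValues_nonneg (hN : 3 ≤ N) (hlam : lam < ((N : ℝ) - 2) ^ 2 / 4) {q : ℝ}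
    (hq : q ∈ quotientValues N lam) : 0 ≤ q := by
  obtain ⟨u, ⟨⟨g, h⟩, -⟩, -, rfl⟩ := hq
  rw [quotient_eq hN h]
  exact div_nonneg (energy_nonneg hN hlam h) (Real.rpow_nonneg (mass_nonneg u) _)

lemma bddBelow_quotientValues (hN : 3 ≤ N) (hlam : lam < ((N : ℝ) - 2) ^ 2 / 4) :
    BddBelow (quotientValues N lam) :=
  ⟨0, fun _ hq => quotientValues_nonneg hN hlam hq⟩

/-- The form without division also covers `u = 0`, as needed for the differences `u n - u₀`. -/
lemma Scirc_mul_le (hN : 3 ≤ N) (hlam : lam < ((N : ℝ) - 2) ^ 2 / 4) (h : HasDirichletGrad u g)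
    (hu : IsCirc u) : Scirc N lam * mass u ^ (2 / critExp N) ≤ energy lam u g := by
  have hp := two_lt_critExp hN
  by_cases h0 : u =ᵐ[volume] 0
  · rw [mass_eq_zero hN h0, Real.zero_rpow (by positivity), mul_zero]
    exact energy_nonneg hN hlam h
  · rw [← le_div_iff₀ (Real.rpow_pos_of_pos (mass_pos hN h h0) _), ← quotient_eq hN h]
    exact csInf_le (bddBelow_quotientValues hN hlam) ⟨u, ⟨⟨g, h⟩, hu⟩, h0, rfl⟩

/-- A normalized minimizing sequence. -/
lemma exists_minimizing_seq (hN : 3 ≤ N) (hlam : lam < ((N : ℝ) - 2) ^ 2 / 4) :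
    ∃ (u : ℕ → EuclideanSpace ℝ (Fin N) → ℝ)
      (g : ℕ → EuclideanSpace ℝ (Fin N) → EuclideanSpace ℝ (Fin N)),
      (∀ n, HasDirichletGrad (u n) (g n)) ∧ (∀ n, IsCirc (u n)) ∧ (∀ n, mass (u n) = 1) ∧
        Tendsto (fun n => energy lam (u n) (g n)) atTop (𝓝 (Scirc N lam)) := by
  have hp := two_lt_critExp hN
  obtain ⟨q, -, hq, hqm⟩ := exists_seq_tendsto_sInf (quotientValues_nonempty N lam)
    (bddBelow_quotientValues hN hlam)
  choose u hu h0 hqu using hqm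
  choose g hg using fun n => (hu n).1
  -- The multiple that normalizes the mass to one; by homogeneity the energy then equals the
  -- quotient.
  set c : ℕ → ℝ := fun n => mass (u n) ^ (-(1 / critExp N)) with hc
  have hm : ∀ n, 0 < mass (u n) := fun n => mass_pos hN (hg n) (h0 n)
  have hcpos : ∀ n, 0 < c n := fun n => Real.rpow_pos_of_pos (hm n) _
  refine ⟨fun n x => c n * u n x, fun n x => c n • g n x, fun n => (hg n).const_mul (c n),
    fun n => IsCirc.const_mul (hu n).2 (c n), fun n => ?_, ?_⟩
  · rw [mass_const_mul, abs_of_pos (hcpos n), hc, ← Real.rpow_mul (hm n).le,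
      show -(1 / critExp N) * critExp N = -1 by field_simp, Real.rpow_neg_one,
      inv_mul_cancel₀ (hm n).ne']
  · refine hq.congr fun n => ?_
    rw [energy_const_mul, ← hqu n, quotient_eq hN (hg n), hc, ← Real.rpow_natCast,
      ← Real.rpow_mul (hm n).le, div_eq_inv_mul, ← Real.rpow_neg (hm n).le]
    congr 2
    push_cast
    ring

/-- Up to a dilation, a fixed part of the mass lies in a fixed annulus. -/
lemma exists_dilate_annulus (hN : 3 ≤ N) {K : ℝ≥0∞} (hK : K ≠ ⊤) : ∃ δ : ℝ≥0∞, δ ≠ 0 ∧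
    ∀ (u : EuclideanSpace ℝ (Fin N) → ℝ) (g : EuclideanSpace ℝ (Fin N) → EuclideanSpace ℝ (Fin N)),
      HasDirichletGrad u g → eLpNorm g 2 volume ≤ K → 1 ≤ ∫⁻ x, ‖u x‖ₑ ^ critExp N →
        ∃ s : ℝ, 0 < s ∧ δ ≤ ∫⁻ x in {x | 1 / 2 ≤ ‖x‖ ∧ ‖x‖ ≤ 4},
          ‖s ^ (((N : ℝ) - 2) / 2) * u (s • x)‖ₑ ^ critExp N := by
  obtain ⟨C, hC⟩ := exists_annuli_const hN
  have hθ := one_sub_two_div_critExp_pos hN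
  have hB : (C : ℝ≥0∞) * K ^ 2 ≠ ⊤ := ENNReal.mul_ne_top (by simp) (by finiteness)
  set B : ℝ≥0∞ := C * K ^ 2 + 1 with hBdef
  have hBt : B ≠ ⊤ := by finiteness
  have hB0 : B⁻¹ ≠ 0 := ENNReal.inv_ne_zero.2 hBt
  have hBi : B⁻¹ ≠ ⊤ := ENNReal.inv_ne_top.2 (by simp [hBdef])
  -- Chosen so that its power `1 - 2/2*` is `1/B`. If every annular mass were smaller, the total
  -- mass would be at most `C K²/B < 1`, since `B = C K² + 1`.
  refine ⟨B⁻¹ ^ (1 - 2 / critExp N)⁻¹, (ENNReal.rpow_pos (pos_iff_ne_zero.2 hB0) hBi).ne',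
    fun u g h hg h1 => ?_⟩
  by_contra! hcon
  have h2 := hC u g h (B⁻¹ ^ (1 - 2 / critExp N)⁻¹)
    (ENNReal.rpow_ne_top_of_nonneg (by positivity) hBi) fun t => by
      have := lintegral_annularCutoff_dilate hN u (Real.exp_pos t)
      rw [← Real.exp_neg] at this
      exact this.trans (hcon _ (Real.exp_pos t)).le
  rw [← ENNReal.rpow_mul, inv_mul_cancel₀ hθ.ne', ENNReal.rpow_one] at h2
  refine absurd (h1.trans h2) (not_le.2 ?_)
  calc B⁻¹ * (C * eLpNorm g 2 volume ^ 2) ≤ B⁻¹ * (C * K ^ 2) := by gcongr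
    _ = C * K ^ 2 / B := by rw [mul_comm, div_eq_mul_inv]
    _ < 1 := by
      refine ENNReal.div_lt_of_lt_mul ?_
      rw [one_mul]
      exact ENNReal.lt_add_right hB one_ne_zero

/-- By symmetry, a bounded sequence that vanishes in `L²_loc` does not concentrate away from the
origin. -/
lemma lintegral_annulus_not_ge (hN : 4 ≤ N) {v : ℕ → EuclideanSpace ℝ (Fin N) → ℝ}
    {k : ℕ → EuclideanSpace ℝ (Fin N) → EuclideanSpace ℝ (Fin N)}
    (hv : ∀ n, HasDirichletGrad (v n) (k n)) (hc : ∀ n, IsCirc (v n)) {K : ℝ≥0∞} (hK : K ≠ ⊤)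
    (hk : ∀ n, eLpNorm (k n) 2 volume ≤ K) (h1 : ∀ n, ∫⁻ x, ‖v n x‖ₑ ^ critExp N ≤ 1)
    (hb : Tendsto (fun n => eLpNorm (v n) 2 (volume.restrict (Metric.ball 0 6))) atTop (𝓝 0))
    {δ : ℝ≥0∞} (hδ : δ ≠ 0)
    (h : ∀ n, δ ≤ ∫⁻ x in {x | 1 / 2 ≤ ‖x‖ ∧ ‖x‖ ≤ 4}, ‖v n x‖ₑ ^ critExp N) : False := by
  obtain ⟨C, hC⟩ := exists_symmetric_annulus_const hN
  have hθ := one_sub_two_div_critExp_pos (show 3 ≤ N by omega)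
  have hB : (C : ℝ≥0∞) * K ^ 2 ≠ ⊤ := ENNReal.mul_ne_top (by simp) (by finiteness)
  have key : ∀ m : ℕ, 0 < m →
      δ ≤ ((m : ℝ≥0∞)⁻¹) ^ (1 - 2 / critExp N) * (C * K ^ 2) := by
    intro m hm
    obtain ⟨D, hD⟩ := hC m hm
    have hmt : ((m : ℝ≥0∞)⁻¹) ^ (1 - 2 / critExp N) ≠ ⊤ :=
      ENNReal.rpow_ne_top_of_nonneg hθ.le (ENNReal.inv_ne_top.2 (by simpa using hm.ne'))
    -- The limit in `n` is taken with `m` fixed, since `D` depends on `m`; only afterwards does `m`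
    -- tend to infinity.
    have ht : Tendsto (fun n => ((m : ℝ≥0∞)⁻¹) ^ (1 - 2 / critExp N) * (C * K ^ 2 +
        D * eLpNorm (v n) 2 (volume.restrict (Metric.ball 0 6)) ^ 2)) atTop
        (𝓝 (((m : ℝ≥0∞)⁻¹) ^ (1 - 2 / critExp N) * (C * K ^ 2 + D * 0 ^ 2))) :=
      ENNReal.Tendsto.const_mul (tendsto_const_nhds.add (ENNReal.Tendsto.const_mul
        (ENNReal.Tendsto.pow hb) (Or.inr (by simp)))) (Or.inr hmt)
    have h2 := ge_of_tendsto ht (Eventually.of_forall fun n => (h n).trans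
      ((hD (v n) (k n) (hv n) (hc n)).trans ?_))
    · simpa using h2
    · have h3 : (m : ℝ≥0∞)⁻¹ * ∫⁻ x, ‖v n x‖ₑ ^ critExp N ≤ (m : ℝ≥0∞)⁻¹ :=
        mul_le_of_le_one_right zero_le (h1 n)
      have h4 := hk n
      gcongr
  have hlim : Tendsto (fun m : ℕ => ((m : ℝ≥0∞)⁻¹) ^ (1 - 2 / critExp N) * (C * K ^ 2)) atTop
      (𝓝 (0 ^ (1 - 2 / critExp N) * (C * K ^ 2))) :=
    ENNReal.Tendsto.mul_const
      ((ENNReal.continuous_rpow_const.tendsto 0).comp ENNReal.tendsto_inv_nat_nhds_zero)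
      (Or.inr hB)
  rw [ENNReal.zero_rpow_of_pos hθ, zero_mul] at hlim
  have := ge_of_tendsto hlim ((eventually_gt_atTop 0).mono key)
  exact hδ (le_zero_iff.1 this)

/-- A bounded minimizing sequence with a nonvanishing part of the mass in a fixed annulus. -/
lemma exists_annular_minimizing_seq (hN : 3 ≤ N) (hlam : lam < ((N : ℝ) - 2) ^ 2 / 4) :
    ∃ (u : ℕ → EuclideanSpace ℝ (Fin N) → ℝ)
      (g : ℕ → EuclideanSpace ℝ (Fin N) → EuclideanSpace ℝ (Fin N)) (K δ : ℝ≥0∞),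
      K ≠ ⊤ ∧ δ ≠ 0 ∧ (∀ n, HasDirichletGrad (u n) (g n)) ∧ (∀ n, IsCirc (u n)) ∧
        (∀ n, mass (u n) = 1) ∧
        Tendsto (fun n => energy lam (u n) (g n)) atTop (𝓝 (Scirc N lam)) ∧
        (∀ n, eLpNorm (g n) 2 volume ≤ K) ∧
        ∀ n, δ ≤ ∫⁻ x in {x | 1 / 2 ≤ ‖x‖ ∧ ‖x‖ ≤ 4}, ‖u n x‖ₑ ^ critExp N := by
  obtain ⟨u, g, hu, hc, hm, hS⟩ := exists_minimizing_seq hN hlam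
  obtain ⟨c, hc0, hcoer⟩ := exists_coercive hN hlam
  obtain ⟨E, hE⟩ := hS.bddAbove_range
  have hg : ∀ n, eLpNorm (g n) 2 volume ≤ ENNReal.ofReal √(E / c) := by
    intro n
    rw [← ENNReal.ofReal_toReal (hu n).memLp_grad.2.ne]
    refine ENNReal.ofReal_le_ofReal (Real.le_sqrt_of_sq_le ?_)
    rw [le_div_iff₀ hc0, mul_comm]
    exact (hcoer _ _ (hu n)).trans (hE ⟨n, rfl⟩)
  obtain ⟨δ, hδ, hdil⟩ := exists_dilate_annulus hN (ENNReal.ofReal_ne_top (r := √(E / c)))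
  choose s hs hsδ using fun n => hdil (u n) (g n) (hu n) (hg n)
    (by rw [← ofReal_mass hN (hu n), hm n, ENNReal.ofReal_one])
  refine ⟨fun n x => s n ^ (((N : ℝ) - 2) / 2) * u n (s n • x),
    fun n x => s n ^ ((N : ℝ) / 2) • g n (s n • x), ENNReal.ofReal √(E / c), δ, by simp, hδ,
    fun n => (hu n).dilate hN (hs n), fun n => (hc n).dilate (hs n) _,
    fun n => (mass_dilate hN (hu n) (hs n)).trans (hm n),
    hS.congr fun n => (energy_dilate hN (hu n) (hs n)).symm, fun n => ?_, hsδ⟩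
  exact (eLpNorm_dilate_two (g n) (hs n)).trans_le (hg n)

/-- Subadditivity of powers with exponent in `[0, 1]`; it rules out any gain from splitting the
mass. -/
lemma one_le_rpow_add_rpow {a t : ℝ} (ha : 0 ≤ a) (ha1 : a ≤ 1) (ht : 0 ≤ t) (ht1 : t ≤ 1) :
    1 ≤ a ^ t + (1 - a) ^ t := by
  have h := Real.rpow_add_le_add_rpow ha (sub_nonneg.2 ha1) ht ht1
  rwa [add_sub_cancel, Real.one_rpow] at h

theorem exists_minimizer (hN : 4 ≤ N) (hlam : lam < ((N : ℝ) - 2) ^ 2 / 4) :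
    ∃ u : EuclideanSpace ℝ (Fin N) → ℝ, MemD12Circ u ∧ ¬ u =ᵐ[volume] 0 ∧
      quotient lam u = Scirc N lam := by
  have hN3 : 3 ≤ N := by omega
  have hp := two_lt_critExp hN3
  have ht0 : 0 ≤ 2 / critExp N := by positivity
  have ht1 : 2 / critExp N ≤ 1 := by linarith [one_sub_two_div_critExp_pos hN3]
  obtain ⟨u, g, K, δ, hK, hδ, hu, hc, hm, hS, hg, hann⟩ := exists_annular_minimizing_seq hN3 hlam
  obtain ⟨u₀, g₀, ns, hns, h₀, hw, hwg⟩ := exists_weak_limit hN3 hu hK hg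
  have hd : ∀ n, HasDirichletGrad (fun x => u (ns n) x - u₀ x) (fun x => g (ns n) x - g₀ x) :=
    fun n => (hu (ns n)).sub hN3 h₀
  set K' : ℝ≥0∞ := K + eLpNorm g₀ 2 volume with hK'def
  have hK' : K' ≠ ⊤ := ENNReal.add_ne_top.2 ⟨hK, h₀.memLp_grad.2.ne⟩
  have hdK : ∀ n, eLpNorm (fun x => g (ns n) x - g₀ x) 2 volume ≤ K' := fun n =>
    (eLpNorm_sub_le (hu (ns n)).memLp_grad.1 h₀.memLp_grad.1 (by norm_num)).trans
      (add_le_add_left (hg (ns n)) _)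
  have mul2 : ∀ {f f' : EuclideanSpace ℝ (Fin N) → ℝ}, MemLp f 2 volume → MemLp f' 2 volume →
      Integrable (fun x => f x * f' x) := fun hf hf' =>
    memLp_one_iff_integrable.1 (hf'.smul (p := 2) (q := 2) hf)
  have hdw : ∀ f : EuclideanSpace ℝ (Fin N) → ℝ, MemLp f 2 volume →
      Tendsto (fun n => ∫ x, f x * (‖x‖⁻¹ * (u (ns n) x - u₀ x))) atTop (𝓝 0) := by
    intro f hf
    have := (hw f hf).sub_const (∫ x, f x * (‖x‖⁻¹ * u₀ x))
    rw [sub_self] at this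
    refine this.congr fun n => ?_
    rw [← integral_sub (mul2 hf ((hu (ns n)).memLp_hardy hN3)) (mul2 hf (h₀.memLp_hardy hN3))]
    simp only [mul_sub]
  have hball := tendsto_eLpNorm_ball_of_weak hN3 hd hK' hdK hdw
  obtain ⟨ms, hms, hae⟩ := exists_seq_tendsto_ae_of_ball hN3 hd hK' hdK hball
  have hlim : ∀ᵐ x, Tendsto (fun n => u (ns (ms n)) x) atTop (𝓝 (u₀ x)) := by
    filter_upwards [hae] with x hx
    simpa using hx.add_const (u₀ x)
  -- Symmetry passes to the limit through almost everywhere convergence along the further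
  -- subsequence `ms`.
  have hc₀ : IsCirc u₀ := IsCirc.of_tendsto (fun n => hc (ns (ms n))) hlim
  -- If `u₀ = 0`, the sequence itself tends to zero in `L²` of the ball of radius 6, which
  -- contradicts the mass retained in the annulus.
  have hne : ¬ u₀ =ᵐ[volume] 0 := by
    intro h0
    refine lintegral_annulus_not_ge hN (fun n => hu (ns n)) (fun n => hc (ns n)) hK
      (fun n => hg (ns n)) (fun n => ?_) ((hball 6).congr fun n => ?_) hδ (fun n => hann (ns n))
    · rw [← ofReal_mass hN3 (hu (ns n)), hm, ENNReal.ofReal_one]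
    · refine eLpNorm_congr_ae (ae_restrict_of_ae ?_)
      filter_upwards [h0] with x hx
      rw [hx, Pi.zero_apply, sub_zero]
  set S := Scirc N lam with hSdef
  set E₀ := energy lam u₀ g₀
  set a := mass u₀
  have ha : 0 < a := mass_pos hN3 h₀ hne
  have hS0 : 0 ≤ S := Real.sInf_nonneg fun q hq => quotientValues_nonneg hN3 hlam hq
  have hmass : Tendsto (fun n => mass (fun x => u (ns (ms n)) x - u₀ x)) atTop (𝓝 (1 - a)) := by
    obtain ⟨C, hC⟩ := exists_sobolev_const hN3
    have hb : ∀ n, mass (fun x => u (ns (ms n)) x - u₀ x) ≤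
        (C * K' : ℝ≥0∞).toReal ^ critExp N := by
      intro n
      rw [mass_eq hN3 (hd (ms n))]
      refine Real.rpow_le_rpow ENNReal.toReal_nonneg (ENNReal.toReal_mono
        (ENNReal.mul_ne_top (by simp) hK') ?_) (by positivity)
      exact (hC _ _ (hd (ms n))).trans (by gcongr; exact hdK (ms n))
    have := brezis_lieb (by linarith) (fun n => (hu (ns (ms n))).memLp_fun) h₀.memLp_fun hb hlim
    have h2 := (tendsto_const_nhds (x := (1 : ℝ))).sub this
    refine h2.congr fun n => ?_
    have h3 : ∫ x, |u (ns (ms n)) x| ^ critExp N = 1 := hm (ns (ms n))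
    rw [h3, sub_sub_cancel, mass]
  have ha1 : a ≤ 1 := sub_nonneg.1 (ge_of_tendsto hmass (Eventually.of_forall fun n => mass_nonneg _))
  have henergy : Tendsto (fun n => energy lam (fun x => u (ns (ms n)) x - u₀ x)
      (fun x => g (ns (ms n)) x - g₀ x)) atTop (𝓝 (S - E₀)) := by
    have h1 := tendsto_energy_sub (lam := lam) hN3 h₀ (fun n => hu (ns (ms n)))
      (fun f hf => (hw f hf).comp hms.tendsto_atTop)
      (fun f hf => (hwg f hf).comp hms.tendsto_atTop)
    refine ((hS.comp (hns.comp hms).tendsto_atTop).sub h1).congr fun n => ?_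
    simp only [Function.comp, sub_sub_cancel]
  -- Each remainder is an admissible symmetric function, so its energy is at least `S` times the
  -- power of its mass; pass to the limit.
  have hle : S * (1 - a) ^ (2 / critExp N) ≤ S - E₀ :=
    le_of_tendsto_of_tendsto ((hmass.rpow_const (Or.inr ht0)).const_mul S) henergy
      (Eventually.of_forall fun n =>
        Scirc_mul_le hN3 hlam (hd (ms n)) ((hc (ns (ms n))).sub hc₀))
  refine ⟨u₀, ⟨⟨g₀, h₀⟩, hc₀⟩, hne, ?_⟩
  have hapos : 0 < a ^ (2 / critExp N) := Real.rpow_pos_of_pos ha _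
  rw [quotient_eq hN3 h₀, div_eq_iff hapos.ne']
  refine le_antisymm ?_ (Scirc_mul_le hN3 hlam h₀ hc₀)
  -- Only `S ≥ 0` is used: `S ≤ S a^t + S (1 - a)^t` together with `hle` leaves `E₀ ≤ S a^t`.
  have h5 := mul_le_mul_of_nonneg_left (one_le_rpow_add_rpow ha.le ha1 ht0 ht1) hS0
  rw [mul_one, mul_add] at h5
  change E₀ ≤ _
  linarith

end Minimizer

end HardySobolev

end

/-! ### Finiteness and attainment of the infimum -/

theorem lemma6p1 (N : ℕ) (hN : 4 ≤ N) (lam : ℝ) (hlam : lam < ((N : ℝ) - 2) ^ 2 / 4) :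
    BddBelow (HardySobolev.quotientValues N lam) ∧
      ∃ u : EuclideanSpace ℝ (Fin N) → ℝ, HardySobolev.MemD12Circ u ∧ ¬ u =ᵐ[volume] 0 ∧
        HardySobolev.quotient lam u = HardySobolev.Scirc N lam := by
  exact ⟨HardySobolev.bddBelow_quotientValues (by omega) hlam,
    HardySobolev.exists_minimizer hN hlam⟩
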